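/- Let $\Sigma$ be a compact Hausdorff smooth $n$-manifold without boundary and let $x:\Sigma\to\mathbb{C}^n$ be a smooth Lagrangian immersion: for the complex structure $J$ and the Kähler form $\overline\omega(v,w)=\langle Jv,w\rangle$ of $\mathbb{C}^n$ one has $x^*\overline\omega=0$. Let $g$ be the induced metric, $d\mu$ its Riemannian measure, $^\top$ and $^\perp$ the tangential and normal projections, $h_{ij}$ the second fundamental form and $H=\sum_i h_{ii}$ the mean curvature vector in local orthonormal tangent frames $\{e_i\}$. Assume that $\Sigma$ is a self-shrinker that becomes extinct at $(x_0,t_0)$, with $x_0\in\mathbb{C}^n$ and $t_0>0$, i.e. $H+\frac{(x-x_0)^\perp}{2t_0}=0$. For a smooth normal vector field $X$ along $x$, with $\nabla$ and $\triangle$ the connection and the Laplacian of the normal bundle, put $$LX=\triangle X+\sum_{i,j}\langle X,h_{ij}\rangle h_{ij}-\sum_i\Big\langle \frac{x-x_0}{2t_0},e_i\Big\rangle\nabla_{e_i}X+\frac1{2t_0}X,$$ and for $y\in\mathbb{C}^n$ and $h\in\mathbb{R}$ let $$F''(X,y,h)=\int_\Sigma\Big[-\langle X,LX\rangle+\frac1{t_0}\langle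 X,y\rangle-\frac{2h}{t_0}\langle X,H\rangle-\frac1{2t_0}|y^\perp|^2-\frac{h^2}{t_0}|H|^2\Big](4\pi t_0)^{-\frac n2}e^{-\frac{|x-x_0|^2}{4t_0}}\,d\mu .$$ This is the second variation at $\Sigma$ of $F_{x_0,t_0}(\Sigma)=\int_\Sigma(4\pi t_0)^{-\frac n2}e^{-\frac{|x-x_0|^2}{4t_0}}d\mu$ when $\Sigma$, $x_0$ and $t_0$ vary with velocities $X$, $y$ and $h$. The field $X$ is called a Lagrangian (resp. Hamiltonian) variation if the one-form $-i_X\overline\omega$ on $\Sigma$ is closed (resp. exact), and $\Sigma$ is called Lagrangian (resp. Hamiltonian) F-stable if for every Lagrangian (resp. Hamiltonian) variation $X$ there exist $y\in\mathbb{C}^n$ and $h\in\mathbb{R}$ with $F''(X,y,h)\ge 0$. **Theorem.** If the first Betti number is $b_1(\Sigma)=1$, then $\Sigma$ is Lagrangian F-stable if and only if it is Hamiltonian F-stable. -/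

import Mathlib

open MeasureTheory
open scoped Manifold ContDiff InnerProductSpace

noncomputable section

namespace LagrangianShrinker

/-! ## Extrinsic geometry of an immersion `x : M → V`

`M` is a manifold of dimension `n` without boundary, `V` a Euclidean space. Tangent vectors of the
immersed submanifold are regarded as vectors of `V` through the differential of `x`. -/

section Euclidean

variable (n : ℕ) {M : Type*} [TopologicalSpace M] [ChartedSpace (EuclideanSpace ℝ (Fin n)) M]
  {V : Type*} [NormedAddCommGroup V] [InnerProductSpace ℝ V]

/-- A smooth immersion: a `C^∞` map whose differential is injective at each point. -/
def IsSmoothImmersion (x : M → V) : Prop :=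
  ContMDiff (𝓡 n) 𝓘(ℝ, V) ∞ x ∧
    ∀ p : M, Function.Injective (mfderiv (𝓡 n) 𝓘(ℝ, V) x p)

/-- The tangent plane of the immersed submanifold at `p`, as a subspace of `V`. -/
def tangentPlane (x : M → V) (p : M) : Submodule ℝ V :=
  LinearMap.range
    (show EuclideanSpace ℝ (Fin n) →L[ℝ] V from mfderiv (𝓡 n) 𝓘(ℝ, V) x p).toLinearMap

instance (x : M → V) (p : M) : FiniteDimensional ℝ (tangentPlane n x p) := by
  unfold tangentPlane; infer_instance

/-- The tangential projection `w ↦ w^⊤` at `p`. -/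
def tangentialPart (x : M → V) (p : M) : V →L[ℝ] V :=
  (tangentPlane n x p).starProjection

/-- The normal projection `w ↦ w^⊥` at `p`. -/
def normalPart (x : M → V) (p : M) : V →L[ℝ] V :=
  (tangentPlane n x p)ᗮ.starProjection

theorem exists_lift (x : M → V) (p : M) (w : V) :
    ∃ v : TangentSpace (𝓡 n) p, mfderiv (𝓡 n) 𝓘(ℝ, V) x p v = tangentialPart n x p w := by
  have h : tangentialPart n x p w ∈ tangentPlane n x p :=
    Submodule.starProjection_apply_mem _ _
  exact h

/-- The tangent vector `v ∈ T_p M` with `dx (v) = w^⊤` (it is unique for an immersion). -/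
def tangentLift (x : M → V) (p : M) (w : V) : TangentSpace (𝓡 n) p :=
  (exists_lift n x p w).choose

/-- The Euclidean derivative at `p` of a vector-valued map `Y` on `M` in the direction `w^⊤`. -/
def dirDeriv (x : M → V) (Y : M → V) (p : M) (w : V) : V :=
  mfderiv (𝓡 n) 𝓘(ℝ, V) Y p (tangentLift n x p w)

/-- The second fundamental form `h(v, w) = (D_v W)^⊥`, where the tangent field
`W = w^⊤` extends the tangent vector `w`. -/
def secondFundamentalForm (x : M → V) (p : M) (v w : V) : V :=
  normalPart n x p (dirDeriv n x (fun q => tangentialPart n x q w) p v)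

/-- An orthonormal basis `e_i` of the tangent plane at `p`. -/
def tangentFrame (x : M → V) (p : M) (i : Fin (Module.finrank ℝ (tangentPlane n x p))) : V :=
  (stdOrthonormalBasis ℝ (tangentPlane n x p) i : V)

/-- The mean curvature vector `H = ∑ i, h(e_i, e_i)`. -/
def meanCurvature (x : M → V) (p : M) : V :=
  ∑ i, secondFundamentalForm n x p (tangentFrame n x p i) (tangentFrame n x p i)

/-- The normal connection `∇_v X = (D_v X)^⊥`. -/
def normalDeriv (x : M → V) (X : M → V) (p : M) (v : V) : V :=
  normalPart n x p (dirDeriv n x X p v)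

/-- The second covariant derivative `∇_v (∇_W X) - ∇_{∇_v W} X` in the normal bundle, where the
tangent field `W = w^⊤` extends the tangent vector `w` and `∇_v W = (D_v W)^⊤`. -/
def normalHessian (x : M → V) (X : M → V) (p : M) (v w : V) : V :=
  normalDeriv n x (fun q => normalDeriv n x X q w) p v
    - normalDeriv n x X p
        (tangentialPart n x p (dirDeriv n x (fun q => tangentialPart n x q w) p v))

/-- The Laplacian of the normal bundle. -/
def normalLaplacian (x : M → V) (X : M → V) (p : M) : V :=
  ∑ i, normalHessian n x X p (tangentFrame n x p i) (tangentFrame n x p i)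

/-- The operator
`L X = Δ X + ⟨X, h_ij⟩ h_ij - ⟨(x - x₀) / (2 t₀), e_i⟩ ∇_{e_i} X + X / (2 t₀)`. -/
def jacobiOperator (x : M → V) (x₀ : V) (t₀ : ℝ) (X : M → V) (p : M) : V :=
  normalLaplacian n x X p
    + (∑ i, ∑ j,
        ⟪X p, secondFundamentalForm n x p (tangentFrame n x p i) (tangentFrame n x p j)⟫_ℝ •
          secondFundamentalForm n x p (tangentFrame n x p i) (tangentFrame n x p j))
    - (∑ i, ⟪(1 / (2 * t₀)) • (x p - x₀), tangentFrame n x p i⟫_ℝ •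
        normalDeriv n x X p (tangentFrame n x p i))
    + (1 / (2 * t₀)) • X p

/-- A self-shrinker that becomes extinct at `(x₀, t₀)`: `H + (x - x₀)^⊥ / (2 t₀) = 0`. -/
def IsSelfShrinker (x : M → V) (x₀ : V) (t₀ : ℝ) : Prop :=
  ∀ p, meanCurvature n x p + (1 / (2 * t₀)) • normalPart n x p (x p - x₀) = 0

/-- The matrix `g_ij = ⟨∂_i F, ∂_j F⟩` of the metric induced by a parametrization `F`. -/
def gramMatrix (F : EuclideanSpace ℝ (Fin n) → V) (u : EuclideanSpace ℝ (Fin n)) :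
    Matrix (Fin n) (Fin n) ℝ :=
  Matrix.of fun i j =>
    ⟪fderiv ℝ F u (EuclideanSpace.single i 1), fderiv ℝ F u (EuclideanSpace.single j 1)⟫_ℝ

/-- The Riemannian measure of the induced metric. In the domain of each chart it is
`√(det g_ij) du`; these measures agree on overlaps, and their least upper bound in the lattice of
measures glues them to a measure on `M`. -/
def inducedVolume [MeasurableSpace M] (x : M → V) : Measure M :=
  ⨆ q : M, Measure.map (chartAt (EuclideanSpace ℝ (Fin n)) q).symm
    ((volume.restrict (chartAt (EuclideanSpace ℝ (Fin n)) q).target).withDensity fun u =>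
      ENNReal.ofReal √(gramMatrix n (x ∘ (chartAt (EuclideanSpace ℝ (Fin n)) q).symm) u).det)

/-- The weight `(4 π t₀)^{-n/2} exp (-|x - x₀|² / (4 t₀))`. -/
def gaussianWeight (x : M → V) (x₀ : V) (t₀ : ℝ) (p : M) : ℝ :=
  (4 * Real.pi * t₀) ^ (-(n : ℝ) / 2) * Real.exp (-‖x p - x₀‖ ^ 2 / (4 * t₀))

/-- The second variation `F''` of the functional
`F_{x₀,t₀} = ∫ (4 π t₀)^{-n/2} exp (-|x - x₀|² / (4 t₀)) dμ` at a self-shrinker that becomes extinct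
at `(x₀, t₀)`, for a variation of the submanifold, of `x₀` and of `t₀` with velocities `X`, `y`
and `h`. -/
def secondVariation [MeasurableSpace M] (x : M → V) (x₀ : V) (t₀ : ℝ)
    (X : M → V) (y : V) (h : ℝ) : ℝ :=
  ∫ p, (-⟪X p, jacobiOperator n x x₀ t₀ X p⟫_ℝ
      + (1 / t₀) * ⟪X p, y⟫_ℝ
      - (2 / t₀) * h * ⟪X p, meanCurvature n x p⟫_ℝ
      - (1 / (2 * t₀)) * ‖normalPart n x p y‖ ^ 2
      - (1 / t₀) * h ^ 2 * ‖meanCurvature n x p‖ ^ 2) * gaussianWeight n x x₀ t₀ p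
    ∂(inducedVolume n x)

/-- A smooth normal vector field along `x`. -/
def IsNormalField (x : M → V) (X : M → V) : Prop :=
  ContMDiff (𝓡 n) 𝓘(ℝ, V) ∞ X ∧ ∀ p, X p ∈ (tangentPlane n x p)ᗮ

end Euclidean

/-! ## One-forms and the first Betti number -/

section Forms

variable (n : ℕ) (M : Type*) [TopologicalSpace M] [ChartedSpace (EuclideanSpace ℝ (Fin n)) M]

/-- One-forms on `M` (no regularity). -/
abbrev OneForm : Type _ := ∀ p : M, TangentSpace (𝓡 n) p →L[ℝ] ℝ

variable {M}

/-- The expression `∑ i, θ_i du^i` of a one-form in the chart at `q` (its pullback by the inverse of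
the chart). -/
def chartForm (θ : OneForm n M) (q : M) (u : EuclideanSpace ℝ (Fin n)) :
    EuclideanSpace ℝ (Fin n) →L[ℝ] ℝ :=
  (θ ((chartAt (EuclideanSpace ℝ (Fin n)) q).symm u)).comp
    (mfderiv (𝓡 n) (𝓡 n) (chartAt (EuclideanSpace ℝ (Fin n)) q).symm u)

theorem chartForm_add (θ η : OneForm n M) (q : M) :
    chartForm n (θ + η) q = chartForm n θ q + chartForm n η q := by
  funext u; ext v; rfl

theorem chartForm_smul (c : ℝ) (θ : OneForm n M) (q : M) :
    chartForm n (c • θ) q = c • chartForm n θ q := by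
  funext u; ext v; rfl

/-- A smooth closed one-form: in each chart its coefficients are smooth and
`dθ (v, w) = D_v θ (w) - D_w θ (v)` vanishes. -/
def IsClosedForm (θ : OneForm n M) : Prop :=
  ∀ q : M,
    ContDiffOn ℝ ∞ (chartForm n θ q) (chartAt (EuclideanSpace ℝ (Fin n)) q).target ∧
    ∀ u ∈ (chartAt (EuclideanSpace ℝ (Fin n)) q).target, ∀ v w : EuclideanSpace ℝ (Fin n),
      fderiv ℝ (chartForm n θ q) u v w - fderiv ℝ (chartForm n θ q) u w v = 0

/-- An exact one-form: `θ = du` for a smooth function `u`. -/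
def IsExactForm (θ : OneForm n M) : Prop :=
  ∃ u : M → ℝ, ContMDiff (𝓡 n) 𝓘(ℝ, ℝ) ∞ u ∧ ∀ p, θ p = mfderiv (𝓡 n) 𝓘(ℝ, ℝ) u p

variable (M)

/-- The space of smooth closed one-forms. -/
def closedForms : Submodule ℝ (OneForm n M) where
  carrier := {θ | IsClosedForm n θ}
  zero_mem' := by
    intro q
    have h : chartForm n (0 : OneForm n M) q = fun _ => 0 := by
      funext u; ext v; rfl
    rw [h]
    exact ⟨contDiffOn_const, fun u _ v w => by simp⟩
  add_mem' := by
    intro θ η hθ hη q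
    obtain ⟨h1, h2⟩ := hθ q
    obtain ⟨h3, h4⟩ := hη q
    rw [chartForm_add]
    refine ⟨h1.add h3, fun u hu v w => ?_⟩
    have hnhds := (chartAt (EuclideanSpace ℝ (Fin n)) q).open_target.mem_nhds hu
    have d1 := (h1.contDiffAt hnhds).differentiableAt (by simp)
    have d3 := (h3.contDiffAt hnhds).differentiableAt (by simp)
    rw [fderiv_add d1 d3]
    have e2 := h2 u hu v w
    have e4 := h4 u hu v w
    simp only [add_apply]
    linarith
  smul_mem' := by
    intro c θ hθ q
    obtain ⟨h1, h2⟩ := hθ q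
    rw [chartForm_smul]
    refine ⟨h1.const_smul c, fun u hu v w => ?_⟩
    have hnhds := (chartAt (EuclideanSpace ℝ (Fin n)) q).open_target.mem_nhds hu
    have d1 := (h1.contDiffAt hnhds).differentiableAt (by simp)
    rw [fderiv_const_smul d1]
    have e2 := h2 u hu v w
    simp only [smul_apply, smul_eq_mul]
    rw [← mul_sub, e2, mul_zero]

/-- The space of exact one-forms. -/
def exactForms : Submodule ℝ (OneForm n M) where
  carrier := {θ | IsExactForm n θ}
  zero_mem' := ⟨fun _ => 0, contMDiff_const, fun p => by
    rw [mfderiv_const]; rfl⟩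
  add_mem' := by
    rintro θ η ⟨u, hu, hθ⟩ ⟨v, hv, hη⟩
    refine ⟨u + v, hu.add hv, fun p => ?_⟩
    have e := mfderiv_add ((hu p).mdifferentiableAt (by simp)) ((hv p).mdifferentiableAt (by simp))
    rw [Pi.add_apply, hθ, hη]
    exact e.symm
  smul_mem' := by
    rintro c θ ⟨u, hu, hθ⟩
    refine ⟨c • u, ?_, fun p => ?_⟩
    · exact (contMDiff_const (I := 𝓡 n) (I' := 𝓘(ℝ, ℝ)) (c := c)).smul hu
    have e := const_smul_mfderiv ((hu p).mdifferentiableAt (by simp)) c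
    rw [Pi.smul_apply, hθ]
    exact e.symm

/-- The first Betti number `b₁`, the dimension of the first de Rham cohomology
`{closed one-forms} / {exact one-forms}`, realized as the space of classes of closed one-forms
modulo exact ones. -/
def firstBettiNumber : ℕ :=
  Module.finrank ℝ ((closedForms n M).map (exactForms n M).mkQ)

end Forms

/-! ## Lagrangian immersions, Lagrangian and Hamiltonian variations -/

section Lagrangian

variable (n : ℕ) {M : Type*} [TopologicalSpace M] [ChartedSpace (EuclideanSpace ℝ (Fin n)) M]

/-- The Kähler form `ω(v, w) = ⟨J v, w⟩`, for which `⟨v, w⟩ = ω(v, J w)`. -/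
def kahlerForm (v w : EuclideanSpace ℂ (Fin n)) : ℝ := ⟪Complex.I • v, w⟫_ℝ

/-- `x` is Lagrangian: the Kähler form vanishes on its tangent planes (for a manifold of dimension
`n` immersed in a space of complex dimension `n`). -/
def IsLagrangian (x : M → EuclideanSpace ℂ (Fin n)) : Prop :=
  ∀ p, ∀ v ∈ tangentPlane n x p, ∀ w ∈ tangentPlane n x p, kahlerForm n v w = 0

/-- The one-form `θ = -i_X ω` on `M`, `θ(v) = -ω(X, dx(v)) = -⟨J X, dx(v)⟩`. -/
def variationForm (x X : M → EuclideanSpace ℂ (Fin n)) :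
    OneForm n M := fun p =>
  -((innerSL ℝ (Complex.I • X p)).comp
    (mfderiv (𝓡 n) 𝓘(ℝ, EuclideanSpace ℂ (Fin n)) x p))

theorem variationForm_apply (x X : M → EuclideanSpace ℂ (Fin n)) (p : M)
    (v : TangentSpace (𝓡 n) p) :
    variationForm n x X p v =
      -kahlerForm n (X p)
        (mfderiv (𝓡 n) 𝓘(ℝ, EuclideanSpace ℂ (Fin n)) x p v : EuclideanSpace ℂ (Fin n)) := rfl

/-- A Lagrangian variation: a normal field `X` with `i_X ω` closed. -/
def IsLagrangianVariation (x X : M → EuclideanSpace ℂ (Fin n)) : Prop :=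
  IsNormalField n x X ∧ IsClosedForm n (variationForm n x X)

/-- A Hamiltonian variation: a normal field `X` with `i_X ω` exact. -/
def IsHamiltonianVariation (x X : M → EuclideanSpace ℂ (Fin n)) : Prop :=
  IsNormalField n x X ∧ IsExactForm n (variationForm n x X)

/-- Lagrangian F-stability of a Lagrangian self-shrinker that becomes extinct at `(x₀, t₀)`. -/
def IsLagrangianFStable [MeasurableSpace M] (x : M → EuclideanSpace ℂ (Fin n))
    (x₀ : EuclideanSpace ℂ (Fin n)) (t₀ : ℝ) : Prop :=
  ∀ X : M → EuclideanSpace ℂ (Fin n), IsLagrangianVariation n x X →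
    ∃ (y : EuclideanSpace ℂ (Fin n)) (h : ℝ), 0 ≤ secondVariation n x x₀ t₀ X y h

/-- Hamiltonian F-stability of a Lagrangian self-shrinker that becomes extinct at `(x₀, t₀)`. -/
def IsHamiltonianFStable [MeasurableSpace M] (x : M → EuclideanSpace ℂ (Fin n))
    (x₀ : EuclideanSpace ℂ (Fin n)) (t₀ : ℝ) : Prop :=
  ∀ X : M → EuclideanSpace ℂ (Fin n), IsHamiltonianVariation n x X →
    ∃ (y : EuclideanSpace ℂ (Fin n)) (h : ℝ), 0 ≤ secondVariation n x x₀ t₀ X y h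

end Lagrangian

end LagrangianShrinker

end

/-! Exact forms are closed, so only the passage from Hamiltonian to Lagrangian stability has
content. Write `y = x - x₀`. On a self-shrinker, moving along `H` has the same second-order effect
as changing `t₀`: for every real `s` and every `z`, `F''(X + s H, z, h - s) = F''(X, z, h)`
(`secondVariation_add_smul_meanCurvature`). This comes from expanding the square with `L H = H / t₀`
(`jacobiOperator_meanCurvature`), the symmetry of `L` for the Gaussian weight
(`integral_inner_jacobiOperator_symm`) and the vanishing of the weighted integral of `H`
(`integral_inner_meanCurvature`).

It remains to see that, modulo Hamiltonian variations, every Lagrangian variation is a multiple of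
`H`. The form `-i_H ω` is the Liouville form `⟨J y, dx⟩ / (2 t₀)`, closed because `x` is Lagrangian.
Suppose it were `du`. Then the weighted Laplacian of `u` vanishes, and integrating by parts against
`u` gives `du = 0`. The Lagrangian condition turns this into `y^⊥ = 0`; at a maximum of `|y|²` this
forces `y = 0`, so `x` is constant, the tangent spaces are trivial and `b₁ = 0`. When `b₁ = 1` the
class of `-i_H ω` therefore spans the first cohomology.

The geometry is done extrinsically, without frames or Christoffel symbols. The operator
`tangentialDeriv` differentiates in the direction `w^⊤` for any ambient `w`, through the
Moore–Penrose inverse of `dx`. With `P` the tangential projection and `S = derivProj` its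
derivative, the second fundamental form is `S(v) P w`, and traces over a tangent frame become traces
over a fixed orthonormal basis of the ambient space with one `P` inserted. Gauss–Codazzi type
identities then follow by differentiating `P² = P` and from the commutator of tangential
derivatives. Integration by parts is proved from the chart definition of the measure, by the
classical formula for the divergence in terms of `√det g` and a partition of unity. -/

namespace LagrangianShrinker

noncomputable section

set_option linter.unusedSectionVars false

/-! ### The Moore–Penrose inverse and its smoothness. -/

section LinearAlgebra

variable {E V : Type*} [NormedAddCommGroup E] [InnerProductSpace ℝ E] [FiniteDimensional ℝ E]
  [NormedAddCommGroup V] [InnerProductSpace ℝ V] [FiniteDimensional ℝ V]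

/-- The Moore–Penrose inverse `(T* T)⁻¹ T*` of an injective linear map. -/
def pinv (T : E →L[ℝ] V) : V →L[ℝ] E :=
  have := FiniteDimensional.complete ℝ E
  have := FiniteDimensional.complete ℝ V
  ((ContinuousLinearMap.adjoint T).comp T).inverse.comp (ContinuousLinearMap.adjoint T)

/-- `T* T v = 0` gives `|T v|² = 0`, so `T* T` is an injective endomorphism in finite dimension. An
equivalence is produced because inversion of operators is smooth at equivalences. -/
theorem exists_equiv_adjoint_comp_self [CompleteSpace E] [CompleteSpace V] {T : E →L[ℝ] V}
    (hT : Function.Injective T) :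
    ∃ e : E ≃L[ℝ] E, (e : E →L[ℝ] E) = (ContinuousLinearMap.adjoint T).comp T := by
  have hinj : Function.Injective ((ContinuousLinearMap.adjoint T).comp T) := by
    rw [injective_iff_map_eq_zero]
    intro v hv
    have h : ⟪T v, T v⟫_ℝ = 0 := by
      rw [← ContinuousLinearMap.adjoint_inner_right]
      have : (ContinuousLinearMap.adjoint T) (T v) = 0 := hv
      rw [this, inner_zero_right]
    rw [inner_self_eq_zero] at h
    exact hT (h.trans (map_zero T).symm)
  refine ⟨(LinearEquiv.ofInjectiveEndo
    ((ContinuousLinearMap.adjoint T).comp T).toLinearMap hinj).toContinuousLinearEquiv, ?_⟩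
  ext v; rfl

theorem pinv_comp_self {T : E →L[ℝ] V} (hT : Function.Injective T) :
    (pinv T).comp T = ContinuousLinearMap.id ℝ E := by
  have := FiniteDimensional.complete ℝ E
  have := FiniteDimensional.complete ℝ V
  obtain ⟨e, he⟩ := exists_equiv_adjoint_comp_self hT
  unfold pinv
  rw [ContinuousLinearMap.comp_assoc, ← he, ContinuousLinearMap.inverse_equiv]
  ext v; simp

theorem pinv_apply_self {T : E →L[ℝ] V} (hT : Function.Injective T) (v : E) :
    pinv T (T v) = v :=
  congrArg (fun f : E →L[ℝ] E => f v) (pinv_comp_self hT)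

theorem pinv_eq_zero_of_mem_orthogonal {T : E →L[ℝ] V} {w : V}
    (hw : w ∈ (LinearMap.range T.toLinearMap)ᗮ) : pinv T w = 0 := by
  have := FiniteDimensional.complete ℝ E
  have := FiniteDimensional.complete ℝ V
  have h : ContinuousLinearMap.adjoint T w = 0 := by
    rw [← inner_self_eq_zero (𝕜 := ℝ), ContinuousLinearMap.adjoint_inner_left]
    rw [real_inner_comm]
    exact (Submodule.mem_orthogonal _ w).1 hw _ ⟨_, rfl⟩
  unfold pinv
  rw [ContinuousLinearMap.comp_apply, h, map_zero]

theorem pinv_starProjection {T : E →L[ℝ] V} (w : V) :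
    pinv T ((LinearMap.range T.toLinearMap).starProjection w) = pinv T w := by
  have h := pinv_eq_zero_of_mem_orthogonal (T := T)
    (Submodule.sub_starProjection_mem_orthogonal (K := LinearMap.range T.toLinearMap) w)
  rw [map_sub, sub_eq_zero] at h
  exact h.symm

/-- For `T = dx` this makes `pinv T w` the tangent vector lying over `w^⊤`, given by an explicit
formula instead of a choice. -/
theorem apply_pinv {T : E →L[ℝ] V} (hT : Function.Injective T) (w : V) :
    T (pinv T w) = (LinearMap.range T.toLinearMap).starProjection w := by
  obtain ⟨v, hv⟩ : (LinearMap.range T.toLinearMap).starProjection w ∈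
    LinearMap.range T.toLinearMap := Submodule.starProjection_apply_mem _ _
  have hv' : T v = (LinearMap.range T.toLinearMap).starProjection w := hv
  rw [← pinv_starProjection, ← hv', pinv_apply_self hT]

/-- Operator inversion is smooth at the invertible `T* T`. All later smoothness of tangential
objects rests on this. -/
theorem contDiffAt_pinv {T : E →L[ℝ] V} (hT : Function.Injective T) :
    ContDiffAt ℝ ∞ (pinv : (E →L[ℝ] V) → (V →L[ℝ] E)) T := by
  have := FiniteDimensional.complete ℝ E
  have := FiniteDimensional.complete ℝ V
  have hadj : ContDiff ℝ ∞ (fun S : E →L[ℝ] V => ContinuousLinearMap.adjoint S) :=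
    (ContinuousLinearMap.adjoint (𝕜 := ℝ) (E := E) (F := V)).toContinuousLinearEquiv.contDiff
  obtain ⟨e, he⟩ := exists_equiv_adjoint_comp_self hT
  have hinv : ContDiffAt ℝ ∞ (fun S : E →L[ℝ] V =>
      ((ContinuousLinearMap.adjoint S).comp S).inverse) T := by
    have h1 := contDiffAt_map_inverse (𝕜 := ℝ) (n := ∞) e
    rw [he] at h1
    exact ContDiffAt.comp (f := fun S : E →L[ℝ] V => (ContinuousLinearMap.adjoint S).comp S) T h1
      (hadj.clm_comp contDiff_id).contDiffAt
  exact hinv.clm_comp hadj.contDiffAt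

end LinearAlgebra

/-! ### Traces of bilinear maps over a subspace. -/

section Traces

variable {V W : Type*} [NormedAddCommGroup V] [InnerProductSpace ℝ V] [FiniteDimensional ℝ V]
  [AddCommGroup W] [Module ℝ W]

/-- A linear map in the first argument of a bilinear trace can be moved to its adjoint in the second
argument. -/
theorem sum_bilin_adjoint [CompleteSpace V] {ι κ : Type*} [Fintype ι] [Fintype κ]
    {U : Type*} [NormedAddCommGroup U] [InnerProductSpace ℝ U] [CompleteSpace U]
    (b : OrthonormalBasis ι ℝ V) (d : OrthonormalBasis κ ℝ U) (B : V →ₗ[ℝ] U →ₗ[ℝ] W)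
    (S : U →L[ℝ] V) :
    ∑ k, B (S (d k)) (d k) = ∑ i, B (b i) (ContinuousLinearMap.adjoint S (b i)) := by
  have h1 : ∀ k, S (d k) = ∑ i, ⟪b i, S (d k)⟫_ℝ • b i := fun k => (b.sum_repr' _).symm
  have h2 : ∀ i, ContinuousLinearMap.adjoint S (b i) =
      ∑ k, ⟪b i, S (d k)⟫_ℝ • d k := fun i => by
    conv_lhs => rw [← d.sum_repr' (ContinuousLinearMap.adjoint S (b i))]
    refine Finset.sum_congr rfl fun k _ => ?_
    rw [ContinuousLinearMap.adjoint_inner_right, real_inner_comm]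
  calc ∑ k, B (S (d k)) (d k) = ∑ k, ∑ i, ⟪b i, S (d k)⟫_ℝ • B (b i) (d k) := by
        refine Finset.sum_congr rfl fun k _ => ?_
        conv_lhs => rw [h1 k]
        rw [map_sum, LinearMap.sum_apply]
        simp only [map_smul, LinearMap.smul_apply]
    _ = ∑ i, B (b i) (ContinuousLinearMap.adjoint S (b i)) := by
        rw [Finset.sum_comm]
        refine Finset.sum_congr rfl fun i _ => ?_
        rw [h2 i, map_sum]
        simp only [map_smul]

/-- The trace over a subspace is the trace over the whole space of the compression. -/
theorem sum_bilin_subspace {ι κ : Type*} [Fintype ι] [Fintype κ]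
    (K : Submodule ℝ V) (b : OrthonormalBasis ι ℝ V) (d : OrthonormalBasis κ ℝ K)
    (B : V →ₗ[ℝ] V →ₗ[ℝ] W) :
    ∑ k, B (d k) (d k) = ∑ i, B (b i) (K.starProjection (b i)) := by
  have := FiniteDimensional.complete ℝ V
  have := FiniteDimensional.complete ℝ K
  -- `S` is the inclusion of `K`, whose adjoint is the orthogonal projection onto `K`.
  have h := sum_bilin_adjoint b d (B.compl₂ K.subtype) K.subtypeL
  rw [Submodule.adjoint_subtypeL] at h
  exact h

end Traces

/-! ### Tangential derivatives in charts. -/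

section ChartCalculus

variable {n : ℕ} {M : Type*} [TopologicalSpace M] [ChartedSpace (EuclideanSpace ℝ (Fin n)) M]
  [IsManifold (𝓡 n) ∞ M]
  {W : Type*} [NormedAddCommGroup W] [NormedSpace ℝ W]

instance isManifold_one : IsManifold (𝓡 n) 1 M := IsManifold.of_le (n := ∞) (by simp)

theorem contMDiffAt_chart_symm (q : M) {u : EuclideanSpace ℝ (Fin n)}
    (hu : u ∈ (chartAt (EuclideanSpace ℝ (Fin n)) q).target) :
    ContMDiffAt (𝓡 n) (𝓡 n) ∞ (chartAt (EuclideanSpace ℝ (Fin n)) q).symm u :=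
  contMDiffOn_chart_symm.contMDiffAt
    ((chartAt (EuclideanSpace ℝ (Fin n)) q).open_target.mem_nhds hu)

theorem contDiffOn_comp_chart_symm {Y : M → W} (hY : ContMDiff (𝓡 n) 𝓘(ℝ, W) ∞ Y) (q : M) :
    ContDiffOn ℝ ∞ (Y ∘ (chartAt (EuclideanSpace ℝ (Fin n)) q).symm)
      (chartAt (EuclideanSpace ℝ (Fin n)) q).target := by
  rw [← contMDiffOn_iff_contDiffOn]
  exact hY.comp_contMDiffOn contMDiffOn_chart_symm

theorem contDiffAt_comp_chart_symm {Y : M → W} (hY : ContMDiff (𝓡 n) 𝓘(ℝ, W) ∞ Y) (q : M)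
    {u : EuclideanSpace ℝ (Fin n)} (hu : u ∈ (chartAt (EuclideanSpace ℝ (Fin n)) q).target) :
    ContDiffAt ℝ ∞ (Y ∘ (chartAt (EuclideanSpace ℝ (Fin n)) q).symm) u :=
  (contDiffOn_comp_chart_symm hY q).contDiffAt
    ((chartAt (EuclideanSpace ℝ (Fin n)) q).open_target.mem_nhds hu)

theorem contMDiff_of_chart {Y : M → W}
    (h : ∀ q, ContDiffOn ℝ ∞ (Y ∘ (chartAt (EuclideanSpace ℝ (Fin n)) q).symm)
      (chartAt (EuclideanSpace ℝ (Fin n)) q).target) : ContMDiff (𝓡 n) 𝓘(ℝ, W) ∞ Y := by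
  intro p
  have h1 : ContMDiffAt (𝓡 n) 𝓘(ℝ, W) ∞ ((Y ∘ (chartAt (EuclideanSpace ℝ (Fin n)) p).symm) ∘
      chartAt (EuclideanSpace ℝ (Fin n)) p) p := by
    refine ContMDiffAt.comp p (I' := 𝓡 n) ?_
      (contMDiffOn_chart.contMDiffAt
        ((chartAt (EuclideanSpace ℝ (Fin n)) p).open_source.mem_nhds (mem_chart_source _ p)))
    exact ((h p).contDiffAt ((chartAt (EuclideanSpace ℝ (Fin n)) p).open_target.mem_nhds
      (mem_chart_target _ p))).contMDiffAt
  refine h1.congr_of_eventuallyEq ?_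
  filter_upwards [(chartAt (EuclideanSpace ℝ (Fin n)) p).open_source.mem_nhds
    (mem_chart_source _ p)] with r hr
  simp [(chartAt (EuclideanSpace ℝ (Fin n)) p).left_inv hr]

theorem mfderiv_chart_symm_surjective (q : M) {u : EuclideanSpace ℝ (Fin n)}
    (hu : u ∈ (chartAt (EuclideanSpace ℝ (Fin n)) q).target) :
    Function.Surjective (mfderiv (𝓡 n) (𝓡 n) (chartAt (EuclideanSpace ℝ (Fin n)) q).symm u) :=
  ((mdifferentiable_chart (I := 𝓡 n) q).symm.mfderiv_bijective hu).2

theorem mfderiv_chart_symm_injective (q : M) {u : EuclideanSpace ℝ (Fin n)}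
    (hu : u ∈ (chartAt (EuclideanSpace ℝ (Fin n)) q).target) :
    Function.Injective (mfderiv (𝓡 n) (𝓡 n) (chartAt (EuclideanSpace ℝ (Fin n)) q).symm u) :=
  ((mdifferentiable_chart (I := 𝓡 n) q).symm.mfderiv_bijective hu).1

theorem fderiv_comp_chart_symm {Y : M → W} (hY : ContMDiff (𝓡 n) 𝓘(ℝ, W) ∞ Y) (q : M)
    {u : EuclideanSpace ℝ (Fin n)} (hu : u ∈ (chartAt (EuclideanSpace ℝ (Fin n)) q).target)
    (v : EuclideanSpace ℝ (Fin n)) :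
    fderiv ℝ (Y ∘ (chartAt (EuclideanSpace ℝ (Fin n)) q).symm) u v =
      mfderiv (𝓡 n) 𝓘(ℝ, W) Y ((chartAt (EuclideanSpace ℝ (Fin n)) q).symm u)
        (mfderiv (𝓡 n) (𝓡 n) (chartAt (EuclideanSpace ℝ (Fin n)) q).symm u v) := by
  rw [← mfderiv_eq_fderiv]
  rw [mfderiv_comp (I' := 𝓡 n) u ((hY _).mdifferentiableAt (by simp))
    ((contMDiffAt_chart_symm q hu).mdifferentiableAt (by simp))]
  rfl

variable {V : Type*} [NormedAddCommGroup V] [InnerProductSpace ℝ V] [FiniteDimensional ℝ V]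

/-- The differential of `x : M → V` as a map between fixed vector spaces. -/
def differential (n : ℕ) {M : Type*} [TopologicalSpace M]
    [ChartedSpace (EuclideanSpace ℝ (Fin n)) M] (x : M → W) (p : M) : EuclideanSpace ℝ (Fin n) →L[ℝ] W :=
  mfderiv (𝓡 n) 𝓘(ℝ, W) x p

/-- The tangential derivative along an immersion `x`: `w ↦ D_{w^⊤} Y`. -/
def tangentialDeriv (n : ℕ) {M : Type*} [TopologicalSpace M]
    [ChartedSpace (EuclideanSpace ℝ (Fin n)) M] (x : M → V) (Y : M → W) (p : M) : V →L[ℝ] W :=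
  (differential n Y p).comp (pinv (differential n x p))

theorem differential_injective {x : M → V} (hx : IsSmoothImmersion n x) (p : M) :
    Function.Injective (differential n x p) := hx.2 p

theorem fderiv_comp_chart_symm_injective {x : M → V} (hx : IsSmoothImmersion n x) (q : M)
    {u : EuclideanSpace ℝ (Fin n)} (hu : u ∈ (chartAt (EuclideanSpace ℝ (Fin n)) q).target) :
    Function.Injective
      (fderiv ℝ (x ∘ (chartAt (EuclideanSpace ℝ (Fin n)) q).symm) u) := by
  intro v w h
  rw [fderiv_comp_chart_symm hx.1 q hu, fderiv_comp_chart_symm hx.1 q hu] at h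
  exact mfderiv_chart_symm_injective q hu (hx.2 _ h)

theorem tangentPlane_chart {x : M → V} (hx : IsSmoothImmersion n x) (q : M)
    {u : EuclideanSpace ℝ (Fin n)} (hu : u ∈ (chartAt (EuclideanSpace ℝ (Fin n)) q).target) :
    tangentPlane n x ((chartAt (EuclideanSpace ℝ (Fin n)) q).symm u) =
      LinearMap.range
        (fderiv ℝ (x ∘ (chartAt (EuclideanSpace ℝ (Fin n)) q).symm) u).toLinearMap := by
  ext w
  constructor
  · rintro ⟨v, rfl⟩
    obtain ⟨s, rfl⟩ := mfderiv_chart_symm_surjective q hu v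
    exact ⟨s, fderiv_comp_chart_symm hx.1 q hu s⟩
  · rintro ⟨s, rfl⟩
    exact ⟨_, (fderiv_comp_chart_symm hx.1 q hu s).symm⟩

theorem tangentialPart_eq_of_tangentPlane_eq {x : M → V} {p : M} {K : Submodule ℝ V}
    (h : tangentPlane n x p = K) : tangentialPart n x p = K.starProjection := by
  subst h; rfl

theorem apply_pinv_differential {x : M → V} (hx : IsSmoothImmersion n x) (p : M) (w : V) :
    differential n x p (pinv (differential n x p) w) = tangentialPart n x p w :=
  apply_pinv (differential_injective hx p) w

/-- The differential of the inverse chart is bijective and cancels between `dY` and the inverse of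
`dx`. This reduces tangential calculus to Euclidean calculus. -/
theorem tangentialDeriv_chart {x : M → V} (hx : IsSmoothImmersion n x) {Y : M → W}
    (hY : ContMDiff (𝓡 n) 𝓘(ℝ, W) ∞ Y) (q : M)
    {u : EuclideanSpace ℝ (Fin n)} (hu : u ∈ (chartAt (EuclideanSpace ℝ (Fin n)) q).target) :
    tangentialDeriv n x Y ((chartAt (EuclideanSpace ℝ (Fin n)) q).symm u) =
      (fderiv ℝ (Y ∘ (chartAt (EuclideanSpace ℝ (Fin n)) q).symm) u).comp
        (pinv (fderiv ℝ (x ∘ (chartAt (EuclideanSpace ℝ (Fin n)) q).symm) u)) := by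
  ext w
  obtain ⟨s, hs⟩ : ∃ s : EuclideanSpace ℝ (Fin n),
      mfderiv (𝓡 n) (𝓡 n) (chartAt (EuclideanSpace ℝ (Fin n)) q).symm u s =
        pinv (differential n x ((chartAt (EuclideanSpace ℝ (Fin n)) q).symm u)) w :=
    mfderiv_chart_symm_surjective q hu _
  have h1 : fderiv ℝ (x ∘ (chartAt (EuclideanSpace ℝ (Fin n)) q).symm) u s =
      tangentialPart n x ((chartAt (EuclideanSpace ℝ (Fin n)) q).symm u) w := by
    rw [fderiv_comp_chart_symm hx.1 q hu, hs]
    exact apply_pinv_differential hx _ w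
  have h2 : s = pinv (fderiv ℝ (x ∘ (chartAt (EuclideanSpace ℝ (Fin n)) q).symm) u) w := by
    rw [← pinv_apply_self (fderiv_comp_chart_symm_injective hx q hu) s, h1,
      tangentialPart_eq_of_tangentPlane_eq (tangentPlane_chart hx q hu), pinv_starProjection]
  have h3 := fderiv_comp_chart_symm hY q hu s
  rw [hs] at h3
  rw [ContinuousLinearMap.comp_apply, ← h2, h3]
  rfl

theorem contMDiff_tangentialDeriv {x : M → V} (hx : IsSmoothImmersion n x) {Y : M → W}
    (hY : ContMDiff (𝓡 n) 𝓘(ℝ, W) ∞ Y) :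
    ContMDiff (𝓡 n) 𝓘(ℝ, V →L[ℝ] W) ∞ (tangentialDeriv n x Y) := by
  refine contMDiff_of_chart fun q => ?_
  have ho := (chartAt (EuclideanSpace ℝ (Fin n)) q).open_target
  have h1 : ContDiffOn ℝ ∞ (fun u => (fderiv ℝ (Y ∘ (chartAt (EuclideanSpace ℝ (Fin n)) q).symm)
      u).comp (pinv (fderiv ℝ (x ∘ (chartAt (EuclideanSpace ℝ (Fin n)) q).symm) u)))
      (chartAt (EuclideanSpace ℝ (Fin n)) q).target := by
    refine ContDiffOn.clm_comp ?_ ?_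
    · exact (contDiffOn_comp_chart_symm hY q).fderiv_of_isOpen ho (by simp)
    · intro u hu
      have h2 := (contDiffOn_comp_chart_symm hx.1 q).fderiv_of_isOpen (m := ∞) ho (by simp)
      exact (contDiffAt_pinv (fderiv_comp_chart_symm_injective hx q hu)).comp_contDiffWithinAt u
        (h2 u hu)
  exact h1.congr fun u hu => tangentialDeriv_chart hx hY q hu

/-- Injectivity of `dx` leaves no freedom in the choice made by `tangentLift`, so it is the
Moore–Penrose lift. -/
theorem dirDeriv_eq_tangentialDeriv {x : M → V} (hx : IsSmoothImmersion n x) (Y : M → V) (p : M)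
    (w : V) : dirDeriv n x Y p w = tangentialDeriv n x Y p w := by
  have h : tangentLift n x p w = pinv (differential n x p) w := by
    apply hx.2 p
    exact (exists_lift n x p w).choose_spec.trans (apply_pinv_differential hx p w).symm
  unfold dirDeriv
  rw [h]
  rfl

theorem tangentialDeriv_tangentialPart (x : M → V) (Y : M → W) (p : M)
    (w : V) : tangentialDeriv n x Y p (tangentialPart n x p w) =
      tangentialDeriv n x Y p w := by
  show differential n Y p (pinv (differential n x p) (tangentialPart n x p w)) =
    differential n Y p (pinv (differential n x p) w)
  congr 1
  exact pinv_starProjection (T := differential n x p) w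

/-- The projection is thus itself a tangential derivative: it inherits smoothness, and the
commutator rule applied to `x` becomes a statement about it. -/
theorem tangentialDeriv_self {x : M → V} (hx : IsSmoothImmersion n x) (p : M) :
    tangentialDeriv n x x p = tangentialPart n x p := by
  ext w
  exact apply_pinv_differential hx p w

theorem contMDiff_tangentialPart {x : M → V} (hx : IsSmoothImmersion n x) :
    ContMDiff (𝓡 n) 𝓘(ℝ, V →L[ℝ] V) ∞ (tangentialPart n x) := by
  have h := contMDiff_tangentialDeriv hx hx.1
  rwa [show tangentialDeriv n x x = tangentialPart n x from
    funext (tangentialDeriv_self hx)] at h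

end ChartCalculus

/-! ### Product rules and the commutator of tangential derivatives. -/

section TangentialCalculus

variable {n : ℕ} {M : Type*} [TopologicalSpace M] [ChartedSpace (EuclideanSpace ℝ (Fin n)) M]
  [IsManifold (𝓡 n) ∞ M]
  {V : Type*} [NormedAddCommGroup V] [InnerProductSpace ℝ V] [FiniteDimensional ℝ V]
  {W W₁ W₂ : Type*} [NormedAddCommGroup W] [NormedSpace ℝ W]
  [NormedAddCommGroup W₁] [NormedSpace ℝ W₁] [NormedAddCommGroup W₂] [NormedSpace ℝ W₂]
  {x : M → V}

theorem exists_chart_symm_eq (n : ℕ) {M : Type*} [TopologicalSpace M]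
    [ChartedSpace (EuclideanSpace ℝ (Fin n)) M] (p : M) :
    ∃ u ∈ (chartAt (EuclideanSpace ℝ (Fin n)) p).target,
      (chartAt (EuclideanSpace ℝ (Fin n)) p).symm u = p :=
  ⟨_, mem_chart_target _ p, (chartAt (EuclideanSpace ℝ (Fin n)) p).left_inv (mem_chart_source _ p)⟩

theorem _root_.ContMDiff.bilin (B : W₁ →L[ℝ] W₂ →L[ℝ] W) {Y : M → W₁} {Z : M → W₂}
    (hY : ContMDiff (𝓡 n) 𝓘(ℝ, W₁) ∞ Y) (hZ : ContMDiff (𝓡 n) 𝓘(ℝ, W₂) ∞ Z) :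
    ContMDiff (𝓡 n) 𝓘(ℝ, W) ∞ (fun p => B (Y p) (Z p)) :=
  B.isBoundedBilinearMap.contDiff.comp_contMDiff (hY.prodMk_space hZ)

/-- The one product rule; evaluation, composition, inner product and multiplication below are
special choices of `B`. -/
theorem tangentialDeriv_bilin (hx : IsSmoothImmersion n x) (B : W₁ →L[ℝ] W₂ →L[ℝ] W) {Y : M → W₁}
    {Z : M → W₂} (hY : ContMDiff (𝓡 n) 𝓘(ℝ, W₁) ∞ Y) (hZ : ContMDiff (𝓡 n) 𝓘(ℝ, W₂) ∞ Z)
    (p : M) (v : V) :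
    tangentialDeriv n x (fun r => B (Y r) (Z r)) p v =
      B (tangentialDeriv n x Y p v) (Z p) + B (Y p) (tangentialDeriv n x Z p v) := by
  obtain ⟨u, hu, hp⟩ := exists_chart_symm_eq n p
  have h1 := ((contDiffAt_comp_chart_symm hY p hu).differentiableAt (by simp)).hasFDerivAt
  have h2 := ((contDiffAt_comp_chart_symm hZ p hu).differentiableAt (by simp)).hasFDerivAt
  have h3 := (B.hasFDerivAt_of_bilinear h1 h2).fderiv
  have e1 := tangentialDeriv_chart hx (hY.bilin B hZ) p hu
  have e2 := tangentialDeriv_chart hx hY p hu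
  have e3 := tangentialDeriv_chart hx hZ p hu
  rw [hp] at e1 e2 e3
  rw [e1, e2, e3]
  change fderiv ℝ (fun r => B ((Y ∘ (chartAt (EuclideanSpace ℝ (Fin n)) p).symm) r)
    ((Z ∘ (chartAt (EuclideanSpace ℝ (Fin n)) p).symm) r)) u _ = _
  rw [h3]
  simp [hp, add_comm]

theorem tangentialDeriv_comp (hx : IsSmoothImmersion n x) {g : W₁ → W} (hg : ContDiff ℝ ∞ g)
    {Y : M → W₁} (hY : ContMDiff (𝓡 n) 𝓘(ℝ, W₁) ∞ Y) (p : M) (v : V) :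
    tangentialDeriv n x (fun r => g (Y r)) p v = fderiv ℝ g (Y p) (tangentialDeriv n x Y p v) := by
  obtain ⟨u, hu, hp⟩ := exists_chart_symm_eq n p
  have h1 := ((contDiffAt_comp_chart_symm hY p hu).differentiableAt (by simp)).hasFDerivAt
  have h2 := (hg.contDiffAt.differentiableAt (x := Y p) (by simp)).hasFDerivAt
  have e1 := tangentialDeriv_chart hx (hg.comp_contMDiff hY) p hu
  have e2 := tangentialDeriv_chart hx hY p hu
  rw [hp] at e1 e2
  have h3 : HasFDerivAt (g ∘ (Y ∘ (chartAt (EuclideanSpace ℝ (Fin n)) p).symm)) _ u :=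
    HasFDerivAt.comp u (by rw [Function.comp_apply, hp]; exact h2) h1
  change tangentialDeriv n x (g ∘ Y) p v = _
  rw [e1, e2]
  change fderiv ℝ (g ∘ (Y ∘ (chartAt (EuclideanSpace ℝ (Fin n)) p).symm)) u _ = _
  rw [h3.fderiv]
  rfl

theorem tangentialDeriv_const (c : W) (p : M) :
    tangentialDeriv n x (fun _ : M => c) p = 0 := by
  ext v
  show mfderiv (𝓡 n) 𝓘(ℝ, W) (fun _ : M => c) p _ = 0
  rw [mfderiv_const]; rfl

theorem tangentialDeriv_add {Y Z : M → W}
    (hY : ContMDiff (𝓡 n) 𝓘(ℝ, W) ∞ Y) (hZ : ContMDiff (𝓡 n) 𝓘(ℝ, W) ∞ Z) (p : M) :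
    tangentialDeriv n x (fun r => Y r + Z r) p =
      tangentialDeriv n x Y p + tangentialDeriv n x Z p := by
  have e := mfderiv_add ((hY p).mdifferentiableAt (by simp)) ((hZ p).mdifferentiableAt (by simp))
  have e' : differential n (fun r => Y r + Z r) p = differential n Y p + differential n Z p := e
  unfold tangentialDeriv
  rw [e', ContinuousLinearMap.add_comp]

theorem tangentialDeriv_sub {Y Z : M → W}
    (hY : ContMDiff (𝓡 n) 𝓘(ℝ, W) ∞ Y) (hZ : ContMDiff (𝓡 n) 𝓘(ℝ, W) ∞ Z) (p : M) :
    tangentialDeriv n x (fun r => Y r - Z r) p =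
      tangentialDeriv n x Y p - tangentialDeriv n x Z p := by
  have e := mfderiv_sub ((hY p).mdifferentiableAt (by simp)) ((hZ p).mdifferentiableAt (by simp))
  have e' : differential n (fun r => Y r - Z r) p = differential n Y p - differential n Z p := e
  unfold tangentialDeriv
  rw [e', ContinuousLinearMap.sub_comp]

theorem tangentialDeriv_const_smul (c : ℝ) {Y : M → W}
    (hY : ContMDiff (𝓡 n) 𝓘(ℝ, W) ∞ Y) (p : M) :
    tangentialDeriv n x (fun r => c • Y r) p = c • tangentialDeriv n x Y p := by
  have e := const_smul_mfderiv ((hY p).mdifferentiableAt (by simp)) c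
  have e' : differential n (fun r => c • Y r) p = c • differential n Y p := e
  unfold tangentialDeriv
  rw [e', ContinuousLinearMap.smul_comp]

theorem tangentialDeriv_sum {ι : Type*} (s : Finset ι) {Y : ι → M → W}
    (hY : ∀ i, ContMDiff (𝓡 n) 𝓘(ℝ, W) ∞ (Y i)) (p : M) :
    tangentialDeriv n x (fun r => ∑ i ∈ s, Y i r) p = ∑ i ∈ s, tangentialDeriv n x (Y i) p := by
  classical
  induction s using Finset.induction_on with
  | empty => simpa using tangentialDeriv_const (0 : W) p
  | insert i s hi ih =>
    simp only [Finset.sum_insert hi]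
    rw [tangentialDeriv_add (hY i) (contMDiff_finsetSum fun j _ => hY j), ih]

theorem tangentialDeriv_clm_apply (hx : IsSmoothImmersion n x) {A : M → W₁ →L[ℝ] W} {Y : M → W₁}
    (hA : ContMDiff (𝓡 n) 𝓘(ℝ, W₁ →L[ℝ] W) ∞ A) (hY : ContMDiff (𝓡 n) 𝓘(ℝ, W₁) ∞ Y)
    (p : M) (v : V) :
    tangentialDeriv n x (fun r => A r (Y r)) p v =
      tangentialDeriv n x A p v (Y p) + A p (tangentialDeriv n x Y p v) :=
  tangentialDeriv_bilin hx (ContinuousLinearMap.id ℝ (W₁ →L[ℝ] W)) hA hY p v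

theorem tangentialDeriv_clm_apply_const (hx : IsSmoothImmersion n x) {A : M → W₁ →L[ℝ] W}
    (hA : ContMDiff (𝓡 n) 𝓘(ℝ, W₁ →L[ℝ] W) ∞ A) (w : W₁) (p : M) (v : V) :
    tangentialDeriv n x (fun r => A r w) p v = tangentialDeriv n x A p v w := by
  rw [tangentialDeriv_clm_apply hx hA contMDiff_const, tangentialDeriv_const]
  simp

theorem tangentialDeriv_clm_comp (hx : IsSmoothImmersion n x) {A : M → W₁ →L[ℝ] W}
    {B : M → W₂ →L[ℝ] W₁}
    (hA : ContMDiff (𝓡 n) 𝓘(ℝ, W₁ →L[ℝ] W) ∞ A) (hB : ContMDiff (𝓡 n) 𝓘(ℝ, W₂ →L[ℝ] W₁) ∞ B)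
    (p : M) (v : V) :
    tangentialDeriv n x (fun r => (A r).comp (B r)) p v =
      (tangentialDeriv n x A p v).comp (B p) + (A p).comp (tangentialDeriv n x B p v) :=
  tangentialDeriv_bilin hx (ContinuousLinearMap.compL ℝ W₂ W₁ W) hA hB p v

theorem tangentialDeriv_inner {U : Type*} [NormedAddCommGroup U] [InnerProductSpace ℝ U]
    (hx : IsSmoothImmersion n x) {Y Z : M → U}
    (hY : ContMDiff (𝓡 n) 𝓘(ℝ, U) ∞ Y) (hZ : ContMDiff (𝓡 n) 𝓘(ℝ, U) ∞ Z) (p : M) (v : V) :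
    tangentialDeriv n x (fun r => ⟪Y r, Z r⟫_ℝ) p v =
      ⟪tangentialDeriv n x Y p v, Z p⟫_ℝ + ⟪Y p, tangentialDeriv n x Z p v⟫_ℝ :=
  tangentialDeriv_bilin hx (innerSL ℝ) hY hZ p v

theorem tangentialDeriv_mul (hx : IsSmoothImmersion n x) {f g : M → ℝ}
    (hf : ContMDiff (𝓡 n) 𝓘(ℝ, ℝ) ∞ f) (hg : ContMDiff (𝓡 n) 𝓘(ℝ, ℝ) ∞ g) (p : M) (v : V) :
    tangentialDeriv n x (fun r => f r * g r) p v =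
      tangentialDeriv n x f p v * g p + f p * tangentialDeriv n x g p v :=
  tangentialDeriv_bilin hx (ContinuousLinearMap.mul ℝ ℝ) hf hg p v

theorem _root_.ContMDiff.inner_space {U : Type*} [NormedAddCommGroup U] [InnerProductSpace ℝ U]
    {Y Z : M → U} (hY : ContMDiff (𝓡 n) 𝓘(ℝ, U) ∞ Y) (hZ : ContMDiff (𝓡 n) 𝓘(ℝ, U) ∞ Z) :
    ContMDiff (𝓡 n) 𝓘(ℝ, ℝ) ∞ (fun r => ⟪Y r, Z r⟫_ℝ) :=
  hY.bilin (innerSL ℝ) hZ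

theorem differentiableAt_pinv_fderiv (hx : IsSmoothImmersion n x) (q : M)
    {u : EuclideanSpace ℝ (Fin n)} (hu : u ∈ (chartAt (EuclideanSpace ℝ (Fin n)) q).target) :
    DifferentiableAt ℝ
      (fun s => pinv (fderiv ℝ (x ∘ (chartAt (EuclideanSpace ℝ (Fin n)) q).symm) s)) u := by
  have h2 := ((contDiffOn_comp_chart_symm hx.1 q).fderiv_of_isOpen (m := ∞)
    (chartAt (EuclideanSpace ℝ (Fin n)) q).open_target (by simp)).contDiffAt
    ((chartAt (EuclideanSpace ℝ (Fin n)) q).open_target.mem_nhds hu)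
  exact ((contDiffAt_pinv (fderiv_comp_chart_symm_injective hx q hu)).comp u h2).differentiableAt
    (by simp)

/-- In the chart the tangential derivative is `dZ ∘ R`. Differentiating it again, the second
derivative of `Z` cancels by symmetry and only the derivative of `R` survives. The vector to which
`dZ` is applied does not depend on `Z`. -/
theorem tangentialDeriv_commutator_chart (hx : IsSmoothImmersion n x) {Z : M → W}
    (hZ : ContMDiff (𝓡 n) 𝓘(ℝ, W) ∞ Z) (q : M) {u : EuclideanSpace ℝ (Fin n)}
    (hu : u ∈ (chartAt (EuclideanSpace ℝ (Fin n)) q).target)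
    {φ : EuclideanSpace ℝ (Fin n) → M} (hφ : φ = (chartAt (EuclideanSpace ℝ (Fin n)) q).symm)
    {R : EuclideanSpace ℝ (Fin n) → (V →L[ℝ] EuclideanSpace ℝ (Fin n))}
    (hR : R = fun s => pinv (fderiv ℝ (x ∘ φ) s)) (v w : V) :
    tangentialDeriv n x (tangentialDeriv n x Z) (φ u) v w -
        tangentialDeriv n x (tangentialDeriv n x Z) (φ u) w v =
      fderiv ℝ (Z ∘ φ) u (fderiv ℝ R u (R u v) w - fderiv ℝ R u (R u w) v) := by
  have hnhds := (chartAt (EuclideanSpace ℝ (Fin n)) q).open_target.mem_nhds hu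
  have hRd : DifferentiableAt ℝ R u := by
    rw [hR, hφ]
    exact differentiableAt_pinv_fderiv hx q hu
  have e1 := tangentialDeriv_chart hx (contMDiff_tangentialDeriv hx hZ) q hu
  rw [← hφ] at e1
  have hZ2 := ((contDiffOn_comp_chart_symm hZ q).fderiv_of_isOpen (m := ∞)
    (chartAt (EuclideanSpace ℝ (Fin n)) q).open_target (by simp)).contDiffAt hnhds
  have hd := hZ2.differentiableAt (by simp)
  rw [← hφ] at hd
  have e2 : fderiv ℝ (tangentialDeriv n x Z ∘ φ) u =
      fderiv ℝ (fun s => (fderiv ℝ (Z ∘ φ) s).comp (R s)) u := by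
    apply Filter.EventuallyEq.fderiv_eq
    filter_upwards [hnhds] with s hs
    rw [hR, hφ]
    exact tangentialDeriv_chart hx hZ q hs
  rw [fderiv_clm_comp hd hRd] at e2
  have hs : IsSymmSndFDerivAt ℝ (Z ∘ φ) u := by
    rw [hφ]
    refine (contDiffAt_comp_chart_symm hZ q hu).isSymmSndFDerivAt ?_
    rw [minSmoothness_of_isRCLikeNormedField]
    exact WithTop.coe_le_coe.2 le_top
  have e3 := hs (R u v) (R u w)
  have e4 : pinv (fderiv ℝ (x ∘ φ) u) = R u := by rw [hR]
  rw [e1, e2, e4]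
  simp only [ContinuousLinearMap.comp_apply, add_apply,
    ContinuousLinearMap.compL_apply, ContinuousLinearMap.flip_apply, map_sub]
  rw [e3]
  abel

theorem _root_.ContMDiff.const_smul_space (c : ℝ) {Y : M → W}
    (hY : ContMDiff (𝓡 n) 𝓘(ℝ, W) ∞ Y) : ContMDiff (𝓡 n) 𝓘(ℝ, W) ∞ (fun r => c • Y r) :=
  (c • ContinuousLinearMap.id ℝ W).contDiff.comp_contMDiff hY

/-- The failure of second tangential derivatives to be symmetric is the derivative along the
commutator of the tangent fields `v^⊤` and `w^⊤`. -/
theorem tangentialDeriv_commutator (hx : IsSmoothImmersion n x) {Y : M → W}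
    (hY : ContMDiff (𝓡 n) 𝓘(ℝ, W) ∞ Y) (p : M) (v w : V) :
    tangentialDeriv n x (tangentialDeriv n x Y) p v w -
        tangentialDeriv n x (tangentialDeriv n x Y) p w v =
      tangentialDeriv n x Y p (tangentialDeriv n x (tangentialPart n x) p v w -
        tangentialDeriv n x (tangentialPart n x) p w v) := by
  obtain ⟨u, hu, hp⟩ := exists_chart_symm_eq n p
  have hPx : tangentialPart n x = tangentialDeriv n x x :=
    (funext (tangentialDeriv_self hx)).symm
  have e := tangentialDeriv_chart hx hY p hu
  have h1 := tangentialDeriv_commutator_chart hx hY p hu rfl rfl v w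
  -- The case `Z = x` expresses the unknown chart vector through the projection; the Moore–Penrose
  -- inverse recovers it.
  have h2 := tangentialDeriv_commutator_chart hx hx.1 p hu rfl rfl v w
  rw [hp] at e h1 h2
  rw [h1, hPx, h2, e, ContinuousLinearMap.comp_apply,
    pinv_apply_self (fderiv_comp_chart_symm_injective hx p hu)]

theorem tangentialDeriv_eq_zero_of_isMax {f : M → ℝ} (hx : IsSmoothImmersion n x)
    (hf : ContMDiff (𝓡 n) 𝓘(ℝ, ℝ) ∞ f) {p : M} (hp : ∀ q, f q ≤ f p) :
    tangentialDeriv n x f p = 0 := by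
  obtain ⟨u, hu, hpu⟩ := exists_chart_symm_eq n p
  have e := tangentialDeriv_chart hx hf p hu
  have h : IsLocalMax (f ∘ (chartAt (EuclideanSpace ℝ (Fin n)) p).symm) u :=
    Filter.Eventually.of_forall fun s => by simpa [hpu] using hp _
  rw [hpu, h.fderiv_eq_zero] at e
  rw [e, ContinuousLinearMap.zero_comp]

end TangentialCalculus

/-! ### The Gram determinant and its derivative. -/

section GramDeterminant

variable {E V : Type*} [NormedAddCommGroup E] [InnerProductSpace ℝ E] [FiniteDimensional ℝ E]
  [NormedAddCommGroup V] [InnerProductSpace ℝ V] [FiniteDimensional ℝ V]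

/-- The trace of an endomorphism as a function of continuous linear maps. -/
abbrev ctrace (S : E →L[ℝ] E) : ℝ := LinearMap.trace ℝ E S.toLinearMap

theorem ctrace_comp_comm {F : Type*} [NormedAddCommGroup F] [NormedSpace ℝ F]
    [FiniteDimensional ℝ F] {E : Type*} [NormedAddCommGroup E] [NormedSpace ℝ E]
    [FiniteDimensional ℝ E] (S : E →L[ℝ] F) (T : F →L[ℝ] E) :
    LinearMap.trace ℝ E (T.comp S).toLinearMap = LinearMap.trace ℝ F (S.comp T).toLinearMap :=
  LinearMap.trace_comp_comm' S.toLinearMap T.toLinearMap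

theorem ctrace_adjoint [CompleteSpace E] (S : E →L[ℝ] E) :
    ctrace (ContinuousLinearMap.adjoint S) = ctrace S := by
  rw [ctrace, ctrace, LinearMap.trace_eq_sum_inner _ (stdOrthonormalBasis ℝ E),
    LinearMap.trace_eq_sum_inner _ (stdOrthonormalBasis ℝ E)]
  refine Finset.sum_congr rfl fun i _ => ?_
  show ⟪_, ContinuousLinearMap.adjoint S _⟫_ℝ = ⟪_, S _⟫_ℝ
  rw [ContinuousLinearMap.adjoint_inner_right, real_inner_comm]

theorem contDiff_det : ContDiff ℝ ∞ (fun S : E →L[ℝ] E => S.det) := by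
  classical
  set b := (stdOrthonormalBasis ℝ E).toBasis
  have h : (fun S : E →L[ℝ] E => S.det) =
      fun S : E →L[ℝ] E => ∑ σ : Equiv.Perm (Fin (Module.finrank ℝ E)),
        (Equiv.Perm.sign σ : ℝ) * ∏ i, b.repr (S (b i)) (σ i) := by
    funext S
    show LinearMap.det S.toLinearMap = _
    rw [← LinearMap.det_toMatrix b, Matrix.det_apply']
    refine Finset.sum_congr rfl fun σ _ => ?_
    simp [LinearMap.toMatrix_apply]
  rw [h]
  refine ContDiff.sum fun σ _ => contDiff_const.mul (contDiff_prod fun i _ => ?_)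
  exact ((b.coord (σ i)).toContinuousLinearMap.contDiff).comp
    (contDiff_id.clm_apply contDiff_const)

/-- Jacobi's formula for the derivative of the determinant at an invertible map. -/
theorem fderiv_det (A : E ≃L[ℝ] E) (B : E →L[ℝ] E) :
    fderiv ℝ (fun S : E →L[ℝ] E => S.det) A B =
      (A : E →L[ℝ] E).det * ctrace ((A.symm : E →L[ℝ] E).comp B) := by
  classical
  set b := (stdOrthonormalBasis ℝ E).toBasis
  set C := (A.symm : E →L[ℝ] E).comp B with hC
  set m := LinearMap.toMatrix b b C.toLinearMap with hm
  have h1 : HasDerivAt (fun t : ℝ => ((A : E →L[ℝ] E) + t • B).det)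
      (fderiv ℝ (fun S : E →L[ℝ] E => S.det) A B) 0 := by
    have hf := ((contDiff_det (E := E)).contDiffAt.differentiableAt
      (x := (A : E →L[ℝ] E)) (by simp)).hasFDerivAt
    have hg : HasDerivAt (fun t : ℝ => (A : E →L[ℝ] E) + t • B) B 0 := by
      simpa using ((hasDerivAt_id (0 : ℝ)).smul_const B).const_add (A : E →L[ℝ] E)
    exact HasFDerivAt.comp_hasDerivAt (0 : ℝ) (by simpa using hf) hg
  -- `A + t B = A (1 + t C)`, and `det (1 + t C)` is `1 + t tr C` plus `t²` times a polynomial in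
  -- `t`.
  have h2 : (fun t : ℝ => ((A : E →L[ℝ] E) + t • B).det) = fun t =>
      (A : E →L[ℝ] E).det * (1 + m.trace * t +
        (Polynomial.eval t (Matrix.det (1 + (Polynomial.X : Polynomial ℝ) •
          m.map Polynomial.C)).divX.divX) * t ^ 2) := by
    funext t
    have e1 : ((A : E →L[ℝ] E) + t • B).toLinearMap =
        (A : E →L[ℝ] E).toLinearMap.comp (1 + t • C.toLinearMap) := by
      ext v; simp [hC]
    show LinearMap.det ((A : E →L[ℝ] E) + t • B).toLinearMap = _
    rw [e1, LinearMap.det_comp, ← LinearMap.det_toMatrix b (1 + t • C.toLinearMap), map_add,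
      map_smul, LinearMap.toMatrix_one, ← hm, Matrix.det_one_add_smul]
  have h3 : HasDerivAt (fun t : ℝ => ((A : E →L[ℝ] E) + t • B).det)
      ((A : E →L[ℝ] E).det * ctrace C) 0 := by
    rw [h2]
    have htr : ctrace C = m.trace := by
      rw [ctrace, LinearMap.trace_eq_matrix_trace ℝ b]
    rw [htr]
    refine HasDerivAt.const_mul _ ?_
    have ha : HasDerivAt (fun t : ℝ => 1 + m.trace * t) m.trace 0 := by
      simpa using ((hasDerivAt_id (0 : ℝ)).const_mul m.trace).const_add 1
    have hb := (Polynomial.hasDerivAt (Matrix.det (1 + (Polynomial.X : Polynomial ℝ) •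
          m.map Polynomial.C)).divX.divX (0 : ℝ)).mul (hasDerivAt_pow 2 (0 : ℝ))
    refine (ha.add hb).congr_deriv ?_
    simp
  exact h1.unique h3

/-- The Gram determinant `det (T* T)`. -/
def gramDet (T : E →L[ℝ] V) : ℝ :=
  have := FiniteDimensional.complete ℝ E
  have := FiniteDimensional.complete ℝ V
  ((ContinuousLinearMap.adjoint T).comp T).det

theorem contDiff_gramDet : ContDiff ℝ ∞ (gramDet : (E →L[ℝ] V) → ℝ) := by
  have := FiniteDimensional.complete ℝ E
  have := FiniteDimensional.complete ℝ V
  have hadj : ContDiff ℝ ∞ (fun S : E →L[ℝ] V => ContinuousLinearMap.adjoint S) :=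
    (ContinuousLinearMap.adjoint (𝕜 := ℝ) (E := E) (F := V)).toContinuousLinearEquiv.contDiff
  exact contDiff_det.comp (hadj.clm_comp contDiff_id)

/-- With `S` the differential of a change of charts, the square root of the extra factor is the
Jacobian in the change of variables formula. -/
theorem gramDet_comp (T : E →L[ℝ] V) (S : E →L[ℝ] E) :
    gramDet (T.comp S) = S.det ^ 2 * gramDet T := by
  have := FiniteDimensional.complete ℝ E
  have := FiniteDimensional.complete ℝ V
  have hdet : (ContinuousLinearMap.adjoint S).det = S.det := by
    classical
    set b := stdOrthonormalBasis ℝ E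
    show LinearMap.det _ = LinearMap.det _
    rw [← LinearMap.det_toMatrix b.toBasis, ← LinearMap.det_toMatrix b.toBasis,
      ← Matrix.det_transpose]
    congr 1
    ext i j
    simp only [Matrix.transpose_apply, LinearMap.toMatrix_apply, OrthonormalBasis.coe_toBasis,
      OrthonormalBasis.coe_toBasis_repr_apply, OrthonormalBasis.repr_apply_apply]
    show ⟪_, ContinuousLinearMap.adjoint S _⟫_ℝ = ⟪_, S _⟫_ℝ
    rw [ContinuousLinearMap.adjoint_inner_right, real_inner_comm]
  show LinearMap.det (((ContinuousLinearMap.adjoint (T.comp S)).comp (T.comp S)).toLinearMap) = _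
  have e : ((ContinuousLinearMap.adjoint (T.comp S)).comp (T.comp S)).toLinearMap =
      (ContinuousLinearMap.adjoint S).toLinearMap.comp
        ((((ContinuousLinearMap.adjoint T).comp T).toLinearMap).comp S.toLinearMap) := by
    rw [ContinuousLinearMap.adjoint_comp]; rfl
  rw [e, LinearMap.det_comp, LinearMap.det_comp]
  change (ContinuousLinearMap.adjoint S).det * (gramDet T * S.det) = _
  rw [hdet]; ring

theorem gramDet_eq_det {ι : Type*} [Fintype ι] [DecidableEq ι] (b : OrthonormalBasis ι ℝ E)
    (T : E →L[ℝ] V) :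
    gramDet T = (Matrix.of fun i j => ⟪T (b i), T (b j)⟫_ℝ).det := by
  have := FiniteDimensional.complete ℝ E
  have := FiniteDimensional.complete ℝ V
  show LinearMap.det _ = _
  rw [← LinearMap.det_toMatrix b.toBasis]
  congr 1
  ext i j
  simp only [LinearMap.toMatrix_apply, OrthonormalBasis.coe_toBasis,
    OrthonormalBasis.coe_toBasis_repr_apply, OrthonormalBasis.repr_apply_apply, Matrix.of_apply]
  show ⟪_, ContinuousLinearMap.adjoint T (T _)⟫_ℝ = _
  rw [ContinuousLinearMap.adjoint_inner_right]

theorem gramDet_pos {T : E →L[ℝ] V} (hT : Function.Injective T) : 0 < gramDet T := by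
  rw [gramDet_eq_det (stdOrthonormalBasis ℝ E)]
  have hli : LinearIndependent ℝ (fun i => T (stdOrthonormalBasis ℝ E i)) :=
    (stdOrthonormalBasis ℝ E).toBasis.linearIndependent.map' T.toLinearMap
      (LinearMap.ker_eq_bot.2 hT) |> fun h => by simpa [Function.comp_def] using h
  exact (Matrix.posDef_gram_of_linearIndependent (𝕜 := ℝ) hli).det_pos

/-- Jacobi's formula for `T* T`, whose derivative is `T* S + S* T`. The two terms have equal trace
against the self-adjoint `(T* T)⁻¹`, and the resulting factor 2 cancels the one from the square
root. -/
theorem fderiv_sqrt_gramDet {T : E →L[ℝ] V} (hT : Function.Injective T) (S : E →L[ℝ] V) :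
    fderiv ℝ (fun T : E →L[ℝ] V => √(gramDet T)) T S =
      √(gramDet T) * ctrace ((pinv T).comp S) := by
  have := FiniteDimensional.complete ℝ E
  have := FiniteDimensional.complete ℝ V
  obtain ⟨e, he⟩ := exists_equiv_adjoint_comp_self hT
  have hpos := gramDet_pos hT
  have hgd : HasFDerivAt (gramDet : (E →L[ℝ] V) → ℝ) (fderiv ℝ gramDet T) T :=
    (contDiff_gramDet.contDiffAt.differentiableAt (by simp)).hasFDerivAt
  set adj : (E →L[ℝ] V) →L[ℝ] (V →L[ℝ] E) :=
    (ContinuousLinearMap.adjoint (𝕜 := ℝ) (E := E)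
      (F := V)).toContinuousLinearEquiv.toContinuousLinearMap with hadj
  have hpinv : pinv T = (e.symm : E →L[ℝ] E).comp (ContinuousLinearMap.adjoint T) := by
    show ((ContinuousLinearMap.adjoint T).comp T).inverse.comp _ = _
    rw [← he, ContinuousLinearMap.inverse_equiv]
  have hder : fderiv ℝ gramDet T S = gramDet T * (2 * ctrace ((pinv T).comp S)) := by
    have h1 : HasFDerivAt (fun T : E →L[ℝ] V => (adj T).comp T)
        ((ContinuousLinearMap.compL ℝ E V E (adj T)).comp (ContinuousLinearMap.id ℝ _) +
          ((ContinuousLinearMap.compL ℝ E V E).flip T).comp adj) T :=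
      adj.hasFDerivAt.clm_comp (hasFDerivAt_id T)
    have h2 := (contDiff_det (E := E)).contDiffAt.differentiableAt
      (x := ((ContinuousLinearMap.adjoint T).comp T)) (by simp) |>.hasFDerivAt
    have h3 : HasFDerivAt (gramDet : (E →L[ℝ] V) → ℝ) _ T :=
      HasFDerivAt.comp (g := fun S : E →L[ℝ] E => S.det) T h2 h1
    rw [h3.fderiv, ContinuousLinearMap.comp_apply, ← he, fderiv_det]
    have hdet : (e : E →L[ℝ] E).det = gramDet T := by rw [he]; rfl
    rw [hdet]
    congr 1
    have e1 : ctrace ((e.symm : E →L[ℝ] E).comp ((ContinuousLinearMap.adjoint S).comp T)) =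
        ctrace ((pinv T).comp S) := by
      have hsa : ContinuousLinearMap.adjoint (e.symm : E →L[ℝ] E) = e.symm := by
        have h4 : ContinuousLinearMap.adjoint (e : E →L[ℝ] E) = e := by
          rw [he, ContinuousLinearMap.adjoint_comp, ContinuousLinearMap.adjoint_adjoint]
        ext v
        obtain ⟨w, rfl⟩ := e.surjective v
        refine ext_inner_right ℝ fun z => ?_
        rw [ContinuousLinearMap.adjoint_inner_left]
        have h5 : ⟪e w, e.symm z⟫_ℝ = ⟪w, e (e.symm z)⟫_ℝ := by
          have := ContinuousLinearMap.adjoint_inner_left (e : E →L[ℝ] E) (e.symm z) w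
          rw [h4] at this
          exact this
        simpa using h5
      rw [← ctrace_adjoint, ContinuousLinearMap.adjoint_comp, ContinuousLinearMap.adjoint_comp,
        ContinuousLinearMap.adjoint_adjoint, hsa, hpinv, ContinuousLinearMap.comp_assoc]
      exact ctrace_comp_comm (e.symm : E →L[ℝ] E) ((ContinuousLinearMap.adjoint T).comp S)
    have e2 : (e.symm : E →L[ℝ] E).comp
        ((((ContinuousLinearMap.compL ℝ E V E (adj T)).comp (ContinuousLinearMap.id ℝ _) +
          ((ContinuousLinearMap.compL ℝ E V E).flip T).comp adj)) S) =
        (pinv T).comp S + (e.symm : E →L[ℝ] E).comp ((ContinuousLinearMap.adjoint S).comp T) := by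
      rw [hpinv]
      ext v
      simp [hadj]
    rw [e2]
    show LinearMap.trace ℝ E (((pinv T).comp S).toLinearMap +
      ((e.symm : E →L[ℝ] E).comp ((ContinuousLinearMap.adjoint S).comp T)).toLinearMap) = _
    rw [map_add]
    change ctrace _ + ctrace _ = _
    rw [e1]; ring
  have h := (hgd.sqrt hpos.ne').fderiv
  rw [h, smul_apply, hder, smul_eq_mul]
  have hs : √(gramDet T) ≠ 0 := (Real.sqrt_pos.2 hpos).ne'
  field_simp
  rw [Real.sq_sqrt hpos.le]

end GramDeterminant

/-! ### The Riemannian measure of the induced metric. -/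

section Volume

variable {n : ℕ} {M : Type*} [TopologicalSpace M] [ChartedSpace (EuclideanSpace ℝ (Fin n)) M]
  [IsManifold (𝓡 n) ∞ M]
  {V : Type*} [NormedAddCommGroup V] [InnerProductSpace ℝ V] [FiniteDimensional ℝ V]
  {x : M → V}

/-- The density `√(det g_ij)` of the induced metric in the chart at `q`. -/
def chartDensity (n : ℕ) {M : Type*} [TopologicalSpace M]
    [ChartedSpace (EuclideanSpace ℝ (Fin n)) M] (x : M → V) (q : M)
    (u : EuclideanSpace ℝ (Fin n)) : ℝ :=
  √(gramDet (fderiv ℝ (x ∘ (chartAt (EuclideanSpace ℝ (Fin n)) q).symm) u))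

theorem contDiffOn_chartDensity (hx : IsSmoothImmersion n x) (q : M) :
    ContDiffOn ℝ ∞ (chartDensity n x q) (chartAt (EuclideanSpace ℝ (Fin n)) q).target := by
  have h := (contDiffOn_comp_chart_symm hx.1 q).fderiv_of_isOpen (m := ∞)
    (chartAt (EuclideanSpace ℝ (Fin n)) q).open_target (by simp)
  exact (contDiff_gramDet.comp_contDiffOn h).sqrt fun u hu =>
    (gramDet_pos (fderiv_comp_chart_symm_injective hx q hu)).ne'

theorem chartDensity_pos (hx : IsSmoothImmersion n x) (q : M) {u : EuclideanSpace ℝ (Fin n)}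
    (hu : u ∈ (chartAt (EuclideanSpace ℝ (Fin n)) q).target) : 0 < chartDensity n x q u :=
  Real.sqrt_pos.2 (gramDet_pos (fderiv_comp_chart_symm_injective hx q hu))

variable [MeasurableSpace M] [BorelSpace M]

/-- The induced volume of the domain of the chart at `q`. -/
def chartVolume (n : ℕ) {M : Type*} [TopologicalSpace M]
    [ChartedSpace (EuclideanSpace ℝ (Fin n)) M] [MeasurableSpace M] (x : M → V) (q : M) :
    Measure M :=
  Measure.map (chartAt (EuclideanSpace ℝ (Fin n)) q).symm
    ((volume.restrict (chartAt (EuclideanSpace ℝ (Fin n)) q).target).withDensity fun u =>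
      ENNReal.ofReal (chartDensity n x q u))

theorem inducedVolume_eq_iSup (x : M → V) :
    inducedVolume n x = ⨆ q : M, chartVolume n x q := by
  unfold inducedVolume chartVolume chartDensity
  congr 1
  funext q
  congr 2
  funext u
  rw [gramDet_eq_det (EuclideanSpace.basisFun (Fin n) ℝ)]
  simp [gramMatrix]

theorem aemeasurable_chart_symm (q : M) (ν : Measure (EuclideanSpace ℝ (Fin n)))
    (hν : ν ≪ volume.restrict (chartAt (EuclideanSpace ℝ (Fin n)) q).target) :
    AEMeasurable (chartAt (EuclideanSpace ℝ (Fin n)) q).symm ν := by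
  refine AEMeasurable.mono_ac ?_ hν
  exact (chartAt (EuclideanSpace ℝ (Fin n)) q).continuousOn_symm.aemeasurable
    (chartAt (EuclideanSpace ℝ (Fin n)) q).open_target.measurableSet

theorem aemeasurable_chartDensity (hx : IsSmoothImmersion n x) (q : M) :
    AEMeasurable (fun u => ENNReal.ofReal (chartDensity n x q u))
      (volume.restrict (chartAt (EuclideanSpace ℝ (Fin n)) q).target) :=
  ((contDiffOn_chartDensity hx q).continuousOn.aemeasurable
    (chartAt (EuclideanSpace ℝ (Fin n)) q).open_target.measurableSet).ennreal_ofReal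

theorem measurableSet_chart_preimage (q : M) {S : Set M} (hS : MeasurableSet S) :
    MeasurableSet ((chartAt (EuclideanSpace ℝ (Fin n)) q).symm ⁻¹' S ∩
      (chartAt (EuclideanSpace ℝ (Fin n)) q).target) := by
  rw [← Set.inter_comm, ← Subtype.image_preimage_coe]
  refine (chartAt (EuclideanSpace ℝ (Fin n)) q).open_target.measurableSet.subtype_image ?_
  have hc : Measurable ((chartAt (EuclideanSpace ℝ (Fin n)) q).target.domRestrict
      (chartAt (EuclideanSpace ℝ (Fin n)) q).symm) :=
    ((chartAt (EuclideanSpace ℝ (Fin n)) q).continuousOn_symm.domRestrict).measurable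
  exact hc hS

theorem chartVolume_apply (x : M → V) (q : M) {S : Set M} (hS : MeasurableSet S) :
    chartVolume n x q S =
      ∫⁻ u in (chartAt (EuclideanSpace ℝ (Fin n)) q).symm ⁻¹' S ∩
        (chartAt (EuclideanSpace ℝ (Fin n)) q).target, ENNReal.ofReal (chartDensity n x q u) := by
  unfold chartVolume
  rw [Measure.map_apply_of_aemeasurable
    (aemeasurable_chart_symm q _ (withDensity_absolutelyContinuous _ _)) hS, withDensity_apply',
    Measure.restrict_restrict' (chartAt (EuclideanSpace ℝ (Fin n)) q).open_target.measurableSet]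

theorem chartVolume_compl_source (x : M → V) (q : M) :
    chartVolume n x q (chartAt (EuclideanSpace ℝ (Fin n)) q).sourceᶜ = 0 := by
  rw [chartVolume_apply x q (chartAt (EuclideanSpace ℝ (Fin n)) q).open_source.measurableSet.compl]
  have : (chartAt (EuclideanSpace ℝ (Fin n)) q).symm ⁻¹'
      (chartAt (EuclideanSpace ℝ (Fin n)) q).sourceᶜ ∩
        (chartAt (EuclideanSpace ℝ (Fin n)) q).target = ∅ := by
    ext u
    simp only [Set.mem_inter_iff, Set.mem_preimage, Set.mem_compl_iff, Set.mem_empty_iff_false,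
      iff_false, not_and]
    intro h1 h2
    exact h1 ((chartAt (EuclideanSpace ℝ (Fin n)) q).map_target h2)
  rw [this, setLIntegral_empty]

/-- The chart volumes agree on overlaps. -/
theorem chartVolume_apply_eq (hx : IsSmoothImmersion n x) (q r : M) {S : Set M}
    (hS : MeasurableSet S) (hq : S ⊆ (chartAt (EuclideanSpace ℝ (Fin n)) q).source)
    (hr : S ⊆ (chartAt (EuclideanSpace ℝ (Fin n)) r).source) :
    chartVolume n x q S = chartVolume n x r S := by
  rw [chartVolume_apply x q hS, chartVolume_apply x r hS]
  set cq := chartAt (EuclideanSpace ℝ (Fin n)) q with hcq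
  set cr := chartAt (EuclideanSpace ℝ (Fin n)) r with hcr
  set τ : EuclideanSpace ℝ (Fin n) → EuclideanSpace ℝ (Fin n) := fun u => cr (cq.symm u) with hτ
  have himage : τ '' (cq.symm ⁻¹' S ∩ cq.target) = cr.symm ⁻¹' S ∩ cr.target := by
    ext v
    constructor
    · rintro ⟨u, ⟨h1, h2⟩, rfl⟩
      refine ⟨?_, cr.map_source (hr h1)⟩
      show cr.symm (cr (cq.symm u)) ∈ S
      rw [cr.left_inv (hr h1)]
      exact h1
    · rintro ⟨h1, h2⟩
      refine ⟨cq (cr.symm v), ⟨?_, cq.map_source (hq h1)⟩, ?_⟩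
      · show cq.symm (cq (cr.symm v)) ∈ S
        rw [cq.left_inv (hq h1)]
        exact h1
      · show cr (cq.symm (cq (cr.symm v))) = v
        rw [cq.left_inv (hq h1), cr.right_inv h2]
  have hτd : ∀ u ∈ cq.symm ⁻¹' S ∩ cq.target, HasFDerivAt τ (fderiv ℝ τ u) u := by
    rintro u ⟨h1, h2⟩
    have h3 : ContMDiffAt (𝓡 n) (𝓡 n) ∞ cr (cq.symm u) :=
      contMDiffOn_chart.contMDiffAt (cr.open_source.mem_nhds (hr h1))
    have h4 := (h3.comp u (contMDiffAt_chart_symm q h2)).contDiffAt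
    exact (h4.differentiableAt (by simp)).hasFDerivAt
  have hinj : Set.InjOn τ (cq.symm ⁻¹' S ∩ cq.target) := by
    rintro u ⟨h1, h2⟩ v ⟨h3, h4⟩ h
    have h5 := cr.injOn (hr h1) (hr h3) h
    exact cq.symm.injOn h2 h4 h5
  -- Change of variables along the transition map `τ`; by `gramDet_comp` its Jacobian is exactly the
  -- ratio of the two densities.
  rw [← himage, lintegral_image_eq_lintegral_abs_det_fderiv_mul volume
    (measurableSet_chart_preimage q hS) (fun u hu => (hτd u hu).hasFDerivWithinAt) hinj]
  refine setLIntegral_congr_fun (measurableSet_chart_preimage q hS) fun u hu => ?_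
  have hd : HasFDerivAt (x ∘ cr.symm) (fderiv ℝ (x ∘ cr.symm) (τ u)) (τ u) :=
    ((contDiffAt_comp_chart_symm hx.1 r (cr.map_source (hr hu.1))).differentiableAt
      (by simp)).hasFDerivAt
  have heq : (x ∘ cq.symm) =ᶠ[nhds u] (x ∘ cr.symm) ∘ τ := by
    have : cq.symm ⁻¹' cr.source ∈ nhds u :=
      (cq.continuousAt_symm hu.2).preimage_mem_nhds (cr.open_source.mem_nhds (hr hu.1))
    filter_upwards [this] with v hv
    simp [hτ, cr.left_inv hv]
  have hD : fderiv ℝ (x ∘ cq.symm) u = (fderiv ℝ (x ∘ cr.symm) (τ u)).comp (fderiv ℝ τ u) := by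
    rw [heq.fderiv_eq]
    exact (hd.comp u (hτd u hu)).fderiv
  show ENNReal.ofReal √(gramDet (fderiv ℝ (x ∘ cq.symm) u)) =
    _ * ENNReal.ofReal √(gramDet (fderiv ℝ (x ∘ cr.symm) (τ u)))
  rw [hD, gramDet_comp, Real.sqrt_mul (sq_nonneg _), Real.sqrt_sq_eq_abs,
    ENNReal.ofReal_mul (abs_nonneg _)]

theorem exists_finite_chart_cover (n : ℕ) (M : Type*) [TopologicalSpace M] [CompactSpace M]
    [ChartedSpace (EuclideanSpace ℝ (Fin n)) M] :
    ∃ (k : ℕ) (q : Fin k → M), ∀ p, ∃ i, p ∈ (chartAt (EuclideanSpace ℝ (Fin n)) (q i)).source := by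
  obtain ⟨t, ht⟩ := isCompact_univ.elim_finite_subcover
    (fun q : M => (chartAt (EuclideanSpace ℝ (Fin n)) q).source)
    (fun q => (chartAt (EuclideanSpace ℝ (Fin n)) q).open_source)
    (fun p _ => Set.mem_iUnion.2 ⟨p, mem_chart_source _ p⟩)
  refine ⟨t.card, fun i => (t.equivFin.symm i : M), fun p => ?_⟩
  obtain ⟨q, hq, hp⟩ := Set.mem_iUnion₂.1 (ht (Set.mem_univ p))
  exact ⟨t.equivFin ⟨q, hq⟩, by simpa using hp⟩

theorem chartVolume_le_inducedVolume (x : M → V) (q : M) :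
    chartVolume n x q ≤ inducedVolume n x := by
  rw [inducedVolume_eq_iSup]
  exact le_iSup (fun q => chartVolume n x q) q

/-- Finitely many chart domains cover `M`. Making them disjoint and summing the restricted chart
volumes gives `ν`; agreement on overlaps makes the result correct in every chart. It serves as an
upper bound for the supremum defining `inducedVolume`. -/
theorem exists_gluing [CompactSpace M] (hx : IsSmoothImmersion n x) :
    ∃ ν : Measure M, ∀ q : M, ∀ S, MeasurableSet S →
      S ⊆ (chartAt (EuclideanSpace ℝ (Fin n)) q).source → ν S = chartVolume n x q S := by
  obtain ⟨k, q, hq⟩ := exists_finite_chart_cover n M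
  set A : Fin k → Set M := disjointed fun i =>
    (chartAt (EuclideanSpace ℝ (Fin n)) (q i)).source with hA
  have hAm : ∀ i, MeasurableSet (A i) := fun i => by
    rw [hA, disjointed_apply, Finset.sup_set_eq_biUnion]
    exact (chartAt (EuclideanSpace ℝ (Fin n)) (q i)).open_source.measurableSet.diff
      (Finset.measurableSet_biUnion _ fun j _ =>
        (chartAt (EuclideanSpace ℝ (Fin n)) (q j)).open_source.measurableSet)
  have hAd : Pairwise (Function.onFun Disjoint A) := disjoint_disjointed _
  have hAs : ∀ i, A i ⊆ (chartAt (EuclideanSpace ℝ (Fin n)) (q i)).source := fun i =>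
    disjointed_subset _ i
  have hAu : ⋃ i, A i = Set.univ := by
    rw [hA, iUnion_disjointed]
    exact Set.eq_univ_of_forall fun p => Set.mem_iUnion.2 (hq p)
  refine ⟨Measure.sum fun i => (chartVolume n x (q i)).restrict (A i), fun r S hS hSr => ?_⟩
  rw [Measure.sum_apply _ hS]
  have h1 : ∀ i, (chartVolume n x (q i)).restrict (A i) S = chartVolume n x r (S ∩ A i) :=
    fun i => by
      rw [Measure.restrict_apply hS]
      exact chartVolume_apply_eq (n := n) hx _ _ (hS.inter (hAm i))
        (Set.inter_subset_right.trans (hAs i)) (Set.inter_subset_left.trans hSr)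
  simp only [h1]
  rw [← measure_iUnion _ fun i => hS.inter (hAm i), ← Set.inter_iUnion, hAu, Set.inter_univ]
  exact fun i j hij => (hAd hij).mono Set.inter_subset_right Set.inter_subset_right

/-- One inequality is a single term of the supremum. For the other, the glued measure dominates
every chart volume, hence the supremum, and equals the chart volume on `S`. -/
theorem inducedVolume_apply_of_subset [CompactSpace M] (hx : IsSmoothImmersion n x) (q : M)
    {S : Set M} (hS : MeasurableSet S)
    (hq : S ⊆ (chartAt (EuclideanSpace ℝ (Fin n)) q).source) :
    inducedVolume n x S = chartVolume n x q S := by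
  obtain ⟨ν, hν⟩ := exists_gluing hx
  refine le_antisymm ?_ (chartVolume_le_inducedVolume x q S)
  rw [← hν q S hS hq]
  have hle : inducedVolume n x ≤ ν := by
    rw [inducedVolume_eq_iSup]
    refine iSup_le fun r => Measure.le_iff.2 fun T hT => ?_
    have hs := (chartAt (EuclideanSpace ℝ (Fin n)) r).open_source.measurableSet
    calc chartVolume n x r T
        ≤ chartVolume n x r ((T ∩ (chartAt (EuclideanSpace ℝ (Fin n)) r).source) ∪
          (chartAt (EuclideanSpace ℝ (Fin n)) r).sourceᶜ) := by
          refine measure_mono fun p hp => ?_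
          by_cases h : p ∈ (chartAt (EuclideanSpace ℝ (Fin n)) r).source
          · exact Or.inl ⟨hp, h⟩
          · exact Or.inr h
      _ ≤ chartVolume n x r (T ∩ (chartAt (EuclideanSpace ℝ (Fin n)) r).source) + 0 := by
          rw [← chartVolume_compl_source (n := n) x r]
          exact measure_union_le _ _
      _ = ν (T ∩ (chartAt (EuclideanSpace ℝ (Fin n)) r).source) := by
          rw [add_zero, hν r _ (hT.inter hs) Set.inter_subset_right]
      _ ≤ ν T := measure_mono Set.inter_subset_left
  exact hle S

theorem inducedVolume_restrict_source [CompactSpace M] (hx : IsSmoothImmersion n x) (q : M) :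
    (inducedVolume n x).restrict (chartAt (EuclideanSpace ℝ (Fin n)) q).source =
      chartVolume n x q := by
  have hs := (chartAt (EuclideanSpace ℝ (Fin n)) q).open_source.measurableSet
  ext S hS
  rw [Measure.restrict_apply hS,
    inducedVolume_apply_of_subset hx q (hS.inter hs) Set.inter_subset_right]
  refine le_antisymm (measure_mono Set.inter_subset_left) ?_
  have h := measure_inter_add_sdiff (μ := chartVolume n x q) S hs
  rw [← h]
  have h0 : chartVolume n x q (S \ (chartAt (EuclideanSpace ℝ (Fin n)) q).source) = 0 :=
    measure_mono_null (fun p hp => hp.2) (chartVolume_compl_source x q)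
  rw [h0, add_zero]

/-- The density is bounded on a small closed ball in a chart, so the measure is locally finite, and
`M` is compact. Every continuous integrand is therefore integrable. -/
theorem isFiniteMeasure_inducedVolume [CompactSpace M] (hx : IsSmoothImmersion n x) :
    IsFiniteMeasure (inducedVolume n x) := by
  have hloc : IsLocallyFiniteMeasure (inducedVolume n x) := by
    refine ⟨fun p => ?_⟩
    set c := chartAt (EuclideanSpace ℝ (Fin n)) p with hc
    obtain ⟨ε, hε, hball⟩ := Metric.isOpen_iff.1 c.open_target (c p) (mem_chart_target _ p)
    have hcb : Metric.closedBall (c p) (ε / 2) ⊆ c.target :=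
      (Metric.closedBall_subset_ball (by linarith)).trans hball
    obtain ⟨C, hC⟩ := (isCompact_closedBall (c p) (ε / 2)).bddAbove_image
      ((contDiffOn_chartDensity hx p).continuousOn.mono hcb)
    have hopen : IsOpen (c.source ∩ c ⁻¹' Metric.ball (c p) (ε / 2)) :=
      c.isOpen_inter_preimage Metric.isOpen_ball
    refine ⟨c.source ∩ c ⁻¹' Metric.ball (c p) (ε / 2),
      hopen.mem_nhds ⟨mem_chart_source _ p, Metric.mem_ball_self (by linarith)⟩, ?_⟩
    rw [inducedVolume_apply_of_subset hx p hopen.measurableSet Set.inter_subset_left,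
      chartVolume_apply x p hopen.measurableSet]
    have hsub : c.symm ⁻¹' (c.source ∩ c ⁻¹' Metric.ball (c p) (ε / 2)) ∩ c.target ⊆
        Metric.closedBall (c p) (ε / 2) := by
      rintro u ⟨⟨_, h2⟩, h3⟩
      have h4 : c (c.symm u) ∈ Metric.ball (c p) (ε / 2) := h2
      rw [c.right_inv h3] at h4
      exact Metric.ball_subset_closedBall h4
    calc _ ≤ ∫⁻ u in Metric.closedBall (c p) (ε / 2), ENNReal.ofReal (chartDensity n x p u) :=
          lintegral_mono_set hsub
      _ ≤ ∫⁻ _ in Metric.closedBall (c p) (ε / 2), ENNReal.ofReal C := by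
          refine setLIntegral_mono measurable_const fun u hu => ENNReal.ofReal_le_ofReal ?_
          exact hC ⟨u, hu, rfl⟩
      _ < ⊤ := by
          rw [setLIntegral_const]
          exact ENNReal.mul_lt_top ENNReal.ofReal_lt_top measure_closedBall_lt_top
  exact CompactSpace.isFiniteMeasure

/-- Used to deduce that a continuous nonnegative function with zero integral vanishes at every
point, not only almost everywhere. -/
theorem isOpenPosMeasure_inducedVolume [CompactSpace M] (hx : IsSmoothImmersion n x) :
    (inducedVolume n x).IsOpenPosMeasure := by
  refine ⟨fun U hU ⟨p, hp⟩ h0 => ?_⟩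
  set c := chartAt (EuclideanSpace ℝ (Fin n)) p with hc
  have h1 : chartVolume n x p U = 0 :=
    le_antisymm ((chartVolume_le_inducedVolume x p U).trans h0.le) zero_le
  rw [chartVolume_apply x p hU.measurableSet] at h1
  have hm := measurableSet_chart_preimage (n := n) p hU.measurableSet
  have hopen : IsOpen (c.symm ⁻¹' U ∩ c.target) := by
    rw [Set.inter_comm]; exact c.isOpen_inter_preimage_symm hU
  have hne : (c.symm ⁻¹' U ∩ c.target).Nonempty :=
    ⟨c p, by simpa [c.left_inv (mem_chart_source _ p)] using hp, mem_chart_target _ p⟩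
  have hpos := hopen.measure_pos volume hne
  rw [lintegral_eq_zero_iff' ((aemeasurable_chartDensity (n := n) hx p).mono_measure
    (Measure.restrict_mono Set.inter_subset_right le_rfl))] at h1
  rw [Filter.EventuallyEq, ae_restrict_iff' hm] at h1
  refine hpos.ne' (measure_mono_null (fun u hu => ?_) h1)
  simp only [Set.mem_compl_iff, Set.mem_ofPred_eq, Classical.not_imp]
  refine ⟨hu, ?_⟩
  simpa using chartDensity_pos (n := n) hx p hu.2

theorem integral_inducedVolume_chart [CompactSpace M] (hx : IsSmoothImmersion n x) (q : M)
    {g : M → ℝ} (hg : Continuous g)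
    (hs : Function.support g ⊆ (chartAt (EuclideanSpace ℝ (Fin n)) q).source) :
    ∫ p, g p ∂(inducedVolume n x) =
      ∫ u in (chartAt (EuclideanSpace ℝ (Fin n)) q).target,
        chartDensity n x q u * g ((chartAt (EuclideanSpace ℝ (Fin n)) q).symm u) := by
  rw [← setIntegral_eq_integral_of_forall_compl_eq_zero
    (s := (chartAt (EuclideanSpace ℝ (Fin n)) q).source)
    (fun p hp => by by_contra h; exact hp (hs h)), inducedVolume_restrict_source hx q, chartVolume,
    integral_map (aemeasurable_chart_symm q _ (withDensity_absolutelyContinuous _ _))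
      hg.aestronglyMeasurable,
    integral_withDensity_eq_integral_toReal_smul₀ (aemeasurable_chartDensity hx q)
      (Filter.Eventually.of_forall fun u => ENNReal.ofReal_lt_top)]
  refine integral_congr_ae (Filter.Eventually.of_forall fun u => ?_)
  show (ENNReal.ofReal (chartDensity n x q u)).toReal • _ = _
  rw [ENNReal.toReal_ofReal (by exact Real.sqrt_nonneg _), smul_eq_mul]

theorem integrable_inducedVolume [CompactSpace M] (hx : IsSmoothImmersion n x) {g : M → ℝ}
    (hg : Continuous g) : Integrable g (inducedVolume n x) := by
  have := isFiniteMeasure_inducedVolume hx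
  exact hg.integrable_of_hasCompactSupport (HasCompactSupport.of_compactSpace g)

end Volume

/-! ### The divergence theorem. -/

section Divergence

variable {n : ℕ} {M : Type*} [TopologicalSpace M] [ChartedSpace (EuclideanSpace ℝ (Fin n)) M]
  [IsManifold (𝓡 n) ∞ M]
  {V : Type*} [NormedAddCommGroup V] [InnerProductSpace ℝ V] [FiniteDimensional ℝ V]
  {x : M → V}

/-- The tangential divergence of the tangential part of the constant field `w`. It is the `w`
component of the mean curvature vector. -/
def divTangentialPart (n : ℕ) {M : Type*} [TopologicalSpace M]
    [ChartedSpace (EuclideanSpace ℝ (Fin n)) M] (x : M → V) (w : V) (p : M) : ℝ :=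
  ctrace (tangentialDeriv n x (fun r => tangentialPart n x r w) p)

theorem contMDiff_divTangentialPart (hx : IsSmoothImmersion n x) (w : V) :
    ContMDiff (𝓡 n) 𝓘(ℝ, ℝ) ∞ (divTangentialPart n x w) := by
  have h1 := contMDiff_tangentialDeriv hx
    ((contMDiff_tangentialPart hx).clm_apply (contMDiff_const (c := w)))
  have hl : ContDiff ℝ ∞ (fun S : V →L[ℝ] V => ctrace S) :=
    ((LinearMap.trace ℝ V).comp
      (ContinuousLinearMap.coeLM ℝ (M := V) (N₃ := V))).toContinuousLinearMap.contDiff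
  exact hl.comp_contMDiff h1

/-- Integration by parts of each coordinate against the constant 1. -/
theorem integral_trace_fderiv_eq_zero {Z : EuclideanSpace ℝ (Fin n) → EuclideanSpace ℝ (Fin n)}
    (hZ : ContDiff ℝ 1 Z) (hc : HasCompactSupport Z) :
    ∫ u, ctrace (fderiv ℝ Z u) = 0 := by
  have h1 : ∀ u, ctrace (fderiv ℝ Z u) =
      ∑ i, fderiv ℝ (fun s => Z s i) u (EuclideanSpace.basisFun (Fin n) ℝ i) := fun u => by
    rw [ctrace, LinearMap.trace_eq_sum_inner _ (EuclideanSpace.basisFun (Fin n) ℝ)]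
    refine Finset.sum_congr rfl fun i _ => ?_
    have h2 : fderiv ℝ (fun s => Z s i) u =
        (EuclideanSpace.proj (𝕜 := ℝ) i).comp (fderiv ℝ Z u) :=
      ((EuclideanSpace.proj (𝕜 := ℝ) i).hasFDerivAt.comp u
        ((hZ.differentiable (by simp)) u).hasFDerivAt).fderiv
    rw [h2]
    simp [EuclideanSpace.inner_single_left]
  have hcd : ∀ i, ContDiff ℝ 1 (fun s => Z s i) := fun i =>
    (EuclideanSpace.proj (𝕜 := ℝ) i).contDiff.comp hZ
  have hcc : ∀ i, HasCompactSupport (fun s => Z s i) := fun i =>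
    hc.comp_left (g := fun z : EuclideanSpace ℝ (Fin n) => z i) rfl
  have hint : ∀ i, Integrable (fun u => fderiv ℝ (fun s => Z s i) u
      (EuclideanSpace.basisFun (Fin n) ℝ i)) := fun i =>
    (((hcd i).continuous_fderiv (by simp)).clm_apply continuous_const).integrable_of_hasCompactSupport
      ((hcc i).fderiv_apply ℝ _)
  simp only [h1]
  rw [integral_finsetSum _ fun i _ => hint i]
  refine Finset.sum_eq_zero fun i _ => ?_
  have h3 := integral_mul_fderiv_eq_neg_fderiv_mul_of_integrable (μ := volume)
    (f := fun _ : EuclideanSpace ℝ (Fin n) => (1 : ℝ)) (g := fun s => Z s i)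
    (v := EuclideanSpace.basisFun (Fin n) ℝ i) (by simp) (by simpa using hint i)
    (by simpa using (hcd i).continuous.integrable_of_hasCompactSupport (hcc i))
    (fun _ _ => differentiableAt_const _) (fun u _ => (hcd i).differentiable (by simp) u)
  simpa using h3

/-- The divergence of the tangent field `f w^⊤` in a chart. -/
theorem divergence_chart (hx : IsSmoothImmersion n x) {f : M → ℝ}
    (hf : ContMDiff (𝓡 n) 𝓘(ℝ, ℝ) ∞ f) (w : V) (q : M) {u : EuclideanSpace ℝ (Fin n)}
    (hu : u ∈ (chartAt (EuclideanSpace ℝ (Fin n)) q).target)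
    {φ : EuclideanSpace ℝ (Fin n) → M} (hφ : φ = (chartAt (EuclideanSpace ℝ (Fin n)) q).symm) :
    ctrace (fderiv ℝ (fun s => (chartDensity n x q s * f (φ s)) •
        pinv (fderiv ℝ (x ∘ φ) s) w) u) =
      chartDensity n x q u * (tangentialDeriv n x f (φ u) w +
        f (φ u) * divTangentialPart n x w (φ u)) := by
  have ho := (chartAt (EuclideanSpace ℝ (Fin n)) q).open_target
  have hnhds := ho.mem_nhds hu
  set T : EuclideanSpace ℝ (Fin n) → (EuclideanSpace ℝ (Fin n) →L[ℝ] V) :=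
    fun s => fderiv ℝ (x ∘ φ) s with hT
  set ξ : EuclideanSpace ℝ (Fin n) → EuclideanSpace ℝ (Fin n) := fun s => pinv (T s) w with hξ
  have hinj : Function.Injective (T u) := by
    rw [hT, hφ]; exact fderiv_comp_chart_symm_injective hx q hu
  have hTd : HasFDerivAt T (fderiv ℝ T u) u := by
    have h2 := ((contDiffOn_comp_chart_symm hx.1 q).fderiv_of_isOpen (m := ∞) ho
      (by simp)).contDiffAt hnhds
    rw [← hφ] at h2
    exact (h2.differentiableAt (by simp)).hasFDerivAt
  have hξd : HasFDerivAt ξ (fderiv ℝ ξ u) u := by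
    have h2 := differentiableAt_pinv_fderiv hx q hu
    rw [← hφ] at h2
    exact (h2.clm_apply (differentiableAt_const w)).hasFDerivAt
  have hJd : HasFDerivAt (chartDensity n x q) (fderiv ℝ (chartDensity n x q) u) u :=
    (((contDiffOn_chartDensity hx q).contDiffAt hnhds).differentiableAt (by simp)).hasFDerivAt
  have hfd : HasFDerivAt (f ∘ φ) (fderiv ℝ (f ∘ φ) u) u := by
    rw [hφ]
    exact ((contDiffAt_comp_chart_symm hf q hu).differentiableAt (by simp)).hasFDerivAt
  have hJ : fderiv ℝ (chartDensity n x q) u (ξ u) =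
      chartDensity n x q u * ctrace ((pinv (T u)).comp (fderiv ℝ T u (ξ u))) := by
    have h1 : chartDensity n x q = (fun S => √(gramDet S)) ∘ T := by
      rw [hT, hφ]; rfl
    have h2 : DifferentiableAt ℝ (fun S : EuclideanSpace ℝ (Fin n) →L[ℝ] V => √(gramDet S)) (T u) :=
      (contDiff_gramDet.contDiffAt.differentiableAt (by simp)).sqrt (gramDet_pos hinj).ne'
    rw [h1, (h2.hasFDerivAt.comp u hTd).fderiv, ContinuousLinearMap.comp_apply,
      fderiv_sqrt_gramDet hinj]
    rfl
  have hsymm : (fderiv ℝ T u).flip (ξ u) = fderiv ℝ T u (ξ u) := by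
    ext s
    have hs : IsSymmSndFDerivAt ℝ (x ∘ φ) u := by
      rw [hφ]
      refine (contDiffAt_comp_chart_symm hx.1 q hu).isSymmSndFDerivAt ?_
      rw [minSmoothness_of_isRCLikeNormedField]
      exact WithTop.coe_le_coe.2 le_top
    exact hs s (ξ u)
  -- In the chart `w^⊤ = T ξ`; the product rule applies, and symmetry of the second derivative of `x
  -- ∘ φ` rewrites the term in `dT`.
  have hP : fderiv ℝ ((fun r => tangentialPart n x r w) ∘ φ) u =
      (T u).comp (fderiv ℝ ξ u) + fderiv ℝ T u (ξ u) := by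
    have h1 : ((fun r => tangentialPart n x r w) ∘ φ) =ᶠ[nhds u] fun s => T s (ξ s) := by
      filter_upwards [hnhds] with s hs
      have hi := fderiv_comp_chart_symm_injective hx q hs
      rw [← hφ] at hi
      have e := tangentPlane_chart hx q hs
      rw [← hφ] at e
      rw [Function.comp_apply, tangentialPart_eq_of_tangentPlane_eq e]
      exact (apply_pinv hi w).symm
    rw [h1.fderiv_eq, (hTd.clm_apply hξd).fderiv, hsymm]
  -- Cyclicity of the trace and `pinv T ∘ T = 1` leave `tr dξ` plus the logarithmic derivative of
  -- `√det g` along `ξ` found in `hJ`. This is the classical `div = (1/√g) ∂_i (√g ξ^i)`.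
  have hH : divTangentialPart n x w (φ u) =
      ctrace (fderiv ℝ ξ u) + ctrace ((pinv (T u)).comp (fderiv ℝ T u (ξ u))) := by
    have e := tangentialDeriv_chart hx
      ((contMDiff_tangentialPart hx).clm_apply (contMDiff_const (c := w))) q hu
    rw [← hφ] at e
    unfold divTangentialPart
    rw [e, hP, ctrace, ← ctrace_comp_comm, ContinuousLinearMap.comp_add,
      ← ContinuousLinearMap.comp_assoc, pinv_comp_self hinj, ContinuousLinearMap.id_comp]
    exact map_add (LinearMap.trace ℝ _) _ _
  have hfE : tangentialDeriv n x f (φ u) w = fderiv ℝ (f ∘ φ) u (ξ u) := by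
    have e := tangentialDeriv_chart hx hf q hu
    rw [← hφ] at e
    rw [e]; rfl
  have hZ := ((hJd.mul hfd).smul hξd).fderiv
  change ctrace (fderiv ℝ ((chartDensity n x q * (f ∘ φ)) • ξ) u) = _
  rw [hZ, hfE, hH]
  have htr : ∀ (c : ℝ) (A : EuclideanSpace ℝ (Fin n) →L[ℝ] EuclideanSpace ℝ (Fin n))
      (l : EuclideanSpace ℝ (Fin n) →L[ℝ] ℝ) (z : EuclideanSpace ℝ (Fin n)),
      ctrace (c • A + l.smulRight z) = c * ctrace A + l z := fun c A l z => by
    show LinearMap.trace ℝ _ (c • A.toLinearMap + l.toLinearMap.smulRight z) = _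
    rw [map_add, map_smul, LinearMap.trace_smulRight]; rfl
  rw [htr]
  simp only [add_apply, smul_apply, smul_eq_mul, hJ, Pi.mul_apply, Function.comp_apply]
  ring

variable [MeasurableSpace M] [BorelSpace M] [T2Space M] [CompactSpace M]

/-- The coordinate field, extended by zero outside the chart target, is `C¹` with compact support
because the support of `f` is compact inside the chart domain. Its Euclidean divergence integrates
to zero. -/
theorem integral_divergence_of_tsupport_subset (hx : IsSmoothImmersion n x) {f : M → ℝ}
    (hf : ContMDiff (𝓡 n) 𝓘(ℝ, ℝ) ∞ f) (w : V) (q : M)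
    (hs : tsupport f ⊆ (chartAt (EuclideanSpace ℝ (Fin n)) q).source) :
    ∫ p, (tangentialDeriv n x f p w + f p * divTangentialPart n x w p) ∂(inducedVolume n x) = 0 := by
  set c := chartAt (EuclideanSpace ℝ (Fin n)) q with hc
  have hzero : ∀ p, p ∉ tsupport f → tangentialDeriv n x f p w = 0 := fun p hp => by
    have h0 : f =ᶠ[nhds p] fun _ => 0 := notMem_tsupport_iff_eventuallyEq.1 hp
    show mfderiv (𝓡 n) 𝓘(ℝ, ℝ) f p _ = 0
    rw [h0.mfderiv_eq, mfderiv_const]; rfl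
  have hsupp : Function.support (fun p => tangentialDeriv n x f p w +
      f p * divTangentialPart n x w p) ⊆ c.source := fun p hp => by
    by_contra h
    have h1 : p ∉ tsupport f := fun h2 => h (hs h2)
    exact hp (by simp [hzero p h1, image_eq_zero_of_notMem_tsupport h1])
  have hcont : Continuous (fun p => tangentialDeriv n x f p w +
      f p * divTangentialPart n x w p) :=
    (((contMDiff_tangentialDeriv hx hf).continuous).clm_apply continuous_const).add
      (hf.continuous.mul (contMDiff_divTangentialPart hx w).continuous)
  rw [integral_inducedVolume_chart hx q hcont hsupp]
  set Z₀ : EuclideanSpace ℝ (Fin n) → EuclideanSpace ℝ (Fin n) := fun s =>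
    (chartDensity n x q s * f (c.symm s)) • pinv (fderiv ℝ (x ∘ c.symm) s) w with hZ₀
  set Z := c.target.indicator Z₀ with hZ
  have hK : IsCompact (c '' tsupport f) :=
    (isClosed_tsupport f).isCompact.image_of_continuousOn (c.continuousOn.mono hs)
  have hZK : ∀ u, u ∉ c '' tsupport f → Z u = 0 := fun u hu => by
    by_cases h : u ∈ c.target
    · rw [hZ, Set.indicator_of_mem h, hZ₀]
      have h1 : c.symm u ∉ tsupport f := fun h2 => hu ⟨_, h2, c.right_inv h⟩
      simp [image_eq_zero_of_notMem_tsupport h1]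
    · exact Set.indicator_of_notMem h _
  have hloc : ∀ u ∈ c.target, Z =ᶠ[nhds u] Z₀ := fun u hu => by
    filter_upwards [c.open_target.mem_nhds hu] with s hs using Set.indicator_of_mem hs _
  have hZ₀d : ∀ u ∈ c.target, ContDiffAt ℝ ∞ Z₀ u := fun u hu => by
    have hn := c.open_target.mem_nhds hu
    have h1 := (contDiffOn_chartDensity hx q).contDiffAt hn
    have h2 := contDiffAt_comp_chart_symm hf q hu
    have h3 := ((contDiffOn_comp_chart_symm hx.1 q).fderiv_of_isOpen (m := ∞) c.open_target
      (by simp)).contDiffAt hn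
    have h4 := (contDiffAt_pinv (fderiv_comp_chart_symm_injective hx q hu)).comp u h3
    exact (h1.mul h2).smul (h4.clm_apply contDiffAt_const)
  have hZd : ContDiff ℝ 1 Z := contDiff_iff_contDiffAt.2 fun u => by
    by_cases h : u ∈ c.target
    · exact ((hZ₀d u h).congr_of_eventuallyEq (hloc u h)).of_le (by simp)
    · have h1 : u ∉ c '' tsupport f := by
        rintro ⟨p, hp, rfl⟩
        exact h (c.map_source (hs hp))
      have h2 : Z =ᶠ[nhds u] fun _ => 0 := by
        filter_upwards [hK.isClosed.isOpen_compl.mem_nhds h1] with s hs using hZK s hs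
      exact contDiffAt_const.congr_of_eventuallyEq h2
  have hmain := integral_trace_fderiv_eq_zero hZd (HasCompactSupport.intro hK hZK)
  have hout : ∀ u, u ∉ c.target → ctrace (fderiv ℝ Z u) = 0 := fun u h => by
    have h1 : u ∉ c '' tsupport f := by
      rintro ⟨p, hp, rfl⟩
      exact h (c.map_source (hs hp))
    have h2 : Z =ᶠ[nhds u] fun _ => 0 := by
      filter_upwards [hK.isClosed.isOpen_compl.mem_nhds h1] with s hs using hZK s hs
    rw [h2.fderiv_eq]
    simp [ctrace]
  rw [← setIntegral_eq_integral_of_forall_compl_eq_zero hout] at hmain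
  rw [← hmain]
  refine setIntegral_congr_fun c.open_target.measurableSet fun u hu => ?_
  have h5 := divergence_chart hx hf w q hu rfl
  rw [← hc] at h5
  show _ = ctrace (fderiv ℝ Z u)
  rw [(hloc u hu).fderiv_eq, ← h5]

/-- The divergence theorem for the tangent field `f w^⊤`. -/
theorem integral_divergence (hx : IsSmoothImmersion n x) {f : M → ℝ}
    (hf : ContMDiff (𝓡 n) 𝓘(ℝ, ℝ) ∞ f) (w : V) :
    ∫ p, (tangentialDeriv n x f p w + f p * divTangentialPart n x w p) ∂(inducedVolume n x) = 0 := by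
  obtain ⟨ρ, hρ⟩ := SmoothPartitionOfUnity.exists_isSubordinate_chartAt_source (𝓡 n) M
  have hfin : {i | (Function.support (ρ i)).Nonempty}.Finite :=
    ρ.locallyFinite.finite_nonempty_of_compact
  set t := hfin.toFinset with ht
  have hρs : ∀ i, ContMDiff (𝓡 n) 𝓘(ℝ, ℝ) ∞ (fun p => ρ i p) := fun i => (ρ i).contMDiff
  have hgs : ∀ i, ContMDiff (𝓡 n) 𝓘(ℝ, ℝ) ∞ (fun p => ρ i p * f p) := fun i => (hρs i).mul hf
  have hsum : ∀ p, ∑ i ∈ t, ρ i p = 1 := fun p => by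
    rw [← ρ.sum_eq_one (Set.mem_univ p), finsum_eq_sum_of_support_subset]
    intro i hi
    rw [ht, Set.Finite.coe_toFinset]
    exact ⟨p, hi⟩
  -- The integrand is linear in `f`, so splitting `f` itself suffices and no derivative of the `ρ i`
  -- has to be cancelled.
  have hfsum : f = fun p => ∑ i ∈ t, ρ i p * f p := by
    funext p
    rw [← Finset.sum_mul, hsum, one_mul]
  have hder : ∀ p, tangentialDeriv n x f p w =
      ∑ i ∈ t, tangentialDeriv n x (fun p => ρ i p * f p) p w := fun p => by
    conv_lhs => rw [hfsum]
    rw [tangentialDeriv_sum t hgs, FunLike.coe_sum, Finset.sum_apply]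
  have heq : ∀ p, tangentialDeriv n x f p w + f p * divTangentialPart n x w p =
      ∑ i ∈ t, (tangentialDeriv n x (fun p => ρ i p * f p) p w +
        (ρ i p * f p) * divTangentialPart n x w p) := fun p => by
    rw [Finset.sum_add_distrib, ← hder, ← Finset.sum_mul, ← Finset.sum_mul, hsum, one_mul]
  simp only [heq]
  rw [integral_finsetSum]
  · refine Finset.sum_eq_zero fun i _ => integral_divergence_of_tsupport_subset hx (hgs i) w i ?_
    exact (tsupport_mul_subset_left (f := fun p => ρ i p) (g := f)).trans (hρ i)
  · intro i _
    exact integrable_inducedVolume hx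
      ((((contMDiff_tangentialDeriv hx (hgs i)).continuous).clm_apply continuous_const).add
      ((hgs i).continuous.mul (contMDiff_divTangentialPart hx w).continuous))

end Divergence

/-! ### The derivative `S` of the tangential projection `P`, and the second fundamental form. -/

section Projections

variable {n : ℕ} {M : Type*} [TopologicalSpace M] [ChartedSpace (EuclideanSpace ℝ (Fin n)) M]
  [IsManifold (𝓡 n) ∞ M]
  {V : Type*} [NormedAddCommGroup V] [InnerProductSpace ℝ V] [FiniteDimensional ℝ V]
  {W : Type*} [NormedAddCommGroup W] [NormedSpace ℝ W]
  {x : M → V}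

/-- The derivative of the tangential projection in the direction `v^⊤`. -/
abbrev derivProj (n : ℕ) {M : Type*} [TopologicalSpace M]
    [ChartedSpace (EuclideanSpace ℝ (Fin n)) M] (x : M → V) (p : M) : V →L[ℝ] V →L[ℝ] V :=
  tangentialDeriv n x (tangentialPart n x) p

theorem sum_bilin_move {ι : Type*} [Fintype ι] (b : OrthonormalBasis ι ℝ V)
    (B : V →ₗ[ℝ] V →ₗ[ℝ] W) (S T : V →L[ℝ] V) (h : ∀ v w, ⟪S v, w⟫_ℝ = ⟪v, T w⟫_ℝ) :
    ∑ i, B (S (b i)) (b i) = ∑ i, B (b i) (T (b i)) := by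
  have := FiniteDimensional.complete ℝ V
  have hT : T = ContinuousLinearMap.adjoint S := by
    rw [ContinuousLinearMap.eq_adjoint_iff]
    intro v w
    rw [real_inner_comm, ← h, real_inner_comm]
  rw [sum_bilin_adjoint b b B S, hT]

theorem tangentialPart_idem (x : M → V) (p : M) (w : V) :
    tangentialPart n x p (tangentialPart n x p w) = tangentialPart n x p w :=
  Submodule.starProjection_eq_self_iff.2 (Submodule.starProjection_apply_mem _ _)

theorem tangentialPart_symm (x : M → V) (p : M) (v w : V) :
    ⟪tangentialPart n x p v, w⟫_ℝ = ⟪v, tangentialPart n x p w⟫_ℝ :=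
  Submodule.inner_starProjection_left_eq_right _ v w

theorem normalPart_apply (x : M → V) (p : M) (w : V) :
    normalPart n x p w = w - tangentialPart n x p w := by
  unfold normalPart tangentialPart
  rw [Submodule.starProjection_orthogonal']
  rfl

theorem normalPart_eq (x : M → V) :
    normalPart n x = fun p => ContinuousLinearMap.id ℝ V - tangentialPart n x p := by
  funext p; ext w; exact normalPart_apply x p w

theorem contMDiff_normalPart (hx : IsSmoothImmersion n x) :
    ContMDiff (𝓡 n) 𝓘(ℝ, V →L[ℝ] V) ∞ (normalPart n x) := by
  rw [normalPart_eq]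
  exact contMDiff_const.sub (contMDiff_tangentialPart hx)

theorem mem_orthogonal_iff (x : M → V) (p : M) (w : V) :
    w ∈ (tangentPlane n x p)ᗮ ↔ tangentialPart n x p w = 0 :=
  (Submodule.starProjection_apply_eq_zero_iff _).symm

theorem tangentialPart_normalPart (x : M → V) (p : M) (w : V) :
    tangentialPart n x p (normalPart n x p w) = 0 := by
  rw [normalPart_apply, map_sub, tangentialPart_idem, sub_self]

theorem normalPart_of_tangentialPart_eq_zero {p : M} {w : V} (h : tangentialPart n x p w = 0) :
    normalPart n x p w = w := by
  rw [normalPart_apply, h, sub_zero]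

theorem normalPart_idem (x : M → V) (p : M) (w : V) :
    normalPart n x p (normalPart n x p w) = normalPart n x p w :=
  normalPart_of_tangentialPart_eq_zero (tangentialPart_normalPart x p w)

theorem normalPart_tangentialPart (x : M → V) (p : M) (w : V) :
    normalPart n x p (tangentialPart n x p w) = 0 := by
  rw [normalPart_apply, tangentialPart_idem, sub_self]

theorem normalPart_symm (x : M → V) (p : M) (v w : V) :
    ⟪normalPart n x p v, w⟫_ℝ = ⟪v, normalPart n x p w⟫_ℝ := by
  rw [normalPart_apply, normalPart_apply, inner_sub_left, inner_sub_right, tangentialPart_symm]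

/-- The derivative of `P² = P`. It implies that each `S(v)` exchanges tangent and normal vectors,
which is the content of the next lemmas. -/
theorem derivProj_idem (hx : IsSmoothImmersion n x) (p : M) (v w : V) :
    derivProj n x p v (tangentialPart n x p w) + tangentialPart n x p (derivProj n x p v w) =
      derivProj n x p v w := by
  have hP := contMDiff_tangentialPart hx
  have h := tangentialDeriv_clm_comp hx hP hP p v
  have e : (fun r => (tangentialPart n x r).comp (tangentialPart n x r)) = tangentialPart n x := by
    funext r; ext z; exact tangentialPart_idem x r z
  rw [e] at h
  exact (congrArg (fun A : V →L[ℝ] V => A w) h).symm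

theorem derivProj_symm (hx : IsSmoothImmersion n x) (p : M) (v a b : V) :
    ⟪derivProj n x p v a, b⟫_ℝ = ⟪a, derivProj n x p v b⟫_ℝ := by
  have hP := contMDiff_tangentialPart hx
  have h1 := tangentialDeriv_inner hx (hP.clm_apply (contMDiff_const (c := a)))
    (contMDiff_const (c := b)) p v
  have h2 := tangentialDeriv_inner hx (contMDiff_const (c := a))
    (hP.clm_apply (contMDiff_const (c := b))) p v
  simp only [tangentialPart_symm] at h1
  rw [h1] at h2
  simpa [tangentialDeriv_clm_apply_const hx hP, tangentialDeriv_const] using h2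

theorem derivProj_tangentialPart (x : M → V) (p : M) (v : V) :
    derivProj n x p (tangentialPart n x p v) = derivProj n x p v :=
  tangentialDeriv_tangentialPart x _ p v

theorem tangentialPart_derivProj_tangentialPart (hx : IsSmoothImmersion n x) (p : M) (v w : V) :
    tangentialPart n x p (derivProj n x p v (tangentialPart n x p w)) = 0 := by
  have h := derivProj_idem hx p v (tangentialPart n x p w)
  rw [tangentialPart_idem] at h
  simpa using h

theorem normalPart_derivProj (hx : IsSmoothImmersion n x) (p : M) (v w : V) :
    normalPart n x p (derivProj n x p v w) = derivProj n x p v (tangentialPart n x p w) := by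
  rw [normalPart_apply, ← derivProj_idem hx p v w]
  abel_nf
  rw [map_add, tangentialPart_derivProj_tangentialPart hx, tangentialPart_idem]
  abel

theorem tangentialPart_derivProj (hx : IsSmoothImmersion n x) (p : M) (v w : V) :
    tangentialPart n x p (derivProj n x p v w) = derivProj n x p v (normalPart n x p w) := by
  rw [normalPart_apply, map_sub, eq_sub_iff_add_eq, add_comm]
  exact derivProj_idem hx p v w

/-- The commutator rule applied to `x`, whose tangential derivative is `P`. Its normal component is
the symmetry of the second fundamental form. -/
theorem derivProj_sub_eq (hx : IsSmoothImmersion n x) (p : M) (v w : V) :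
    derivProj n x p v w - derivProj n x p w v =
      tangentialPart n x p (derivProj n x p v w - derivProj n x p w v) := by
  have h := tangentialDeriv_commutator hx hx.1 p v w
  rw [show tangentialDeriv n x x = tangentialPart n x from funext (tangentialDeriv_self hx)] at h
  exact h

theorem secondFundamentalForm_eq (hx : IsSmoothImmersion n x) (p : M) (v w : V) :
    secondFundamentalForm n x p v w = derivProj n x p v (tangentialPart n x p w) := by
  unfold secondFundamentalForm
  rw [dirDeriv_eq_tangentialDeriv hx, tangentialDeriv_clm_apply_const hx
    (contMDiff_tangentialPart hx), normalPart_derivProj hx]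

variable {ι : Type*} [Fintype ι] (b : OrthonormalBasis ι ℝ V)

theorem sum_tangentFrame (x : M → V) (p : M) (B : V →ₗ[ℝ] V →ₗ[ℝ] W) :
    ∑ i, B (tangentFrame n x p i) (tangentFrame n x p i) =
      ∑ a, B (b a) (tangentialPart n x p (b a)) :=
  sum_bilin_subspace (tangentPlane n x p) b (stdOrthonormalBasis ℝ (tangentPlane n x p)) B

theorem sum_bilin_tangentialPart (x : M → V) (p : M) (B : V →ₗ[ℝ] V →ₗ[ℝ] W) :
    ∑ a, B (tangentialPart n x p (b a)) (b a) = ∑ a, B (b a) (tangentialPart n x p (b a)) :=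
  sum_bilin_move b B _ _ (tangentialPart_symm x p)

theorem meanCurvature_eq (hx : IsSmoothImmersion n x) (p : M) :
    meanCurvature n x p = ∑ a, derivProj n x p (b a) (tangentialPart n x p (b a)) := by
  unfold meanCurvature
  simp only [secondFundamentalForm_eq hx]
  have h := sum_tangentFrame (n := n) b x p (LinearMap.mk₂ ℝ
    (fun v w => derivProj n x p v (tangentialPart n x p w)) (by simp) (by simp) (by simp) (by simp))
  simp only [LinearMap.mk₂_apply, tangentialPart_idem] at h
  exact h

/-- `S(v)` sees only `v^⊤`, so the trace runs over tangent directions, where the normal projection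
in the other slot vanishes. -/
theorem sum_derivProj_normalPart (p : M) :
    ∑ a, derivProj n x p (b a) (normalPart n x p (b a)) = 0 := by
  have h := sum_bilin_tangentialPart (n := n) b x p (LinearMap.mk₂ ℝ
    (fun v w => derivProj n x p v (normalPart n x p w)) (by simp) (by simp) (by simp) (by simp))
  simp only [LinearMap.mk₂_apply, normalPart_tangentialPart, derivProj_tangentialPart, map_zero,
    Finset.sum_const_zero] at h
  exact h

/-- The projection in the second slot may be dropped, since the normal directions contribute
nothing. This form of `H` is the one that appears when traces of product rules are taken. -/
theorem meanCurvature_eq_sum (hx : IsSmoothImmersion n x) (p : M) :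
    meanCurvature n x p = ∑ a, derivProj n x p (b a) (b a) := by
  rw [meanCurvature_eq b hx, ← add_zero (∑ a, _), ← sum_derivProj_normalPart (n := n) (x := x) b p,
    ← Finset.sum_add_distrib]
  refine Finset.sum_congr rfl fun a _ => ?_
  rw [normalPart_apply, map_sub]
  abel

theorem tangentialPart_meanCurvature (hx : IsSmoothImmersion n x) (p : M) :
    tangentialPart n x p (meanCurvature n x p) = 0 := by
  rw [meanCurvature_eq (stdOrthonormalBasis ℝ V) hx, map_sum]
  exact Finset.sum_eq_zero fun a _ => tangentialPart_derivProj_tangentialPart hx p _ _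

theorem contMDiff_derivProj (hx : IsSmoothImmersion n x) :
    ContMDiff (𝓡 n) 𝓘(ℝ, V →L[ℝ] V →L[ℝ] V) ∞ (derivProj n x) :=
  contMDiff_tangentialDeriv hx (contMDiff_tangentialPart hx)

theorem contMDiff_meanCurvature (hx : IsSmoothImmersion n x) :
    ContMDiff (𝓡 n) 𝓘(ℝ, V) ∞ (meanCurvature n x) := by
  rw [show meanCurvature n x = fun p => ∑ a, derivProj n x p (stdOrthonormalBasis ℝ V a)
    (stdOrthonormalBasis ℝ V a) from funext (meanCurvature_eq_sum _ hx)]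
  exact contMDiff_finsetSum fun a _ =>
    ((contMDiff_derivProj hx).clm_apply contMDiff_const).clm_apply contMDiff_const

theorem isNormalField_meanCurvature (hx : IsSmoothImmersion n x) :
    IsNormalField n x (meanCurvature n x) :=
  ⟨contMDiff_meanCurvature hx, fun p =>
    (mem_orthogonal_iff x p _).2 (tangentialPart_meanCurvature hx p)⟩

/-- The divergence is the trace of `v ↦ S(v) w`, and the symmetry of each `S(v)` moves it onto the
basis vectors. -/
theorem divTangentialPart_eq (hx : IsSmoothImmersion n x) (w : V) (p : M) :
    divTangentialPart n x w p = ⟪meanCurvature n x p, w⟫_ℝ := by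
  unfold divTangentialPart
  rw [ctrace, LinearMap.trace_eq_sum_inner _ (stdOrthonormalBasis ℝ V),
    meanCurvature_eq_sum (stdOrthonormalBasis ℝ V) hx, sum_inner]
  refine Finset.sum_congr rfl fun a _ => ?_
  rw [derivProj_symm hx, ← tangentialDeriv_clm_apply_const hx (contMDiff_tangentialPart hx)]
  rfl

end Projections

/-! ### The normal connection, its Laplacian and the operator `L`. -/

section NormalBundle

variable {n : ℕ} {M : Type*} [TopologicalSpace M] [ChartedSpace (EuclideanSpace ℝ (Fin n)) M]
  [IsManifold (𝓡 n) ∞ M]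
  {V : Type*} [NormedAddCommGroup V] [InnerProductSpace ℝ V] [FiniteDimensional ℝ V]
  {x : M → V} {ι : Type*} [Fintype ι] (b : OrthonormalBasis ι ℝ V)

/-- The covariant derivative `v ↦ ∇_{v^⊤} X` in the normal bundle. -/
def covDeriv (n : ℕ) {M : Type*} [TopologicalSpace M]
    [ChartedSpace (EuclideanSpace ℝ (Fin n)) M] (x X : M → V) (p : M) : V →L[ℝ] V :=
  (normalPart n x p).comp (tangentialDeriv n x X p)

theorem contMDiff_covDeriv (hx : IsSmoothImmersion n x) {X : M → V}
    (hX : ContMDiff (𝓡 n) 𝓘(ℝ, V) ∞ X) :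
    ContMDiff (𝓡 n) 𝓘(ℝ, V →L[ℝ] V) ∞ (covDeriv n x X) :=
  (contMDiff_normalPart hx).clm_comp (contMDiff_tangentialDeriv hx hX)

theorem normalDeriv_eq (hx : IsSmoothImmersion n x) (X : M → V) (p : M) (v : V) :
    normalDeriv n x X p v = covDeriv n x X p v := by
  unfold normalDeriv
  rw [dirDeriv_eq_tangentialDeriv hx]
  rfl

theorem covDeriv_tangentialPart (x X : M → V) (p : M) (v : V) :
    covDeriv n x X p (tangentialPart n x p v) = covDeriv n x X p v := by
  unfold covDeriv
  rw [ContinuousLinearMap.comp_apply, tangentialDeriv_tangentialPart]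
  rfl

theorem covDeriv_normalPart (x X : M → V) (p : M) (v : V) :
    covDeriv n x X p (normalPart n x p v) = 0 := by
  rw [← covDeriv_tangentialPart, tangentialPart_normalPart, map_zero]

theorem normalPart_covDeriv (x X : M → V) (p : M) (v : V) :
    normalPart n x p (covDeriv n x X p v) = covDeriv n x X p v :=
  normalPart_idem x p _

/-- The full derivative of the covariant derivative. -/
abbrev derivCovDeriv (n : ℕ) {M : Type*} [TopologicalSpace M]
    [ChartedSpace (EuclideanSpace ℝ (Fin n)) M] (x X : M → V) (p : M) : V →L[ℝ] V →L[ℝ] V :=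
  tangentialDeriv n x (covDeriv n x X) p

/-- The derivative of `∇X ∘ P = ∇X`. -/
theorem derivCovDeriv_apply (hx : IsSmoothImmersion n x) {X : M → V}
    (hX : ContMDiff (𝓡 n) 𝓘(ℝ, V) ∞ X) (p : M) (v w : V) :
    derivCovDeriv n x X p v w = derivCovDeriv n x X p v (tangentialPart n x p w) +
      covDeriv n x X p (derivProj n x p v w) := by
  have h := tangentialDeriv_clm_comp hx (contMDiff_covDeriv hx hX) (contMDiff_tangentialPart hx) p v
  have e : (fun r => (covDeriv n x X r).comp (tangentialPart n x r)) = covDeriv n x X := by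
    funext r; ext z; exact covDeriv_tangentialPart x X r z
  rw [e] at h
  exact congrArg (fun A : V →L[ℝ] V => A w) h

/-- The correction term `∇_{∇_v W} X` is exactly the derivative of the projection extending `w`, so
what remains is the derivative of the operator `∇X` on tangent vectors. -/
theorem normalHessian_eq (hx : IsSmoothImmersion n x) {X : M → V}
    (hX : ContMDiff (𝓡 n) 𝓘(ℝ, V) ∞ X) (p : M) (v w : V) :
    normalHessian n x X p v w =
      normalPart n x p (derivCovDeriv n x X p v (tangentialPart n x p w)) := by
  unfold normalHessian
  simp only [normalDeriv_eq hx]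
  rw [dirDeriv_eq_tangentialDeriv hx, tangentialDeriv_clm_apply_const hx
    (contMDiff_tangentialPart hx), covDeriv_tangentialPart]
  change normalPart n x p (tangentialDeriv n x (fun q => covDeriv n x X q w) p v) - _ = _
  rw [tangentialDeriv_clm_apply_const hx (contMDiff_covDeriv hx hX)]
  change normalPart n x p (derivCovDeriv n x X p v w) - _ = _
  rw [derivCovDeriv_apply hx hX, map_add, normalPart_covDeriv]
  abel

theorem normalLaplacian_eq (hx : IsSmoothImmersion n x) {X : M → V}
    (hX : ContMDiff (𝓡 n) 𝓘(ℝ, V) ∞ X) (p : M) :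
    normalLaplacian n x X p =
      ∑ a, normalPart n x p (derivCovDeriv n x X p (b a) (tangentialPart n x p (b a))) := by
  unfold normalLaplacian
  simp only [normalHessian_eq hx hX]
  have h := sum_tangentFrame (n := n) b x p (LinearMap.mk₂ ℝ
    (fun v w => normalPart n x p (derivCovDeriv n x X p v (tangentialPart n x p w)))
    (by simp) (by simp) (by simp) (by simp))
  simp only [LinearMap.mk₂_apply, tangentialPart_idem] at h
  exact h

/-- By symmetry of `S(v)`, the coefficients `⟨z, S(v) e_j⟩` are those of the tangential part of
`S(v) z`; the sum over `j` reassembles that vector. -/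
theorem sum_inner_smul_secondFundamentalForm (hx : IsSmoothImmersion n x) (p : M) (z : V) :
    ∑ i, ∑ j, ⟪z, secondFundamentalForm n x p (tangentFrame n x p i) (tangentFrame n x p j)⟫_ℝ •
          secondFundamentalForm n x p (tangentFrame n x p i) (tangentFrame n x p j) =
      ∑ a, derivProj n x p (b a) (tangentialPart n x p (derivProj n x p (b a) z)) := by
  simp only [secondFundamentalForm_eq hx]
  have inner_sum : ∀ v : V,
      ∑ j, ⟪z, derivProj n x p v (tangentialPart n x p (tangentFrame n x p j))⟫_ℝ •
        derivProj n x p v (tangentialPart n x p (tangentFrame n x p j)) =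
      derivProj n x p v (tangentialPart n x p (derivProj n x p v z)) := fun v => by
    have h := sum_tangentFrame (n := n) b x p (LinearMap.mk₂ ℝ
      (fun e f => ⟪z, derivProj n x p v (tangentialPart n x p e)⟫_ℝ •
        derivProj n x p v (tangentialPart n x p f))
      (by intros; simp [inner_add_right, add_smul]) (by intros; simp [inner_smul_right, mul_smul])
      (by intros; simp) (by intros; simp [smul_smul, mul_comm]))
    simp only [LinearMap.mk₂_apply, tangentialPart_idem] at h
    rw [h]
    conv_rhs => rw [← b.sum_repr' (derivProj n x p v z)]
    simp only [map_sum, map_smul]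
    have h2 := sum_bilin_tangentialPart (n := n) b x p (LinearMap.mk₂ ℝ
      (fun e f => ⟪z, derivProj n x p v e⟫_ℝ • derivProj n x p v (tangentialPart n x p f))
      (by intros; simp [inner_add_right, add_smul]) (by intros; simp [inner_smul_right, mul_smul])
      (by intros; simp) (by intros; simp [smul_smul, mul_comm]))
    simp only [LinearMap.mk₂_apply, tangentialPart_idem] at h2
    rw [h2]
    refine Finset.sum_congr rfl fun a _ => ?_
    rw [← derivProj_symm hx, real_inner_comm]
  simp only [inner_sum]
  have h := sum_tangentFrame (n := n) b x p (LinearMap.mk₂ ℝ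
    (fun v w => derivProj n x p w (tangentialPart n x p (derivProj n x p v z)))
    (by simp) (by simp) (by simp) (by simp))
  simp only [LinearMap.mk₂_apply, derivProj_tangentialPart] at h
  exact h

theorem sum_inner_smul_normalDeriv (hx : IsSmoothImmersion n x) (X : M → V) (p : M) (z : V) :
    ∑ i, ⟪z, tangentFrame n x p i⟫_ℝ • normalDeriv n x X p (tangentFrame n x p i) =
      covDeriv n x X p z := by
  simp only [normalDeriv_eq hx]
  have h := sum_tangentFrame (n := n) (stdOrthonormalBasis ℝ V) x p (LinearMap.mk₂ ℝ
    (fun v w => ⟪z, v⟫_ℝ • covDeriv n x X p w)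
    (by intros; simp [inner_add_right, add_smul]) (by intros; simp [inner_smul_right, mul_smul])
    (by intros; simp) (by intros; simp [smul_smul, mul_comm]))
  simp only [LinearMap.mk₂_apply, covDeriv_tangentialPart] at h
  rw [h]
  conv_rhs => rw [← (stdOrthonormalBasis ℝ V).sum_repr' z]
  simp only [map_sum, map_smul, real_inner_comm]

/-- The Jacobi operator in terms of a fixed orthonormal basis of the ambient space. -/
theorem jacobiOperator_eq (hx : IsSmoothImmersion n x) {X : M → V}
    (hX : ContMDiff (𝓡 n) 𝓘(ℝ, V) ∞ X) (x₀ : V) (t₀ : ℝ) (p : M) :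
    jacobiOperator n x x₀ t₀ X p =
      ∑ a, normalPart n x p (derivCovDeriv n x X p (b a) (tangentialPart n x p (b a))) +
      ∑ a, derivProj n x p (b a) (tangentialPart n x p (derivProj n x p (b a) (X p))) -
      (1 / (2 * t₀)) • covDeriv n x X p (x p - x₀) + (1 / (2 * t₀)) • X p := by
  unfold jacobiOperator
  rw [normalLaplacian_eq b hx hX, sum_inner_smul_secondFundamentalForm b hx,
    sum_inner_smul_normalDeriv hx, map_smul]

theorem covDeriv_add_smul {X Y : M → V}
    (hX : ContMDiff (𝓡 n) 𝓘(ℝ, V) ∞ X) (hY : ContMDiff (𝓡 n) 𝓘(ℝ, V) ∞ Y) (c : ℝ) (p : M) :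
    covDeriv n x (fun r => X r + c • Y r) p = covDeriv n x X p + c • covDeriv n x Y p := by
  unfold covDeriv
  have hcY : ContMDiff (𝓡 n) 𝓘(ℝ, V) ∞ (fun r => c • Y r) := hY.const_smul_space c
  rw [tangentialDeriv_add hX hcY, tangentialDeriv_const_smul c hY]
  ext v; simp

theorem jacobiOperator_add_smul (hx : IsSmoothImmersion n x) {X Y : M → V}
    (hX : ContMDiff (𝓡 n) 𝓘(ℝ, V) ∞ X) (hY : ContMDiff (𝓡 n) 𝓘(ℝ, V) ∞ Y) (c : ℝ)
    (x₀ : V) (t₀ : ℝ) (p : M) :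
    jacobiOperator n x x₀ t₀ (fun r => X r + c • Y r) p =
      jacobiOperator n x x₀ t₀ X p + c • jacobiOperator n x x₀ t₀ Y p := by
  have hcY : ContMDiff (𝓡 n) 𝓘(ℝ, V) ∞ (fun r => c • Y r) := hY.const_smul_space c
  have hcB : ContMDiff (𝓡 n) 𝓘(ℝ, V →L[ℝ] V) ∞ (fun r => c • covDeriv n x Y r) :=
    (contMDiff_covDeriv hx hY).const_smul_space c
  have hB : covDeriv n x (fun r => X r + c • Y r) =
      fun r => covDeriv n x X r + c • covDeriv n x Y r :=
    funext (covDeriv_add_smul hX hY c)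
  set b := stdOrthonormalBasis ℝ V
  rw [jacobiOperator_eq b hx (X := fun r => X r + c • Y r) (hX.add hcY), jacobiOperator_eq b hx hX, jacobiOperator_eq b hx hY]
  unfold derivCovDeriv
  rw [hB, tangentialDeriv_add (contMDiff_covDeriv hx hX) hcB,
    tangentialDeriv_const_smul c (contMDiff_covDeriv hx hY)]
  simp only [add_apply, smul_apply, map_add, map_smul, Finset.sum_add_distrib, ← Finset.smul_sum]
  module

theorem contMDiff_jacobiOperator (hx : IsSmoothImmersion n x) {X : M → V}
    (hX : ContMDiff (𝓡 n) 𝓘(ℝ, V) ∞ X) (x₀ : V) (t₀ : ℝ) :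
    ContMDiff (𝓡 n) 𝓘(ℝ, V) ∞ (jacobiOperator n x x₀ t₀ X) := by
  set b := stdOrthonormalBasis ℝ V
  rw [show jacobiOperator n x x₀ t₀ X = _ from funext (jacobiOperator_eq b hx hX x₀ t₀)]
  have hP := contMDiff_tangentialPart hx
  have hN := contMDiff_normalPart hx
  have hS := contMDiff_derivProj hx
  have hB := contMDiff_covDeriv hx hX
  have hD := contMDiff_tangentialDeriv hx hB
  have hb : ∀ a, ContMDiff (𝓡 n) 𝓘(ℝ, V) ∞ (fun _ : M => b a) := fun a => contMDiff_const
  refine ((ContMDiff.add (contMDiff_finsetSum fun a _ => ?_)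
    (contMDiff_finsetSum fun a _ => ?_)).sub ?_).add ?_
  · exact hN.clm_apply ((hD.clm_apply (hb a)).clm_apply (hP.clm_apply (hb a)))
  · exact (hS.clm_apply (hb a)).clm_apply
      (hP.clm_apply ((hS.clm_apply (hb a)).clm_apply hX))
  · exact (hB.clm_apply (hx.1.sub contMDiff_const)).const_smul_space _
  · exact hX.const_smul_space _

end NormalBundle

/-! ### The Codazzi equation, and `H` as an eigenfield of `L`. -/

section MeanCurvatureEigenfield

variable {n : ℕ} {M : Type*} [TopologicalSpace M] [ChartedSpace (EuclideanSpace ℝ (Fin n)) M]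
  [IsManifold (𝓡 n) ∞ M]
  {V : Type*} [NormedAddCommGroup V] [InnerProductSpace ℝ V] [FiniteDimensional ℝ V]
  {x : M → V} {ι : Type*} [Fintype ι] (b : OrthonormalBasis ι ℝ V)

/-- The full derivative of the derivative of the tangential projection. -/
abbrev secondDerivProj (n : ℕ) {M : Type*} [TopologicalSpace M]
    [ChartedSpace (EuclideanSpace ℝ (Fin n)) M] (x : M → V) (p : M) :
    V →L[ℝ] V →L[ℝ] V →L[ℝ] V :=
  tangentialDeriv n x (derivProj n x) p

/-- The normal part of the derivative of `derivProj_sub_eq`. The term in which `P` is differentiated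
drops out, because `S(v^⊤) w^⊤` and `S(w^⊤) v^⊤` are normal. -/
theorem normalPart_secondDerivProj_comm (hx : IsSmoothImmersion n x) (p : M) (a v w : V) :
    normalPart n x p (secondDerivProj n x p a (tangentialPart n x p v) (tangentialPart n x p w)) =
      normalPart n x p
        (secondDerivProj n x p a (tangentialPart n x p w) (tangentialPart n x p v)) := by
  have hP := contMDiff_tangentialPart hx
  have hS := contMDiff_derivProj hx
  -- From here these are constant ambient vectors, tangent only at `p`; `derivProj_sub_eq` holds at
  -- every point for arbitrary vectors, so it can still be differentiated.
  set v' := tangentialPart n x p v with hv'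
  set w' := tangentialPart n x p w with hw'
  have h1 : ContMDiff (𝓡 n) 𝓘(ℝ, V) ∞ (fun r => derivProj n x r v' w') :=
    (hS.clm_apply contMDiff_const).clm_apply contMDiff_const
  have h2 : ContMDiff (𝓡 n) 𝓘(ℝ, V) ∞ (fun r => derivProj n x r w' v') :=
    (hS.clm_apply contMDiff_const).clm_apply contMDiff_const
  have e1 : tangentialDeriv n x (fun r => derivProj n x r v' w') p a =
      secondDerivProj n x p a v' w' := by
    rw [tangentialDeriv_clm_apply_const hx (hS.clm_apply contMDiff_const),
      tangentialDeriv_clm_apply_const hx hS]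
  have e2 : tangentialDeriv n x (fun r => derivProj n x r w' v') p a =
      secondDerivProj n x p a w' v' := by
    rw [tangentialDeriv_clm_apply_const hx (hS.clm_apply contMDiff_const),
      tangentialDeriv_clm_apply_const hx hS]
  have h3 := tangentialDeriv_clm_apply hx hP (h1.sub h2) p a
  have e3 : (fun r => tangentialPart n x r
      (derivProj n x r v' w' - derivProj n x r w' v')) =
      fun r => derivProj n x r v' w' - derivProj n x r w' v' := by
    funext r; exact (derivProj_sub_eq hx r v' w').symm
  rw [e3, tangentialDeriv_sub h1 h2, sub_apply, e1, e2] at h3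
  have h4 := congrArg (normalPart n x p) h3
  rw [map_sub, map_add, normalPart_tangentialPart, add_zero, normalPart_derivProj hx] at h4
  have h5 : tangentialPart n x p
      (derivProj n x p v' w' - derivProj n x p w' v') = 0 := by
    rw [map_sub, hv', hw', tangentialPart_derivProj_tangentialPart hx,
      tangentialPart_derivProj_tangentialPart hx, sub_zero]
  rw [h5, map_zero, sub_eq_zero] at h4
  exact h4

/-- Moving `P ∘ S(z)` to the other slot as its adjoint `S(z) ∘ P` produces `P S(z) P = 0`. -/
theorem sum_derivProj_derivProj (hx : IsSmoothImmersion n x) (p : M) (z : V) :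
    ∑ a, derivProj n x p (derivProj n x p z (b a)) (tangentialPart n x p (b a)) = 0 := by
  have h := sum_bilin_move b (LinearMap.mk₂ ℝ
    (fun v w => derivProj n x p v (tangentialPart n x p w)) (by simp) (by simp) (by simp) (by simp))
    ((tangentialPart n x p).comp (derivProj n x p z))
    ((derivProj n x p z).comp (tangentialPart n x p)) (fun v w => by
      rw [ContinuousLinearMap.comp_apply, ContinuousLinearMap.comp_apply, tangentialPart_symm,
        derivProj_symm hx])
  simp only [LinearMap.mk₂_apply, ContinuousLinearMap.comp_apply, derivProj_tangentialPart,
    tangentialPart_derivProj_tangentialPart hx, map_zero, Finset.sum_const_zero] at h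
  exact h

theorem sum_derivProj_tangentialPart_derivProj (hx : IsSmoothImmersion n x) (p : M) (z : V) :
    ∑ a, derivProj n x p (b a) (tangentialPart n x p (derivProj n x p z (b a))) = 0 := by
  have h := sum_bilin_tangentialPart (n := n) b x p (LinearMap.mk₂ ℝ
    (fun v w => derivProj n x p v (tangentialPart n x p (derivProj n x p z w)))
    (by simp) (by simp) (by simp) (by simp))
  simp only [LinearMap.mk₂_apply, derivProj_tangentialPart,
    tangentialPart_derivProj_tangentialPart hx, map_zero, Finset.sum_const_zero] at h
  exact h

/-- The traced Codazzi equation: the divergence of the second fundamental form is the normal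
derivative of the mean curvature. -/
theorem sum_normalPart_secondDerivProj (hx : IsSmoothImmersion n x) (p : M) (z : V) :
    ∑ a, normalPart n x p (secondDerivProj n x p (b a) (tangentialPart n x p (b a))
        (tangentialPart n x p z)) =
      covDeriv n x (meanCurvature n x) p z := by
  have hP := contMDiff_tangentialPart hx
  have hS := contMDiff_derivProj hx
  have hc : ∀ v : V, ContMDiff (𝓡 n) 𝓘(ℝ, V) ∞ (fun _ : M => v) := fun v => contMDiff_const
  rw [← covDeriv_tangentialPart]
  set z' := tangentialPart n x p z with hz'
  have hz : tangentialPart n x p z' = z' := tangentialPart_idem x p z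
  have h1 : ∀ a, normalPart n x p (secondDerivProj n x p (b a) (tangentialPart n x p (b a)) z') =
      normalPart n x p (secondDerivProj n x p z' (b a) (tangentialPart n x p (b a))) -
      normalPart n x p (derivProj n x p (derivProj n x p z' (b a))
        (tangentialPart n x p (b a))) := fun a => by
    rw [hz', normalPart_secondDerivProj_comm hx, ← hz']
    -- After the swap of the last two slots, the commutator rule for `P` swaps the first two. Of its
    -- two correction terms, `S(S(b a) z')` vanishes since `S(b a) z'` is normal, and the other has
    -- zero trace.
    have h2 := tangentialDeriv_commutator hx hP p (b a) z'
    have h3 : tangentialDeriv n x (tangentialPart n x) p (tangentialDeriv n x (tangentialPart n x) p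
        (b a) z') = 0 := by
      rw [← tangentialDeriv_tangentialPart x]
      have : tangentialPart n x p (derivProj n x p (b a) z') = 0 := by
        rw [← hz]; exact tangentialPart_derivProj_tangentialPart hx p _ _
      rw [this, map_zero]
    rw [map_sub, h3, zero_sub, sub_eq_iff_eq_add, neg_add_eq_sub] at h2
    have h4 := congrArg (fun A : V →L[ℝ] V =>
      normalPart n x p (A (tangentialPart n x p (b a)))) h2
    simpa only [sub_apply, map_sub] using h4
  simp only [h1]
  rw [Finset.sum_sub_distrib, ← map_sum (normalPart n x p), ← map_sum (normalPart n x p),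
    sum_derivProj_derivProj b hx, map_zero, sub_zero]
  have hH : meanCurvature n x = fun r => ∑ a, derivProj n x r (b a) (tangentialPart n x r (b a)) :=
    funext (meanCurvature_eq b hx)
  unfold covDeriv
  rw [ContinuousLinearMap.comp_apply, hH, tangentialDeriv_sum _ fun a =>
    (hS.clm_apply (hc (b a))).clm_apply (hP.clm_apply (hc (b a))), FunLike.coe_sum,
    Finset.sum_apply]
  have h5 : ∀ a, tangentialDeriv n x
      (fun r => derivProj n x r (b a) (tangentialPart n x r (b a))) p z' =
      secondDerivProj n x p z' (b a) (tangentialPart n x p (b a)) +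
        derivProj n x p (b a) (derivProj n x p z' (b a)) := fun a => by
    rw [tangentialDeriv_clm_apply hx (hS.clm_apply (hc (b a))) (hP.clm_apply (hc (b a))),
      tangentialDeriv_clm_apply_const hx hS, tangentialDeriv_clm_apply_const hx hP]
  simp only [h5]
  rw [Finset.sum_add_distrib, map_add, map_sum _ (fun a => derivProj n x p (b a) _)]
  simp only [normalPart_derivProj hx]
  rw [sum_derivProj_tangentialPart_derivProj b hx, add_zero]

/-- On a self-shrinker `L H = H / t₀`. -/
theorem jacobiOperator_meanCurvature (hx : IsSmoothImmersion n x) {x₀ : V} {t₀ : ℝ} (ht₀ : t₀ ≠ 0)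
    (hs : IsSelfShrinker n x x₀ t₀) (p : M) :
    jacobiOperator n x x₀ t₀ (meanCurvature n x) p = (1 / t₀) • meanCurvature n x p := by
  set b := stdOrthonormalBasis ℝ V
  set c : ℝ := 1 / (2 * t₀) with hc
  have hP := contMDiff_tangentialPart hx
  have hN := contMDiff_normalPart hx
  have hS := contMDiff_derivProj hx
  have hHs := contMDiff_meanCurvature hx
  have hconst : ∀ v : V, ContMDiff (𝓡 n) 𝓘(ℝ, V) ∞ (fun _ : M => v) := fun v => contMDiff_const
  have hy : ContMDiff (𝓡 n) 𝓘(ℝ, V) ∞ (fun r => x r - x₀) := hx.1.sub contMDiff_const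
  have hPy := hP.clm_apply hy
  have hdy : ∀ r v, tangentialDeriv n x (fun r => x r - x₀) r v = tangentialPart n x r v :=
    fun r v => by
      rw [tangentialDeriv_sub hx.1 (hconst x₀), tangentialDeriv_self hx, tangentialDeriv_const,
        sub_zero]
  have hdPy : ∀ r v, tangentialDeriv n x (fun r => tangentialPart n x r (x r - x₀)) r v =
      derivProj n x r v (x r - x₀) + tangentialPart n x r v := fun r v => by
    rw [tangentialDeriv_clm_apply hx hP hy, hdy, tangentialPart_idem]
  have hH : ∀ r, meanCurvature n x r = -(c • normalPart n x r (x r - x₀)) := fun r =>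
    eq_neg_of_add_eq_zero_left (hs r)
  -- The shrinker equation gives `∇_v H = c h(v, y^⊤)` with `y = x - x₀`.
  have hB : ∀ r v, covDeriv n x (meanCurvature n x) r v =
      c • derivProj n x r v (tangentialPart n x r (x r - x₀)) := fun r v => by
    have h1 : meanCurvature n x = fun r => (-c) • ((x r - x₀) - tangentialPart n x r (x r - x₀)) := by
      funext r
      rw [hH, normalPart_apply, neg_smul]
    unfold covDeriv
    rw [ContinuousLinearMap.comp_apply, h1, tangentialDeriv_const_smul _ (hy.sub hPy),
      tangentialDeriv_sub hy hPy, smul_apply, sub_apply, hdy, hdPy, map_smul, map_sub, map_add,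
      normalPart_tangentialPart, normalPart_derivProj hx]
    module
  have hD : ∀ v w, derivCovDeriv n x (meanCurvature n x) p v w =
      c • (secondDerivProj n x p v w (tangentialPart n x p (x p - x₀)) +
        derivProj n x p w (derivProj n x p v (x p - x₀) + tangentialPart n x p v)) := fun v w => by
    have h1 : (fun r => covDeriv n x (meanCurvature n x) r w) =
        fun r => c • derivProj n x r w (tangentialPart n x r (x r - x₀)) := funext fun r => hB r w
    have h2 := tangentialDeriv_clm_apply_const hx (contMDiff_covDeriv hx hHs) w p v
    rw [h1, tangentialDeriv_const_smul c ((hS.clm_apply (hconst w)).clm_apply hPy), smul_apply,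
      tangentialDeriv_clm_apply hx (hS.clm_apply (hconst w)) hPy,
      tangentialDeriv_clm_apply_const hx hS, hdPy] at h2
    exact h2.symm
  -- Differentiating `S` gives `c ∇_y H` by Codazzi, cancelling the drift of `L`. Differentiating
  -- `P` inside `y^⊤` gives `-⟨H, h_ij⟩ h_ij` since `H = -c y^⊥`, and differentiating `y` gives `c
  -- H`. With the zeroth order term, `L H = 2 c H`.
  have hlap : ∑ a, normalPart n x p (derivCovDeriv n x (meanCurvature n x) p (b a)
      (tangentialPart n x p (b a))) =
      c • covDeriv n x (meanCurvature n x) p (x p - x₀) -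
        ∑ a, derivProj n x p (b a) (tangentialPart n x p
          (derivProj n x p (b a) (meanCurvature n x p))) + c • meanCurvature n x p := by
    have h1 : ∀ a, normalPart n x p (derivCovDeriv n x (meanCurvature n x) p (b a)
        (tangentialPart n x p (b a))) =
        c • normalPart n x p (secondDerivProj n x p (b a) (tangentialPart n x p (b a))
          (tangentialPart n x p (x p - x₀))) -
        derivProj n x p (b a) (tangentialPart n x p
          (derivProj n x p (b a) (meanCurvature n x p))) +
        c • derivProj n x p (b a) (tangentialPart n x p (b a)) := fun a => by
      rw [hD, map_smul, map_add, derivProj_tangentialPart, normalPart_derivProj hx, map_add,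
        map_add, tangentialPart_idem, tangentialPart_derivProj hx, hH, map_neg, map_neg, map_neg,
        map_smul, map_smul, map_smul, tangentialPart_derivProj hx, normalPart_idem]
      module
    simp only [h1]
    rw [Finset.sum_add_distrib, Finset.sum_sub_distrib, ← Finset.smul_sum, ← Finset.smul_sum,
      sum_normalPart_secondDerivProj b hx, ← meanCurvature_eq b hx]
  rw [jacobiOperator_eq b hx hHs, hlap, ← hc]
  have h2 : 1 / t₀ = c + c := by rw [hc]; field_simp; norm_num
  rw [h2]
  module

end MeanCurvatureEigenfield

/-! ### Integration by parts with the Gaussian weight. -/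

section WeightedDivergence

variable {n : ℕ} {M : Type*} [TopologicalSpace M] [ChartedSpace (EuclideanSpace ℝ (Fin n)) M]
  [IsManifold (𝓡 n) ∞ M]
  {V : Type*} [NormedAddCommGroup V] [InnerProductSpace ℝ V] [FiniteDimensional ℝ V]
  {x : M → V} {x₀ : V} {t₀ : ℝ} {ι : Type*} [Fintype ι] (b : OrthonormalBasis ι ℝ V)

theorem gaussianWeight_pos (x : M → V) (x₀ : V) (ht₀ : 0 < t₀) (p : M) :
    0 < gaussianWeight n x x₀ t₀ p := by
  unfold gaussianWeight
  positivity

theorem contDiff_gaussian (k t₀ : ℝ) :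
    ContDiff ℝ ∞ (fun v : V => k * Real.exp (-‖v‖ ^ 2 / (4 * t₀))) :=
  contDiff_const.mul (((contDiff_norm_sq ℝ).neg.div_const _).exp)

theorem contMDiff_gaussianWeight (hx : IsSmoothImmersion n x) (x₀ : V) (t₀ : ℝ) :
    ContMDiff (𝓡 n) 𝓘(ℝ, ℝ) ∞ (gaussianWeight n x x₀ t₀) :=
  (contDiff_gaussian ((4 * Real.pi * t₀) ^ (-(n : ℝ) / 2)) t₀).comp_contMDiff
    (hx.1.sub contMDiff_const)

theorem tangentialDeriv_position (hx : IsSmoothImmersion n x) (x₀ : V) (p : M) :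
    tangentialDeriv n x (fun r => x r - x₀) p = tangentialPart n x p := by
  rw [tangentialDeriv_sub hx.1 contMDiff_const, tangentialDeriv_self hx, tangentialDeriv_const,
    sub_zero]

theorem tangentialDeriv_gaussianWeight (hx : IsSmoothImmersion n x) (x₀ : V) (t₀ : ℝ) (p : M)
    (w : V) :
    tangentialDeriv n x (gaussianWeight n x x₀ t₀) p w =
      -(1 / (2 * t₀) * ⟪x p - x₀, tangentialPart n x p w⟫_ℝ * gaussianWeight n x x₀ t₀ p) := by
  set k := (4 * Real.pi * t₀) ^ (-(n : ℝ) / 2) with hk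
  have hy : ContMDiff (𝓡 n) 𝓘(ℝ, V) ∞ (fun r => x r - x₀) := hx.1.sub contMDiff_const
  have h1 := tangentialDeriv_comp hx (contDiff_gaussian k t₀) hy p w
  have h2 : HasFDerivAt (fun v : V => k * Real.exp (-‖v‖ ^ 2 / (4 * t₀))) _ (x p - x₀) :=
    ((((hasStrictFDerivAt_norm_sq (x p - x₀)).hasFDerivAt.neg.mul_const
      ((4 * t₀)⁻¹)).exp).const_mul k)
  rw [h2.fderiv, tangentialDeriv_position hx] at h1
  change tangentialDeriv n x (fun r => k * Real.exp (-‖x r - x₀‖ ^ 2 / (4 * t₀))) p w = _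
  rw [h1]
  unfold gaussianWeight
  rw [← hk]
  simp only [smul_apply, neg_apply, innerSL_apply_apply, smul_eq_mul, nsmul_eq_mul,
    Nat.cast_ofNat, div_eq_mul_inv, Pi.neg_apply]
  by_cases ht : t₀ = 0
  · simp [ht]
  · field_simp
    ring

variable [MeasurableSpace M] [BorelSpace M] [T2Space M] [CompactSpace M]

/-- The weighted divergence theorem on a self-shrinker. -/
theorem integral_weighted_divergence (hx : IsSmoothImmersion n x)
    (hs : IsSelfShrinker n x x₀ t₀) {f : M → ℝ} (hf : ContMDiff (𝓡 n) 𝓘(ℝ, ℝ) ∞ f) (w : V) :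
    ∫ p, (tangentialDeriv n x f p w - 1 / (2 * t₀) * ⟪x p - x₀, w⟫_ℝ * f p) *
      gaussianWeight n x x₀ t₀ p ∂(inducedVolume n x) = 0 := by
  have hG := contMDiff_gaussianWeight hx x₀ t₀
  rw [← integral_divergence hx (hf.mul hG) w]
  congr 1
  funext p
  have h1 := tangentialDeriv_mul hx hf hG p w
  have hH : meanCurvature n x p = -((1 / (2 * t₀)) • normalPart n x p (x p - x₀)) :=
    eq_neg_of_add_eq_zero_left (hs p)
  change _ = tangentialDeriv n x (fun r => f r * gaussianWeight n x x₀ t₀ r) p w +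
    (f p * gaussianWeight n x x₀ t₀ p) * _
  -- The weight contributes the tangential part of `x - x₀` and the mean curvature its normal part,
  -- with the same factor.
  rw [h1, tangentialDeriv_gaussianWeight hx, divTangentialPart_eq hx, hH, inner_neg_left,
    real_inner_smul_left, normalPart_apply,
    inner_sub_left (x p - x₀) (tangentialPart n x p (x p - x₀)), tangentialPart_symm]
  ring

theorem integral_sum_weighted_divergence (hx : IsSmoothImmersion n x)
    (hs : IsSelfShrinker n x x₀ t₀) {f : ι → M → ℝ}
    (hf : ∀ a, ContMDiff (𝓡 n) 𝓘(ℝ, ℝ) ∞ (f a)) :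
    ∫ p, (∑ a, (tangentialDeriv n x (f a) p (b a) - 1 / (2 * t₀) * ⟪x p - x₀, b a⟫_ℝ * f a p)) *
      gaussianWeight n x x₀ t₀ p ∂(inducedVolume n x) = 0 := by
  simp only [Finset.sum_mul]
  rw [integral_finsetSum]
  · exact Finset.sum_eq_zero fun a _ => integral_weighted_divergence hx hs (hf a) (b a)
  · intro a _
    refine integrable_inducedVolume hx (Continuous.mul (Continuous.sub ?_ ?_)
      (contMDiff_gaussianWeight hx x₀ t₀).continuous)
    · exact (contMDiff_tangentialDeriv hx (hf a)).continuous.clm_apply continuous_const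
    · exact (continuous_const.mul ((hx.1.continuous.sub continuous_const).inner
        continuous_const)).mul (hf a).continuous

end WeightedDivergence

/-! ### Symmetry of `L`, the weighted mean of `H` and the Liouville argument. -/

section SelfAdjointness

variable {n : ℕ} {M : Type*} [TopologicalSpace M] [ChartedSpace (EuclideanSpace ℝ (Fin n)) M]
  [IsManifold (𝓡 n) ∞ M]
  {V : Type*} [NormedAddCommGroup V] [InnerProductSpace ℝ V] [FiniteDimensional ℝ V]
  {x : M → V} {x₀ : V} {t₀ : ℝ} {ι : Type*} [Fintype ι] (b : OrthonormalBasis ι ℝ V)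

/-- A pointwise Green identity: a weighted divergence plus terms symmetric in `X` and `Y`. Symmetry
of `L` follows by integrating the antisymmetrized identity. -/
theorem inner_jacobiOperator (hx : IsSmoothImmersion n x) {X Y : M → V}
    (hX : IsNormalField n x X) (hY : ContMDiff (𝓡 n) 𝓘(ℝ, V) ∞ Y) (x₀ : V) (t₀ : ℝ) (p : M) :
    ⟪X p, jacobiOperator n x x₀ t₀ Y p⟫_ℝ =
      ∑ a, (tangentialDeriv n x (fun r => ⟪X r, covDeriv n x Y r (b a)⟫_ℝ) p (b a) -
        1 / (2 * t₀) * ⟪x p - x₀, b a⟫_ℝ * ⟪X p, covDeriv n x Y p (b a)⟫_ℝ) -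
      ∑ a, ⟪covDeriv n x X p (b a), covDeriv n x Y p (b a)⟫_ℝ +
      ∑ a, ⟪tangentialPart n x p (derivProj n x p (b a) (X p)),
        tangentialPart n x p (derivProj n x p (b a) (Y p))⟫_ℝ + 1 / (2 * t₀) * ⟪X p, Y p⟫_ℝ := by
  have hB := contMDiff_covDeriv hx hY
  have hXn : normalPart n x p (X p) = X p :=
    normalPart_of_tangentialPart_eq_zero ((mem_orthogonal_iff x p _).1 (hX.2 p))
  have h1 : ∀ a, tangentialDeriv n x (fun r => ⟪X r, covDeriv n x Y r (b a)⟫_ℝ) p (b a) =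
      ⟪covDeriv n x X p (b a), covDeriv n x Y p (b a)⟫_ℝ +
      ⟪X p, normalPart n x p (derivCovDeriv n x Y p (b a) (tangentialPart n x p (b a)))⟫_ℝ +
      ⟪X p, covDeriv n x Y p (derivProj n x p (b a) (b a))⟫_ℝ := fun a => by
    rw [tangentialDeriv_inner hx hX.1 (hB.clm_apply contMDiff_const),
      tangentialDeriv_clm_apply_const hx hB]
    change _ + ⟪X p, derivCovDeriv n x Y p (b a) (b a)⟫_ℝ = _
    rw [derivCovDeriv_apply hx hY, inner_add_right, ← normalPart_symm, hXn,
      ← normalPart_covDeriv x Y p (b a), ← normalPart_symm, normalPart_covDeriv]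
    change ⟪covDeriv n x X p (b a), _⟫_ℝ + _ = _
    ring
  -- The correction terms add up to the derivative of `Y` along `H^⊤ = 0`.
  have h2 : ∑ a, covDeriv n x Y p (derivProj n x p (b a) (b a)) = 0 := by
    rw [← map_sum, ← meanCurvature_eq_sum b hx,
      ← normalPart_of_tangentialPart_eq_zero (tangentialPart_meanCurvature hx p),
      covDeriv_normalPart]
  have h3 : ∑ a, ⟪x p - x₀, b a⟫_ℝ * ⟪X p, covDeriv n x Y p (b a)⟫_ℝ =
      ⟪X p, covDeriv n x Y p (x p - x₀)⟫_ℝ := by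
    conv_rhs => rw [← b.sum_repr' (x p - x₀)]
    rw [map_sum, inner_sum]
    refine Finset.sum_congr rfl fun a _ => ?_
    rw [map_smul, real_inner_smul_right, real_inner_comm]
  rw [jacobiOperator_eq b hx hY, inner_add_right, inner_sub_right, inner_add_right, inner_sum,
    inner_sum, real_inner_smul_right, real_inner_smul_right, ← h3]
  simp only [h1, Finset.sum_sub_distrib, Finset.sum_add_distrib, ← inner_sum, h2, inner_zero_right,
    mul_assoc, ← Finset.mul_sum]
  have h4 : ∀ a, ⟪X p, derivProj n x p (b a) (tangentialPart n x p
      (derivProj n x p (b a) (Y p)))⟫_ℝ =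
      ⟪tangentialPart n x p (derivProj n x p (b a) (X p)),
        tangentialPart n x p (derivProj n x p (b a) (Y p))⟫_ℝ := fun a => by
    rw [← derivProj_symm hx, tangentialPart_symm, tangentialPart_idem]
  have h5 : ⟪X p, ∑ a, derivProj n x p (b a) (tangentialPart n x p
      (derivProj n x p (b a) (Y p)))⟫_ℝ = ∑ a,
      ⟪tangentialPart n x p (derivProj n x p (b a) (X p)),
        tangentialPart n x p (derivProj n x p (b a) (Y p))⟫_ℝ := by
    rw [inner_sum]
    exact Finset.sum_congr rfl fun a _ => h4 a
  rw [h5]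
  ring

variable [MeasurableSpace M] [BorelSpace M] [T2Space M] [CompactSpace M]

/-- The Jacobi operator of a self-shrinker is symmetric for the Gaussian weight. -/
theorem integral_inner_jacobiOperator_symm (hx : IsSmoothImmersion n x)
    (hs : IsSelfShrinker n x x₀ t₀) {X Y : M → V}
    (hX : IsNormalField n x X) (hY : IsNormalField n x Y) :
    ∫ p, (⟪X p, jacobiOperator n x x₀ t₀ Y p⟫_ℝ - ⟪Y p, jacobiOperator n x x₀ t₀ X p⟫_ℝ) *
      gaussianWeight n x x₀ t₀ p ∂(inducedVolume n x) = 0 := by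
  set b := stdOrthonormalBasis ℝ V
  have hc : ∀ v : V, ContMDiff (𝓡 n) 𝓘(ℝ, V) ∞ (fun _ : M => v) := fun v => contMDiff_const
  have h1 : ∀ a, ContMDiff (𝓡 n) 𝓘(ℝ, ℝ) ∞ (fun r => ⟪X r, covDeriv n x Y r (b a)⟫_ℝ) := fun a =>
    hX.1.inner_space ((contMDiff_covDeriv hx hY.1).clm_apply (hc _))
  have h2 : ∀ a, ContMDiff (𝓡 n) 𝓘(ℝ, ℝ) ∞ (fun r => ⟪Y r, covDeriv n x X r (b a)⟫_ℝ) := fun a =>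
    hY.1.inner_space ((contMDiff_covDeriv hx hX.1).clm_apply (hc _))
  have h3 := integral_sum_weighted_divergence b hx hs (f := fun a r =>
    ⟪X r, covDeriv n x Y r (b a)⟫_ℝ - ⟪Y r, covDeriv n x X r (b a)⟫_ℝ)
    (fun a => (h1 a).sub (h2 a))
  rw [← h3]
  congr 1
  funext p
  congr 1
  rw [inner_jacobiOperator b hx hX hY.1, inner_jacobiOperator b hx hY hX.1]
  have h4 : ∀ a, tangentialDeriv n x (fun r =>
      ⟪X r, covDeriv n x Y r (b a)⟫_ℝ - ⟪Y r, covDeriv n x X r (b a)⟫_ℝ) p (b a) =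
      tangentialDeriv n x (fun r => ⟪X r, covDeriv n x Y r (b a)⟫_ℝ) p (b a) -
      tangentialDeriv n x (fun r => ⟪Y r, covDeriv n x X r (b a)⟫_ℝ) p (b a) := fun a => by
    rw [tangentialDeriv_sub (h1 a) (h2 a), sub_apply]
  simp only [h4, mul_sub, Finset.sum_sub_distrib]
  have h5 : ∑ a, ⟪covDeriv n x Y p (b a), covDeriv n x X p (b a)⟫_ℝ =
      ∑ a, ⟪covDeriv n x X p (b a), covDeriv n x Y p (b a)⟫_ℝ :=
    Finset.sum_congr rfl fun a _ => real_inner_comm _ _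
  have h6 : ∑ a, ⟪tangentialPart n x p (derivProj n x p (b a) (Y p)),
        tangentialPart n x p (derivProj n x p (b a) (X p))⟫_ℝ =
      ∑ a, ⟪tangentialPart n x p (derivProj n x p (b a) (X p)),
        tangentialPart n x p (derivProj n x p (b a) (Y p))⟫_ℝ :=
    Finset.sum_congr rfl fun a _ => real_inner_comm _ _
  rw [h5, h6, real_inner_comm (X p) (Y p)]
  ring

theorem sum_inner_tangentialPart (hx : IsSmoothImmersion n x) (p : M) :
    ∑ a, ⟪tangentialPart n x p (b a), b a⟫_ℝ = n := by
  have h1 : ∑ a, ⟪tangentialPart n x p (b a), b a⟫_ℝ =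
      LinearMap.trace ℝ V (tangentialPart n x p).toLinearMap := by
    rw [LinearMap.trace_eq_sum_inner _ b]
    exact Finset.sum_congr rfl fun a _ => real_inner_comm _ _
  have h2 : LinearMap.IsProj (tangentPlane n x p) (tangentialPart n x p).toLinearMap :=
    ⟨fun v => Submodule.starProjection_apply_mem _ _,
      fun v hv => Submodule.starProjection_eq_self_iff.2 hv⟩
  rw [h1, h2.trace]
  have h3 : Module.finrank ℝ (tangentPlane n x p) = n :=
    (LinearMap.finrank_range_of_inj (f := (differential n x p).toLinearMap)
      (differential_injective hx p)).trans finrank_euclideanSpace_fin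
  rw [h3]

/-- `⟨H, z⟩` is a combination of the weighted divergences of the tangential parts of `z`, `|y|² z`
and `⟨y, z⟩ y`, where `y = x - x₀`. -/
theorem integral_inner_meanCurvature (hx : IsSmoothImmersion n x)
    (hs : IsSelfShrinker n x x₀ t₀) (z : V) :
    ∫ p, ⟪meanCurvature n x p, z⟫_ℝ * gaussianWeight n x x₀ t₀ p ∂(inducedVolume n x) = 0 := by
  set b := stdOrthonormalBasis ℝ V
  set c : ℝ := 1 / (2 * t₀) with hc
  have hconst : ∀ v : V, ContMDiff (𝓡 n) 𝓘(ℝ, V) ∞ (fun _ : M => v) := fun v => contMDiff_const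
  have hy : ContMDiff (𝓡 n) 𝓘(ℝ, V) ∞ (fun r => x r - x₀) := hx.1.sub contMDiff_const
  have hyv : ∀ v : V, ContMDiff (𝓡 n) 𝓘(ℝ, ℝ) ∞ (fun r => ⟪x r - x₀, v⟫_ℝ) := fun v =>
    hy.inner_space (hconst v)
  have hdyv : ∀ p v w, tangentialDeriv n x (fun r => ⟪x r - x₀, v⟫_ℝ) p w =
      ⟪tangentialPart n x p w, v⟫_ℝ := fun p v w => by
    rw [tangentialDeriv_inner hx hy (hconst v), tangentialDeriv_position hx, tangentialDeriv_const]
    simp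
  have I0 := integral_weighted_divergence hx hs (contMDiff_const (c := (1 : ℝ))) z
  have I1 := integral_weighted_divergence hx hs (hy.inner_space hy) z
  have I2 := integral_sum_weighted_divergence b hx hs
    (f := fun a r => ⟪x r - x₀, z⟫_ℝ * ⟪x r - x₀, b a⟫_ℝ) (fun a => (hyv z).mul (hyv (b a)))
  set D0 : M → ℝ := fun p => (tangentialDeriv n x (fun _ : M => (1 : ℝ)) p z -
    c * ⟪x p - x₀, z⟫_ℝ * 1) * gaussianWeight n x x₀ t₀ p with hD0
  set D1 : M → ℝ := fun p => (tangentialDeriv n x (fun r => ⟪x r - x₀, x r - x₀⟫_ℝ) p z -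
    c * ⟪x p - x₀, z⟫_ℝ * ⟪x p - x₀, x p - x₀⟫_ℝ) * gaussianWeight n x x₀ t₀ p with hD1
  set D2 : M → ℝ := fun p => (∑ a, (tangentialDeriv n x
    (fun r => ⟪x r - x₀, z⟫_ℝ * ⟪x r - x₀, b a⟫_ℝ) p (b a) -
      c * ⟪x p - x₀, b a⟫_ℝ * (⟪x p - x₀, z⟫_ℝ * ⟪x p - x₀, b a⟫_ℝ))) *
        gaussianWeight n x x₀ t₀ p with hD2
  -- Up to the weight, `D1 - D2` loses the cubic terms and equals `⟨y^⊤, z⟩ - n ⟨y, z⟩`; as `D0 = -c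
  -- ⟨y, z⟩`, the coefficient `1 - n` leaves `-c ⟨y^⊥, z⟩`.
  have key : ∀ p, ⟪meanCurvature n x p, z⟫_ℝ * gaussianWeight n x x₀ t₀ p =
      (1 - n) * D0 p + c * D1 p - c * D2 p := fun p => by
    have hH : meanCurvature n x p = -(c • normalPart n x p (x p - x₀)) :=
      eq_neg_of_add_eq_zero_left (hs p)
    have e1 : tangentialDeriv n x (fun r => ⟪x r - x₀, x r - x₀⟫_ℝ) p z =
        2 * ⟪tangentialPart n x p (x p - x₀), z⟫_ℝ := by
      rw [tangentialDeriv_inner hx hy hy, tangentialDeriv_position hx, tangentialPart_symm x p _ z,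
        real_inner_comm (x p - x₀) (tangentialPart n x p z), two_mul]
    have e2 : ∀ a, tangentialDeriv n x (fun r => ⟪x r - x₀, z⟫_ℝ * ⟪x r - x₀, b a⟫_ℝ) p (b a) =
        ⟪tangentialPart n x p z, b a⟫_ℝ * ⟪b a, x p - x₀⟫_ℝ +
          ⟪x p - x₀, z⟫_ℝ * ⟪tangentialPart n x p (b a), b a⟫_ℝ := fun a => by
      rw [tangentialDeriv_mul hx (hyv z) (hyv (b a)), hdyv, hdyv, tangentialPart_symm,
        real_inner_comm (tangentialPart n x p z), real_inner_comm (x p - x₀)]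
    have e3 : ∑ a, (tangentialDeriv n x
        (fun r => ⟪x r - x₀, z⟫_ℝ * ⟪x r - x₀, b a⟫_ℝ) p (b a) -
          c * ⟪x p - x₀, b a⟫_ℝ * (⟪x p - x₀, z⟫_ℝ * ⟪x p - x₀, b a⟫_ℝ)) =
        ⟪tangentialPart n x p (x p - x₀), z⟫_ℝ + ⟪x p - x₀, z⟫_ℝ * n -
          c * ⟪x p - x₀, z⟫_ℝ * ⟪x p - x₀, x p - x₀⟫_ℝ := by
      have e4 : ∀ a, c * ⟪x p - x₀, b a⟫_ℝ * (⟪x p - x₀, z⟫_ℝ * ⟪x p - x₀, b a⟫_ℝ) =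
          c * ⟪x p - x₀, z⟫_ℝ * (⟪x p - x₀, b a⟫_ℝ * ⟪b a, x p - x₀⟫_ℝ) := fun a => by
        rw [real_inner_comm (x p - x₀) (b a)]; ring
      simp only [e2, e4]
      rw [Finset.sum_sub_distrib, Finset.sum_add_distrib, b.sum_inner_mul_inner, ← Finset.mul_sum,
        sum_inner_tangentialPart b hx, ← Finset.mul_sum, b.sum_inner_mul_inner,
        real_inner_comm (x p - x₀) (tangentialPart n x p z), ← tangentialPart_symm]
    rw [hD0, hD1, hD2]
    simp only [e1, e3]
    rw [hH, tangentialDeriv_const, inner_neg_left, real_inner_smul_left, normalPart_apply,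
      inner_sub_left (x p - x₀) (tangentialPart n x p (x p - x₀)), zero_apply]
    ring
  have hG := (contMDiff_gaussianWeight hx x₀ t₀).continuous
  have hyc : Continuous (fun r => x r - x₀) := hy.continuous
  have C0 : Continuous D0 :=
    (((contMDiff_tangentialDeriv hx contMDiff_const).continuous.clm_apply continuous_const).sub
      ((continuous_const.mul (hyv z).continuous).mul continuous_const)).mul hG
  have C1 : Continuous D1 :=
    (((contMDiff_tangentialDeriv hx (hy.inner_space hy)).continuous.clm_apply continuous_const).sub
      ((continuous_const.mul (hyv z).continuous).mul (hy.inner_space hy).continuous)).mul hG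
  have C2 : Continuous D2 :=
    (continuous_finsetSum _ fun a _ =>
      ((contMDiff_tangentialDeriv hx ((hyv z).mul (hyv (b a)))).continuous.clm_apply
        continuous_const).sub ((continuous_const.mul (hyv (b a)).continuous).mul
          ((hyv z).continuous.mul (hyv (b a)).continuous))).mul hG
  simp only [key]
  rw [integral_sub, integral_add, integral_const_mul, integral_const_mul, integral_const_mul,
    I0, I1, I2]
  · simp
  · exact (integrable_inducedVolume hx C0).const_mul _
  · exact (integrable_inducedVolume hx C1).const_mul _
  · exact ((integrable_inducedVolume hx C0).const_mul _).add
      ((integrable_inducedVolume hx C1).const_mul _)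
  · exact (integrable_inducedVolume hx C2).const_mul _

/-- A Liouville type argument: on a closed self-shrinker on whose tangent planes the skew form
`⟪J v, w⟫` vanishes, the form `⟪J (x - x₀), dx⟫` is exact only if it is zero. -/
theorem tangentialPart_eq_zero_of_exact (hx : IsSmoothImmersion n x) (ht₀ : 0 < t₀)
    (hs : IsSelfShrinker n x x₀ t₀) (J : V →L[ℝ] V) (hJ : ∀ v, ⟪J v, v⟫_ℝ = 0)
    (hlag : ∀ p v w, ⟪J (tangentialPart n x p v), tangentialPart n x p w⟫_ℝ = 0)
    {u : M → ℝ} (hu : ContMDiff (𝓡 n) 𝓘(ℝ, ℝ) ∞ u)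
    (hdu : ∀ p v, tangentialDeriv n x u p v = ⟪J (x p - x₀), tangentialPart n x p v⟫_ℝ) (p : M) :
    tangentialPart n x p (J (x p - x₀)) = 0 := by
  set b := stdOrthonormalBasis ℝ V
  set c : ℝ := 1 / (2 * t₀) with hc
  have hconst : ∀ v : V, ContMDiff (𝓡 n) 𝓘(ℝ, V) ∞ (fun _ : M => v) := fun v => contMDiff_const
  have hP := contMDiff_tangentialPart hx
  have hy : ContMDiff (𝓡 n) 𝓘(ℝ, V) ∞ (fun r => x r - x₀) := hx.1.sub contMDiff_const
  have hJy : ContMDiff (𝓡 n) 𝓘(ℝ, V) ∞ (fun r => J (x r - x₀)) := J.contDiff.comp_contMDiff hy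
  have hg : ∀ v : V, ContMDiff (𝓡 n) 𝓘(ℝ, ℝ) ∞
      (fun r => ⟪J (x r - x₀), tangentialPart n x r v⟫_ℝ) := fun v =>
    hJy.inner_space (hP.clm_apply (hconst v))
  have I := integral_sum_weighted_divergence b hx hs
    (f := fun a r => u r * ⟪J (x r - x₀), tangentialPart n x r (b a)⟫_ℝ)
    (fun a => hu.mul (hg (b a)))
  -- `(J y)^⊤` has zero weighted divergence: the term `⟨J e_i, e_i⟩` vanishes, and the contribution
  -- of `H` cancels the drift because `⟨J y, y⟩ = 0`. Only the derivative of `u` remains.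
  have key : ∀ p, ∑ a, (tangentialDeriv n x
      (fun r => u r * ⟪J (x r - x₀), tangentialPart n x r (b a)⟫_ℝ) p (b a) -
        c * ⟪x p - x₀, b a⟫_ℝ * (u p * ⟪J (x p - x₀), tangentialPart n x p (b a)⟫_ℝ)) =
      ‖tangentialPart n x p (J (x p - x₀))‖ ^ 2 := fun p => by
    have hH : meanCurvature n x p = -(c • normalPart n x p (x p - x₀)) :=
      eq_neg_of_add_eq_zero_left (hs p)
    have e1 : ∀ a, tangentialDeriv n x
        (fun r => u r * ⟪J (x r - x₀), tangentialPart n x r (b a)⟫_ℝ) p (b a) =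
        ⟪tangentialPart n x p (J (x p - x₀)), b a⟫_ℝ *
          ⟪b a, tangentialPart n x p (J (x p - x₀))⟫_ℝ +
        u p * ⟪J (x p - x₀), derivProj n x p (b a) (b a)⟫_ℝ := fun a => by
      rw [tangentialDeriv_mul hx hu (hg (b a)), hdu,
        tangentialDeriv_inner hx hJy (hP.clm_apply (hconst (b a))),
        tangentialDeriv_clm_apply_const hx hP]
      have e2 : tangentialDeriv n x (fun r => J (x r - x₀)) p (b a) =
          J (tangentialPart n x p (b a)) := by
        rw [tangentialDeriv_comp hx J.contDiff hy, J.fderiv, tangentialDeriv_position hx]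
      rw [e2, hlag, ← tangentialPart_symm, zero_add, real_inner_comm (b a)]
    have e3 : ∀ a, c * ⟪x p - x₀, b a⟫_ℝ * (u p * ⟪J (x p - x₀), tangentialPart n x p (b a)⟫_ℝ) =
        c * u p * (⟪x p - x₀, b a⟫_ℝ * ⟪b a, tangentialPart n x p (J (x p - x₀))⟫_ℝ) := fun a => by
      rw [← tangentialPart_symm,
        real_inner_comm (b a) (tangentialPart n x p (J (x p - x₀)))]
      ring
    have e4 : ⟪J (x p - x₀), normalPart n x p (x p - x₀)⟫_ℝ =
        -⟪x p - x₀, tangentialPart n x p (J (x p - x₀))⟫_ℝ := by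
      rw [normalPart_apply, inner_sub_right _ _ (tangentialPart n x p (x p - x₀)), hJ,
        ← tangentialPart_symm x p (J (x p - x₀)), real_inner_comm (x p - x₀), zero_sub]
    simp only [e1, e3]
    rw [Finset.sum_sub_distrib, Finset.sum_add_distrib, b.sum_inner_mul_inner, ← Finset.mul_sum,
      ← Finset.mul_sum, b.sum_inner_mul_inner, ← inner_sum, ← meanCurvature_eq_sum b hx, hH,
      inner_neg_right, real_inner_smul_right, e4, real_inner_self_eq_norm_sq]
    ring
  rw [← hc] at I
  simp only [key] at I
  have hcont : Continuous (fun p => ‖tangentialPart n x p (J (x p - x₀))‖ ^ 2 *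
      gaussianWeight n x x₀ t₀ p) :=
    ((hP.clm_apply hJy).continuous.norm.pow 2).mul (contMDiff_gaussianWeight hx x₀ t₀).continuous
  have hnn : ∀ p, 0 ≤ ‖tangentialPart n x p (J (x p - x₀))‖ ^ 2 *
      gaussianWeight n x x₀ t₀ p := fun p =>
    mul_nonneg (sq_nonneg _) (gaussianWeight_pos x x₀ ht₀ p).le
  have hpos := isOpenPosMeasure_inducedVolume hx
  rw [integral_eq_zero_iff_of_nonneg hnn (integrable_inducedVolume hx hcont)] at I
  have h0 := congrFun (hcont.ae_eq_iff_eq (inducedVolume n x) continuous_const |>.1 I) p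
  have h1 : ‖tangentialPart n x p (J (x p - x₀))‖ ^ 2 * gaussianWeight n x x₀ t₀ p = 0 := h0
  rcases mul_eq_zero.1 h1 with h | h
  · simpa using h
  · exact absurd h (gaussianWeight_pos x x₀ ht₀ p).ne'

/-- A closed self-shrinker whose position vector is tangent everywhere is a point. -/
theorem eq_of_normalPart_position_eq_zero (hx : IsSmoothImmersion n x)
    (h : ∀ p, normalPart n x p (x p - x₀) = 0) (p : M) : x p = x₀ := by
  have hy : ContMDiff (𝓡 n) 𝓘(ℝ, V) ∞ (fun r => x r - x₀) := hx.1.sub contMDiff_const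
  have hf := hy.inner_space hy
  obtain ⟨q, -, hq⟩ := isCompact_univ.exists_isMaxOn ⟨p, Set.mem_univ p⟩ hf.continuous.continuousOn
  have hmax : ∀ r, ⟪x r - x₀, x r - x₀⟫_ℝ ≤ ⟪x q - x₀, x q - x₀⟫_ℝ := fun r => hq (Set.mem_univ r)
  -- At the maximum, the derivative of `|y|²` along `y` is `2 |y|²`, since `y` is tangent there.
  have h1 := tangentialDeriv_eq_zero_of_isMax hx hf hmax
  have h2 := tangentialDeriv_inner hx hy hy q (x q - x₀)
  rw [h1, tangentialDeriv_position hx] at h2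
  have h3 : tangentialPart n x q (x q - x₀) = x q - x₀ := by
    have := h q
    rw [normalPart_apply, sub_eq_zero] at this
    exact this.symm
  rw [h3, zero_apply] at h2
  have h4 : ⟪x q - x₀, x q - x₀⟫_ℝ = 0 := by linarith
  have h5 := hmax p
  rw [h4] at h5
  have h6 : ⟪x p - x₀, x p - x₀⟫_ℝ = 0 := le_antisymm h5 real_inner_self_nonneg
  exact sub_eq_zero.1 (inner_self_eq_zero.1 h6)

end SelfAdjointness

/-! ### Invariance of the second variation along `H`. -/

section SecondVariation

variable {n : ℕ} {M : Type*} [TopologicalSpace M] [ChartedSpace (EuclideanSpace ℝ (Fin n)) M]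
  [IsManifold (𝓡 n) ∞ M]
  {V : Type*} [NormedAddCommGroup V] [InnerProductSpace ℝ V] [FiniteDimensional ℝ V]
  {x : M → V} {x₀ : V} {t₀ : ℝ}
  [MeasurableSpace M] [BorelSpace M] [T2Space M] [CompactSpace M]

theorem continuous_secondVariation_integrand (hx : IsSmoothImmersion n x) {X : M → V}
    (hX : ContMDiff (𝓡 n) 𝓘(ℝ, V) ∞ X) (x₀ : V) (t₀ : ℝ) (y : V) (h : ℝ) :
    Continuous (fun p => (-⟪X p, jacobiOperator n x x₀ t₀ X p⟫_ℝ
      + (1 / t₀) * ⟪X p, y⟫_ℝ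
      - (2 / t₀) * h * ⟪X p, meanCurvature n x p⟫_ℝ
      - (1 / (2 * t₀)) * ‖normalPart n x p y‖ ^ 2
      - (1 / t₀) * h ^ 2 * ‖meanCurvature n x p‖ ^ 2) * gaussianWeight n x x₀ t₀ p) := by
  have h1 := (contMDiff_jacobiOperator hx hX x₀ t₀).continuous
  have h2 := (contMDiff_meanCurvature hx).continuous
  have h3 : Continuous (fun p => normalPart n x p y) :=
    (contMDiff_normalPart hx).continuous.clm_apply continuous_const
  have h4 := (contMDiff_gaussianWeight hx x₀ t₀).continuous
  have h5 := hX.continuous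
  fun_prop

/-- Adding a multiple of the mean curvature to the variation amounts to a shift of the velocity of
the extinction time. -/
theorem secondVariation_add_smul_meanCurvature (hx : IsSmoothImmersion n x) (ht₀ : t₀ ≠ 0)
    (hs : IsSelfShrinker n x x₀ t₀) {X : M → V} (hX : IsNormalField n x X) (c : ℝ) (y : V)
    (h : ℝ) :
    secondVariation n x x₀ t₀ (fun r => X r + c • meanCurvature n x r) y (h - c) =
      secondVariation n x x₀ t₀ X y h := by
  have hHn := isNormalField_meanCurvature hx
  have hH := contMDiff_meanCurvature hx
  have hG := (contMDiff_gaussianWeight hx x₀ t₀).continuous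
  have I1 := integral_inner_jacobiOperator_symm hx hs hX hHn
  have I2 := integral_inner_meanCurvature hx hs y
  have C1 : Continuous (fun p => (⟪X p, jacobiOperator n x x₀ t₀ (meanCurvature n x) p⟫_ℝ -
      ⟪meanCurvature n x p, jacobiOperator n x x₀ t₀ X p⟫_ℝ) * gaussianWeight n x x₀ t₀ p) :=
    ((hX.1.inner_space (contMDiff_jacobiOperator hx hH x₀ t₀)).continuous.sub
      (hH.inner_space (contMDiff_jacobiOperator hx hX.1 x₀ t₀)).continuous).mul hG
  have C2 : Continuous (fun p => ⟪meanCurvature n x p, y⟫_ℝ * gaussianWeight n x x₀ t₀ p) :=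
    (hH.inner_space contMDiff_const).continuous.mul hG
  have C3 := continuous_secondVariation_integrand hx hX.1 x₀ t₀ y h
  -- With `L H = H / t₀` the terms in `|H|²` combine to `-h² / t₀`, and the cross terms reduce to
  -- the antisymmetric pairing of `X` and `H`. The two added terms integrate to zero.
  have key : ∀ p, (-⟪X p + c • meanCurvature n x p,
        jacobiOperator n x x₀ t₀ (fun r => X r + c • meanCurvature n x r) p⟫_ℝ
      + (1 / t₀) * ⟪X p + c • meanCurvature n x p, y⟫_ℝ
      - (2 / t₀) * (h - c) * ⟪X p + c • meanCurvature n x p, meanCurvature n x p⟫_ℝ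
      - (1 / (2 * t₀)) * ‖normalPart n x p y‖ ^ 2
      - (1 / t₀) * (h - c) ^ 2 * ‖meanCurvature n x p‖ ^ 2) * gaussianWeight n x x₀ t₀ p =
      (-⟪X p, jacobiOperator n x x₀ t₀ X p⟫_ℝ
      + (1 / t₀) * ⟪X p, y⟫_ℝ
      - (2 / t₀) * h * ⟪X p, meanCurvature n x p⟫_ℝ
      - (1 / (2 * t₀)) * ‖normalPart n x p y‖ ^ 2
      - (1 / t₀) * h ^ 2 * ‖meanCurvature n x p‖ ^ 2) * gaussianWeight n x x₀ t₀ p +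
      c * ((⟪X p, jacobiOperator n x x₀ t₀ (meanCurvature n x) p⟫_ℝ -
        ⟪meanCurvature n x p, jacobiOperator n x x₀ t₀ X p⟫_ℝ) * gaussianWeight n x x₀ t₀ p) +
      (c / t₀) * (⟪meanCurvature n x p, y⟫_ℝ * gaussianWeight n x x₀ t₀ p) := fun p => by
    rw [jacobiOperator_add_smul hx hX.1 hH, jacobiOperator_meanCurvature hx ht₀ hs]
    simp only [inner_add_left, inner_add_right, real_inner_smul_left, real_inner_smul_right,
      real_inner_self_eq_norm_sq]
    ring
  unfold secondVariation
  simp only [key]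
  rw [integral_add, integral_add, integral_const_mul, integral_const_mul, I1, I2]
  · simp
  · exact integrable_inducedVolume hx C3
  · exact (integrable_inducedVolume hx C1).const_mul _
  · exact (integrable_inducedVolume hx C3).add ((integrable_inducedVolume hx C1).const_mul _)
  · exact (integrable_inducedVolume hx C2).const_mul _

end SecondVariation

/-! ### Closed forms and the line of classes. -/

section ClosedForms

variable {n : ℕ} {M : Type*} [TopologicalSpace M] [ChartedSpace (EuclideanSpace ℝ (Fin n)) M]
  [IsManifold (𝓡 n) ∞ M]

/-- Exact one-forms are closed. -/
theorem IsExactForm.isClosedForm {θ : OneForm n M} (hθ : IsExactForm n θ) : IsClosedForm n θ := by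
  obtain ⟨u, hu, hdu⟩ := hθ
  intro q
  have ho := (chartAt (EuclideanSpace ℝ (Fin n)) q).open_target
  have h1 : Set.EqOn (chartForm n θ q)
      (fderiv ℝ (u ∘ (chartAt (EuclideanSpace ℝ (Fin n)) q).symm))
      (chartAt (EuclideanSpace ℝ (Fin n)) q).target := fun s hs => by
    ext v
    rw [fderiv_comp_chart_symm hu q hs, ← hdu]
    rfl
  refine ⟨((contDiffOn_comp_chart_symm hu q).fderiv_of_isOpen ho (by simp)).congr h1,
    fun s hs v w => ?_⟩
  have h2 : chartForm n θ q =ᶠ[nhds s]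
      fderiv ℝ (u ∘ (chartAt (EuclideanSpace ℝ (Fin n)) q).symm) := by
    filter_upwards [ho.mem_nhds hs] with r hr using h1 hr
  rw [h2.fderiv_eq, sub_eq_zero]
  refine (contDiffAt_comp_chart_symm hu q hs).isSymmSndFDerivAt ?_ v w
  rw [minSmoothness_of_isRCLikeNormedField]
  exact WithTop.coe_le_coe.2 le_top

/-- A one-form whose pullback is `⟪J (x - x₀), dx⟫` is closed if the skew form `⟪J v, w⟫` vanishes
on tangent planes. -/
theorem isClosedForm_liouville {V : Type*} [NormedAddCommGroup V] [InnerProductSpace ℝ V]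
    [FiniteDimensional ℝ V] {x : M → V} (hx : IsSmoothImmersion n x) (x₀ : V) (J : V →L[ℝ] V)
    (hlag : ∀ p, ∀ v ∈ tangentPlane n x p, ∀ w ∈ tangentPlane n x p, ⟪J v, w⟫_ℝ = 0)
    {θ : OneForm n M}
    (hθ : ∀ p, θ p = (innerSL ℝ (J (x p - x₀))).comp (differential n x p)) :
    IsClosedForm n θ := by
  intro q
  set φ := (chartAt (EuclideanSpace ℝ (Fin n)) q).symm with hφ
  have ho := (chartAt (EuclideanSpace ℝ (Fin n)) q).open_target
  have h1 : Set.EqOn (chartForm n θ q)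
      (fun s => (innerSL ℝ (J ((x ∘ φ) s - x₀))).comp (fderiv ℝ (x ∘ φ) s))
      (chartAt (EuclideanSpace ℝ (Fin n)) q).target := fun s hs => by
    ext v
    have h2 := fderiv_comp_chart_symm hx.1 q hs v
    rw [← hφ] at h2
    rw [ContinuousLinearMap.comp_apply, h2]
    show θ (φ s) (mfderiv (𝓡 n) (𝓡 n) φ s v) = _
    rw [hθ]
    rfl
  have hF := contDiffOn_comp_chart_symm hx.1 q
  have hF' := hF.fderiv_of_isOpen (m := ∞) ho (by simp)
  rw [← hφ] at hF hF'
  have hL : ContDiff ℝ ∞ (fun v : V => innerSL ℝ (J (v - x₀))) :=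
    (innerSL ℝ (E := V)).contDiff.comp (J.contDiff.comp (contDiff_id.sub contDiff_const))
  refine ⟨((hL.comp_contDiffOn hF).clm_comp hF').congr h1, fun s hs v w => ?_⟩
  have h2 : chartForm n θ q =ᶠ[nhds s]
      (fun s => (innerSL ℝ (J ((x ∘ φ) s - x₀))).comp (fderiv ℝ (x ∘ φ) s)) := by
    filter_upwards [ho.mem_nhds hs] with r hr using h1 hr
  have hd1 : HasFDerivAt (x ∘ φ) (fderiv ℝ (x ∘ φ) s) s :=
    ((hF.contDiffAt (ho.mem_nhds hs)).differentiableAt (by simp)).hasFDerivAt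
  have hd2 : HasFDerivAt (fderiv ℝ (x ∘ φ)) (fderiv ℝ (fderiv ℝ (x ∘ φ)) s) s :=
    ((hF'.contDiffAt (ho.mem_nhds hs)).differentiableAt (by simp)).hasFDerivAt
  have hd3 : HasFDerivAt (fun s => innerSL ℝ (J ((x ∘ φ) s - x₀)))
      ((innerSL ℝ (E := V)).comp (J.comp (fderiv ℝ (x ∘ φ) s))) s :=
    (innerSL ℝ (E := V)).hasFDerivAt.comp s (J.hasFDerivAt.comp s (hd1.sub_const x₀))
  have hsymm : fderiv ℝ (fderiv ℝ (x ∘ φ)) s v w = fderiv ℝ (fderiv ℝ (x ∘ φ)) s w v := by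
    refine (contDiffAt_comp_chart_symm hx.1 q hs).isSymmSndFDerivAt ?_ v w
    rw [minSmoothness_of_isRCLikeNormedField]
    exact WithTop.coe_le_coe.2 le_top
  have hmem : ∀ v, fderiv ℝ (x ∘ φ) s v ∈ tangentPlane n x (φ s) := fun v => by
    rw [hφ, tangentPlane_chart hx q hs]
    exact ⟨v, rfl⟩
  -- The product rule gives a second term, the skew form on two tangent vectors, which vanishes by
  -- `hlag`. What remains is symmetric in `v` and `w`.
  have h3 : ∀ v w, fderiv ℝ (chartForm n θ q) s v w =
      ⟪J ((x ∘ φ) s - x₀), fderiv ℝ (fderiv ℝ (x ∘ φ)) s v w⟫_ℝ := fun v w => by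
    rw [h2.fderiv_eq, (hd3.clm_comp hd2).fderiv]
    have h4 := hlag (φ s) _ (hmem v) _ (hmem w)
    change ⟪J ((x ∘ φ) s - x₀), fderiv ℝ (fderiv ℝ (x ∘ φ)) s v w⟫_ℝ +
      ⟪J (fderiv ℝ (x ∘ φ) s v), fderiv ℝ (x ∘ φ) s w⟫_ℝ = _
    rw [h4, add_zero]
  rw [h3, h3, hsymm, sub_self]

/-- A nonzero class spans a one-dimensional quotient. Applied with closed forms as `Z`, exact forms
as `B` and the form of `H` as `θ`. -/
theorem finrank_map_mkQ_eq_one {K F : Type*} [Field K] [AddCommGroup F] [Module K F]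
    {Z B : Submodule K F} (h : Module.finrank K (Z.map B.mkQ) = 1) {θ : F} (hθ : θ ∈ Z)
    (hθ' : θ ∉ B) {η : F} (hη : η ∈ Z) : ∃ c : K, η - c • θ ∈ B := by
  have hne : (⟨B.mkQ θ, Submodule.mem_map_of_mem hθ⟩ : Z.map B.mkQ) ≠ 0 := fun h0 =>
    hθ' ((Submodule.Quotient.mk_eq_zero B).1 (congrArg Subtype.val h0))
  obtain ⟨c, hc⟩ := (finrank_eq_one_iff_of_nonzero' _ hne).1 h
    ⟨B.mkQ η, Submodule.mem_map_of_mem hη⟩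
  refine ⟨c, ?_⟩
  have h1 : c • B.mkQ θ = B.mkQ η := congrArg Subtype.val hc
  rw [← map_smul] at h1
  exact (Submodule.Quotient.eq B).1 h1.symm

end ClosedForms

/-! ### Lagrangian planes and the cohomology class of the mean curvature form. -/

section Lagrangian

variable {n : ℕ}

/-- The complex structure as a real linear map. -/
def complexStructure (n : ℕ) : EuclideanSpace ℂ (Fin n) →L[ℝ] EuclideanSpace ℂ (Fin n) :=
  Complex.I • ContinuousLinearMap.id ℝ (EuclideanSpace ℂ (Fin n))

theorem complexStructure_apply (v : EuclideanSpace ℂ (Fin n)) :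
    complexStructure n v = Complex.I • v := rfl

theorem inner_complexStructure_self (v : EuclideanSpace ℂ (Fin n)) :
    ⟪complexStructure n v, v⟫_ℝ = 0 := by
  rw [complexStructure_apply, PiLp.inner_apply]
  refine Finset.sum_eq_zero fun i _ => ?_
  simp [Complex.inner, mul_comm]

theorem complexStructure_complexStructure (v : EuclideanSpace ℂ (Fin n)) :
    complexStructure n (complexStructure n v) = -v := by
  rw [complexStructure_apply, complexStructure_apply, smul_smul, Complex.I_mul_I, neg_smul,
    one_smul]

/-- The complex structure maps the normal spaces of a Lagrangian subspace into the subspace. -/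
theorem complexStructure_mem_of_mem_orthogonal {T : Submodule ℝ (EuclideanSpace ℂ (Fin n))}
    (hT : Module.finrank ℝ T = n)
    (hlag : ∀ v ∈ T, ∀ w ∈ T, ⟪complexStructure n v, w⟫_ℝ = 0) {z : EuclideanSpace ℂ (Fin n)}
    (hz : z ∈ Tᗮ) : complexStructure n z ∈ T := by
  have hinj : Function.Injective (complexStructure n) := by
    rw [injective_iff_map_eq_zero]
    intro v hv
    have := complexStructure_complexStructure v
    rw [hv, map_zero] at this
    exact neg_eq_zero.1 this.symm
  have hle : T.map (complexStructure n).toLinearMap ≤ Tᗮ := by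
    rintro _ ⟨v, hv, rfl⟩
    rw [Submodule.mem_orthogonal]
    intro w hw
    rw [real_inner_comm]
    exact hlag v hv w hw
  have hdim : Module.finrank ℝ (EuclideanSpace ℂ (Fin n)) = 2 * n := by
    rw [← Module.finrank_mul_finrank ℝ ℂ (EuclideanSpace ℂ (Fin n)), Complex.finrank_real_complex,
      finrank_euclideanSpace_fin]
  have h1 := Submodule.finrank_add_finrank_orthogonal T
  have h2 : Module.finrank ℝ (T.map (complexStructure n).toLinearMap) = n :=
    (LinearEquiv.finrank_eq (Submodule.equivMapOfInjective _ hinj T)).symm.trans hT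
  -- `J T` lies in the normal space and both have real dimension `n`, so they coincide; then `J² =
  -- -1` maps it back to `T`.
  have heq := Submodule.eq_of_le_of_finrank_eq hle (by omega)
  rw [← heq] at hz
  obtain ⟨v, hv, rfl⟩ := hz
  have : complexStructure n ((complexStructure n).toLinearMap v) = -v :=
    complexStructure_complexStructure v
  rw [this]
  exact T.neg_mem hv

variable {M : Type*} [TopologicalSpace M] [ChartedSpace (EuclideanSpace ℝ (Fin n)) M]
  [IsManifold (𝓡 n) ∞ M] {x : M → EuclideanSpace ℂ (Fin n)} {x₀ : EuclideanSpace ℂ (Fin n)}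
  {t₀ : ℝ}

theorem finrank_tangentPlane (hx : IsSmoothImmersion n x) (p : M) :
    Module.finrank ℝ (tangentPlane n x p) = n :=
  (LinearMap.finrank_range_of_inj (f := (differential n x p).toLinearMap)
    (differential_injective hx p)).trans finrank_euclideanSpace_fin

theorem variationForm_sub_smul (x X Y : M → EuclideanSpace ℂ (Fin n)) (c : ℝ) :
    variationForm n x (fun r => X r + (-c) • Y r) =
      variationForm n x X - c • variationForm n x Y := by
  funext p
  ext v
  show -⟪complexStructure n (X p + (-c) • Y p), differential n x p v⟫_ℝ =
    -⟪complexStructure n (X p), differential n x p v⟫_ℝ -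
      c • (-⟪complexStructure n (Y p), differential n x p v⟫_ℝ)
  rw [map_add, map_smul, inner_add_left, real_inner_smul_left, smul_eq_mul]
  ring

/-- On a Lagrangian self-shrinker the form `-i_H ω` is a multiple of the Liouville form. -/
theorem variationForm_meanCurvature (hlag : IsLagrangian n x)
    (hs : IsSelfShrinker n x x₀ t₀) (p : M) :
    variationForm n x (meanCurvature n x) p =
      (innerSL ℝ (((1 / (2 * t₀)) • complexStructure n) (x p - x₀))).comp (differential n x p) := by
  have hH : meanCurvature n x p = -((1 / (2 * t₀)) • normalPart n x p (x p - x₀)) :=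
    eq_neg_of_add_eq_zero_left (hs p)
  ext v
  show -⟪complexStructure n (meanCurvature n x p), differential n x p v⟫_ℝ =
    ⟪(1 / (2 * t₀)) • complexStructure n (x p - x₀), differential n x p v⟫_ℝ
  -- By the Lagrangian condition, `y^⊥` can be replaced by the whole of `y`.
  have h0 : ⟪complexStructure n (tangentialPart n x p (x p - x₀)), differential n x p v⟫_ℝ = 0 :=
    hlag p _ (Submodule.starProjection_apply_mem _ _) _ ⟨v, rfl⟩
  rw [hH, normalPart_apply, map_neg, map_smul, map_sub _ (x p - x₀), inner_neg_left,
    real_inner_smul_left, real_inner_smul_left, inner_sub_left, h0]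
  ring

theorem isClosedForm_variationForm_meanCurvature (hx : IsSmoothImmersion n x)
    (hlag : IsLagrangian n x) (hs : IsSelfShrinker n x x₀ t₀) :
    IsClosedForm n (variationForm n x (meanCurvature n x)) := by
  refine isClosedForm_liouville hx x₀ ((1 / (2 * t₀)) • complexStructure n) (fun p v hv w hw => ?_)
    (variationForm_meanCurvature hlag hs)
  have h := hlag p v hv w hw
  rw [smul_apply, real_inner_smul_left]
  exact mul_eq_zero_of_right _ h

variable [MeasurableSpace M] [BorelSpace M] [T2Space M] [CompactSpace M]

/-- The class of `-i_H ω` on a closed Lagrangian self-shrinker with `b₁ ≠ 0` is not zero. -/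
theorem not_isExactForm_variationForm_meanCurvature (hx : IsSmoothImmersion n x)
    (hlag : IsLagrangian n x) (ht₀ : 0 < t₀) (hs : IsSelfShrinker n x x₀ t₀)
    (hb : firstBettiNumber n M ≠ 0) :
    ¬ IsExactForm n (variationForm n x (meanCurvature n x)) := by
  rintro ⟨u, hu, hdu⟩
  set J := (1 / (2 * t₀)) • complexStructure n with hJ
  have hc : (1 / (2 * t₀)) ≠ 0 := by positivity
  have hlag' : ∀ p v w, ⟪complexStructure n (tangentialPart n x p v),
      tangentialPart n x p w⟫_ℝ = 0 := fun p v w =>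
    hlag p _ (Submodule.starProjection_apply_mem _ _) _ (Submodule.starProjection_apply_mem _ _)
  have h1 : ∀ p, tangentialPart n x p (J (x p - x₀)) = 0 := by
    refine tangentialPart_eq_zero_of_exact hx ht₀ hs J (fun v => ?_) (fun p v w => ?_) hu
      (fun p v => ?_)
    · rw [hJ, smul_apply, real_inner_smul_left, inner_complexStructure_self, mul_zero]
    · rw [hJ, smul_apply, real_inner_smul_left, hlag', mul_zero]
    · have h2 := (hdu p).symm.trans (variationForm_meanCurvature hlag hs p)
      have h3 : differential n u p = (innerSL ℝ (J (x p - x₀))).comp (differential n x p) := h2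
      show differential n u p (pinv (differential n x p) v) = _
      rw [h3, ContinuousLinearMap.comp_apply, apply_pinv_differential hx]
      rfl
  -- `J y^⊤` is normal and `J y^⊥` is tangent, so `(J y)^⊤ = 0` says `J y^⊥ = 0`.
  have h2 : ∀ p, normalPart n x p (x p - x₀) = 0 := fun p => by
    have hmem : complexStructure n (normalPart n x p (x p - x₀)) ∈ tangentPlane n x p :=
      complexStructure_mem_of_mem_orthogonal (finrank_tangentPlane hx p) (hlag p)
        (Submodule.starProjection_apply_mem _ _)
    have h3 : tangentialPart n x p (complexStructure n (normalPart n x p (x p - x₀))) =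
        complexStructure n (normalPart n x p (x p - x₀)) :=
      Submodule.starProjection_eq_self_iff.2 hmem
    have h4 : tangentialPart n x p (complexStructure n (tangentialPart n x p (x p - x₀))) = 0 := by
      rw [← inner_self_eq_zero (𝕜 := ℝ), ← tangentialPart_symm, tangentialPart_idem,
        real_inner_comm]
      exact hlag' p _ _
    have h5 := h1 p
    rw [hJ, smul_apply, map_smul, smul_eq_zero_iff_right hc] at h5
    have h6 : complexStructure n (normalPart n x p (x p - x₀)) = 0 := by
      rw [← h3, normalPart_apply, map_sub, map_sub, h4, sub_zero, h5]
    have h7 := complexStructure_complexStructure (normalPart n x p (x p - x₀))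
    rw [h6, map_zero] at h7
    exact neg_eq_zero.1 h7.symm
  have h3 : x = fun _ => x₀ := funext (eq_of_normalPart_position_eq_zero hx h2)
  -- A constant immersion has trivial tangent spaces, so there are no nonzero one-forms and `b₁ =
  -- 0`.
  have hsub : ∀ p : M, Subsingleton (TangentSpace (𝓡 n) p) := fun p => ⟨fun v w => by
    refine hx.2 p ?_
    rw [h3, mfderiv_const]
    rfl⟩
  have hforms : Subsingleton (OneForm n M) := ⟨fun θ η => by
    funext p
    ext v
    have := hsub p
    rw [Subsingleton.elim v 0, map_zero, map_zero]⟩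
  refine hb ?_
  unfold firstBettiNumber
  have : Subsingleton ((closedForms n M).map (exactForms n M).mkQ) := ⟨by
    rintro ⟨_, θ, _, rfl⟩ ⟨_, η, _, rfl⟩
    exact Subtype.ext (congrArg (exactForms n M).mkQ (Subsingleton.elim θ η))⟩
  exact Module.finrank_zero_of_subsingleton

end Lagrangian

end

end LagrangianShrinker

/-! ### The equivalence of the two notions of stability. -/

theorem theorem1p2 (n : ℕ) (M : Type*) [TopologicalSpace M] [T2Space M] [CompactSpace M]
    [ChartedSpace (EuclideanSpace ℝ (Fin n)) M] [IsManifold (𝓡 n) ∞ M]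
    [MeasurableSpace M] [BorelSpace M]
    (x : M → EuclideanSpace ℂ (Fin n)) (x₀ : EuclideanSpace ℂ (Fin n)) (t₀ : ℝ) (ht₀ : 0 < t₀)
    (himm : LagrangianShrinker.IsSmoothImmersion n x)
    (hlag : LagrangianShrinker.IsLagrangian n x)
    (hshr : LagrangianShrinker.IsSelfShrinker n x x₀ t₀)
    (hb₁ : LagrangianShrinker.firstBettiNumber n M = 1) :
    LagrangianShrinker.IsLagrangianFStable n x x₀ t₀ ↔
      LagrangianShrinker.IsHamiltonianFStable n x x₀ t₀ := by
  refine ⟨fun h X hX => h X ⟨hX.1, hX.2.isClosedForm⟩, fun h X hX => ?_⟩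
  -- `c` is the coordinate of the class of `X` on the class of `H`, so `X - c H` is Hamiltonian.
  obtain ⟨c, hc⟩ := LagrangianShrinker.finrank_map_mkQ_eq_one hb₁
    (LagrangianShrinker.isClosedForm_variationForm_meanCurvature himm hlag hshr)
    (LagrangianShrinker.not_isExactForm_variationForm_meanCurvature himm hlag ht₀ hshr
      (by rw [hb₁]; exact one_ne_zero)) hX.2
  rw [← LagrangianShrinker.variationForm_sub_smul] at hc
  have hH := LagrangianShrinker.isNormalField_meanCurvature himm
  have hX₀ : LagrangianShrinker.IsNormalField n x
      (fun r => X r + (-c) • LagrangianShrinker.meanCurvature n x r) :=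
    ⟨hX.1.1.add (hH.1.const_smul_space (-c)), fun p =>
      Submodule.add_mem _ (hX.1.2 p) (Submodule.smul_mem _ _ (hH.2 p))⟩
  obtain ⟨y, k, hyk⟩ := h _ ⟨hX₀, hc⟩
  -- Restoring `c H` to the variation is compensated by lowering the velocity of the extinction time
  -- by `c`.
  refine ⟨y, k - c, ?_⟩
  rw [← LagrangianShrinker.secondVariation_add_smul_meanCurvature himm ht₀.ne' hshr hX₀ c y k] at hyk
  have hXeq : (fun r => X r + (-c) • LagrangianShrinker.meanCurvature n x r +
      c • LagrangianShrinker.meanCurvature n x r) = X := by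
    funext r
    module
  rwa [hXeq] at hyk
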